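/- **Setting.** Let $\mathcal G$ be a finite undirected connected graph on the agent set $\mathcal N=\{1,\dots,N\}$, $N\ge 1$. Write $\mathcal N_i^{k}$ for the set of agents at graph distance at most $k$ from $i$ (including $i$), $\mathcal N_i=\mathcal N_i^{1}$, and $M_k=\max_i|\mathcal N_i^{k}|$. Let $w_{il}=1/|\mathcal N_l|$ if $i\in\mathcal N_l$ and $w_{il}=0$ otherwise. Let $\kappa_p\ge 1$ and $d\ge 0$ be integers and $\gamma\in(0,1)$. Agent $i$ has a measurable local state space $\mathcal S_i$ and a measurable local action space $\mathcal A_i$, a local transition probability $\mathcal P_i(\cdot\mid s_i,a_i)$ on $\mathcal S_i$, and a measurable reward $r_i(s_{\mathcal N_i},a_{\mathcal N_i})$. The initial global state $\boldsymbol s_0$ has law $\boldsymbol\rho$. The global transition probability is $\prod_i\mathcal P_i(\cdot\mid s_i,a_i)$. The local policy $\pi_i(a_i\mid s_i,\boldsymbol\theta)>0$ is a probability density in $a_i$ with respect to a fixed $\sigma$-finite measure on $\mathcal A_i$ (the counting measure in the discrete case), jointly measurable in $(s_i,a_i,\boldsymbol\theta)$. It depends on $\boldsymbol\theta=(\theta_1,\dots,\theta_N)\in(\mathbb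 R^d)^N$ only through $(\theta_j)_{j\in\mathcal N_i^{\kappa_p}}$. The joint policy is $\boldsymbol\pi_{\boldsymbol\theta}(\boldsymbol a\mid\boldsymbol s)=\prod_i\pi_i(a_i\mid s_i,\boldsymbol\theta)$, and $$J(\boldsymbol\theta)=\mathbb E\Big[\tfrac1N\sum_{t=0}^\infty\sum_{i=1}^N\gamma^t r_{i,t}\;\Big|\;\boldsymbol s_0\sim\boldsymbol\rho,\ \boldsymbol a_t\sim\boldsymbol\pi_{\boldsymbol\theta}(\cdot\mid\boldsymbol s_t)\Big],\qquad r_{i,t}=r_i(s_{\mathcal N_i,t},a_{\mathcal N_i,t}).$$ All vector norms are Euclidean. **DSCP algorithm.** Given learning rates $(\eta_t)_{t\ge1}$, start from $\theta_{j,1}=\breve\theta^i_{j,1}=0$ and $p_{i,1}=1$. In iteration $t=1,2,\dots$: 1. Put $p_{i,t+1}=\sum_{l\in\mathcal N_i}w_{il}p_{l,t}$ and $\hat\theta^i_{j,t}=\frac1{p_{i,t+1}}\sum_{l\in\mathcal N_i}w_{il}\breve\theta^l_{j,t}$, and let $\hat{\boldsymbol\theta}^i_t=(\hat\theta^i_{1,t},\dots,\hat\theta^i_{N,t})$.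 2. Independently of the past and of each other, draw $T_1\sim\mathrm{Geom}(1-\gamma)$ and $T_2\sim\mathrm{Geom}(1-\gamma^{1/2})$ on $\{0,1,2,\dots\}$. Independently of $(T_1,T_2)$, draw a fresh trajectory $(\boldsymbol s_\tau,\boldsymbol a_\tau)_{\tau\ge0}$ with $\boldsymbol s_0\sim\boldsymbol\rho$, in which each agent $i$ executes $\pi_i(\cdot\mid s_i,\hat{\boldsymbol\theta}^i_t)$. 3. Put $$g_{i,t}=\frac1{1-\gamma}\Big(\frac1N\sum_{\tau=0}^{T_2}\gamma^{\tau/2}\sum_{j\in\mathcal N_i^{\kappa_p+1}}r_{j,T_1+\tau}\Big)\sum_{j\in\mathcal N_i^{\kappa_p}}\nabla_{\theta_i}\log\pi_j(a_{j,T_1}\mid s_{j,T_1},\hat{\boldsymbol\theta}^i_t).$$ 4. Put $\theta_{i,t+1}=\theta_{i,t}+\eta_t\,g_{i,t}$. 5. Put $\breve\theta^i_{j,t+1}=\sum_{l\in\mathcal N_i}w_{il}\breve\theta^l_{j,t}$, to which $w_{ij}N(\theta_{j,t+1}-\theta_{j,t})$ is added if $j\in\mathcal N_i$. **Theorem.**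 Let $R,B,C>0$ and $L\ge0$. Suppose that: - $|r_i|\le R$ for all $i$; - for all $i$, all $j\in\mathcal N_i^{\kappa_p}$ and all $(s_i,a_i)$, the gradient $\nabla_{\theta_j}\log\pi_i(a_i\mid s_i,\boldsymbol\theta)$ exists for every $\boldsymbol\theta$, is bounded in norm by $B$, and is $L$-Lipschitz in $\boldsymbol\theta$; - $0<\eta_t\le C/t$ for all $t\ge1$. Then $J$ is differentiable, and the random variables $\|\nabla J(\boldsymbol\theta_t)\|^2$, $t\ge1$, are integrable. There is a positive function $J_{\sup}$ of two non-negative integer arguments, strictly increasing in each of them and depending only on $\mathcal G,\gamma,R,B,L,C$ (not on $\kappa_p$, $d$, the spaces, the transition probabilities, rewards and policies, $\boldsymbol\rho$, or the learning rates), such that for all $T\ge2$ $$\frac{\mathbb E\big[\sum_{t=1}^{T-1}\eta_t\|\nabla J(\boldsymbol\theta_t)\|^2\big]}{\sum_{t=1}^{T-1}\eta_t}\le\frac{J_{\sup}(M_{\kappa_p},M_{\kappa_p+1})}{\sum_{t=1}^{T-1}\eta_t}.$$ If moreover $\sum_{t\ge1}\eta_t=\infty$, then $$\lim_{T\to\infty}\frac{\mathbb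 E\big[\sum_{t=1}^{T-1}\eta_t\|\nabla J(\boldsymbol\theta_t)\|^2\big]}{\sum_{t=1}^{T-1}\eta_t}=0.$$ -/

import Mathlib

open MeasureTheory ProbabilityTheory

namespace DSCP

set_option linter.unusedSectionVars false

noncomputable section

/-! ### The network -/

/-- The `k`-hop neighbourhood of agent `i`: all agents at graph distance at most `k` from `i`,
including `i` itself. The direct neighbourhood is the case `k = 1`. -/
def nbhd {ι : Type*} [Fintype ι] (G : SimpleGraph ι) (k : ℕ) (i : ι) : Finset ι :=
  open Classical in Finset.univ.filter fun j => G.edist i j ≤ k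

/-- The largest `k`-hop neighbourhood size. -/
def maxNbhd {ι : Type*} [Fintype ι] (G : SimpleGraph ι) (k : ℕ) : ℕ :=
  Finset.univ.sup fun i => (nbhd G k i).card

/-- The weight matrix: `w i l = 1 / |N_l|` if `i` is a direct neighbour of `l`, and `0` otherwise
(the network is undirected, so in- and out-neighbourhoods agree). -/
def weight {ι : Type*} [Fintype ι] (G : SimpleGraph ι) (i l : ι) : ℝ :=
  open Classical in if i ∈ nbhd G 1 l then 1 / ((nbhd G 1 l).card : ℝ) else 0

/-- Push-sum weights, with `pushSum G k i` the weight `p_{i,k+1}`; so `p_{i,1} = 1`. -/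
def pushSum {ι : Type*} [Fintype ι] (G : SimpleGraph ι) : ℕ → ι → ℝ
  | 0, _ => 1
  | k + 1, i => ∑ l ∈ nbhd G 1 i, weight G i l * pushSum G k l

/-! ### Policy parameters -/

/-- Joint policy parameters `θ = (θ_i)_i`, each `θ_i ∈ ℝ^d`, with the `ℓ²` norm. -/
abbrev Params (ι : Type*) (d : ℕ) : Type _ := PiLp 2 (fun _ : ι => EuclideanSpace ℝ (Fin d))

/-- `θ` with its `j`-th block replaced by `x`. -/
def setBlock {ι : Type*} [DecidableEq ι] {d : ℕ} (θ : Params ι d) (j : ι)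
    (x : EuclideanSpace ℝ (Fin d)) : Params ι d :=
  WithLp.toLp 2 (Function.update θ.ofLp j x)

/-! ### The model -/

/-- A networked multi-agent reinforcement learning problem over the graph `G`, with local state
spaces `S i`, local action spaces `A i`, policies coupled over `κ` hops, and local policy
parameters in `ℝ^d`. Policies are given by densities with respect to `σ`-finite reference measures
on the action spaces (the counting measure in the discrete case). -/
structure Model {ι : Type*} [Fintype ι] [DecidableEq ι] (G : SimpleGraph ι) (κ d : ℕ)
    (S A : ι → Type*) [∀ i, MeasurableSpace (S i)] [∀ i, MeasurableSpace (A i)] where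
  /-- Local transition probabilities `P_i(· | s_i, a_i)`. -/
  trans : ∀ i, Kernel (S i × A i) (S i)
  trans_markov : ∀ i, IsMarkovKernel (trans i)
  /-- Rewards; `r_i` depends only on the state-action pairs of the direct neighbours of `i`. -/
  reward : ι → (∀ i, S i) → (∀ i, A i) → ℝ
  reward_measurable : ∀ i, Measurable fun x : (∀ i, S i) × (∀ i, A i) => reward i x.1 x.2
  reward_local : ∀ i s s' a a', (∀ j ∈ nbhd G 1 i, s j = s' j) → (∀ j ∈ nbhd G 1 i, a j = a' j) →
    reward i s a = reward i s' a'
  /-- The distribution of the initial global state. -/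
  init : Measure (∀ i, S i)
  init_prob : IsProbabilityMeasure init
  /-- The discount factor. -/
  discount : ℝ
  discount_pos : 0 < discount
  discount_lt_one : discount < 1
  /-- Reference measures on the action spaces. -/
  ref : ∀ i, Measure (A i)
  ref_sigmaFinite : ∀ i, SigmaFinite (ref i)
  /-- Local policies `π_i(a_i | s_i, θ)`; they depend on `θ` only through the blocks of the
  `κ`-hop neighbours of `i`. -/
  policy : ∀ i, S i → A i → Params ι d → ℝ
  policy_pos : ∀ i s a θ, 0 < policy i s a θ
  policy_measurable : ∀ i, Measurable fun x : (S i × A i) × Params ι d => policy i x.1.1 x.1.2 x.2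
  policy_lintegral : ∀ i s θ, ∫⁻ a, ENNReal.ofReal (policy i s a θ) ∂(ref i) = 1
  policy_local : ∀ i s a θ θ', (∀ j ∈ nbhd G κ i, θ j = θ' j) → policy i s a θ = policy i s a θ'
  /-- The gradients `∇_{θ_j} log π_i`, `j` a `κ`-hop neighbour of `i`, exist. -/
  policy_diff : ∀ i, ∀ j ∈ nbhd G κ i, ∀ s a θ,
    DifferentiableAt ℝ (fun x => Real.log (policy i s a (setBlock θ j x))) (θ j)

/-- Product of finitely many Markov kernels with a common source. -/
def piKernel {ι X : Type*} [Fintype ι] [MeasurableSpace X] {Y : ι → Type*}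
    [∀ i, MeasurableSpace (Y i)] (k : ∀ i, Kernel X (Y i)) [∀ i, IsMarkovKernel (k i)] :
    Kernel X (∀ i, Y i) where
  toFun x := Measure.pi fun i => k i x
  measurable' := by
    refine Measurable.measure_of_isPiSystem_of_isProbabilityMeasure generateFrom_pi.symm
      isPiSystem_pi ?_
    rintro _ ⟨t, ht, rfl⟩
    simp only [Set.mem_pi, Set.mem_univ, true_implies, Set.mem_ofPred_eq] at ht
    simp only [Measure.pi_pi]
    exact Finset.measurable_prod _ fun i _ => Kernel.measurable_coe (k i) (ht i)

instance {ι X : Type*} [Fintype ι] [MeasurableSpace X] {Y : ι → Type*}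
    [∀ i, MeasurableSpace (Y i)] (k : ∀ i, Kernel X (Y i)) [∀ i, IsMarkovKernel (k i)] :
    IsMarkovKernel (piKernel k) :=
  ⟨fun x => by change IsProbabilityMeasure (Measure.pi fun i => k i x); infer_instance⟩

namespace Model

variable {ι : Type*} [Fintype ι] [DecidableEq ι] {G : SimpleGraph ι} {κ d : ℕ}
  {S A : ι → Type*} [∀ i, MeasurableSpace (S i)] [∀ i, MeasurableSpace (A i)]

attribute [instance] trans_markov init_prob ref_sigmaFinite

/-- The gradient `∇_{θ_j} log π_i(a_i | s_i, θ)`. -/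
def logGrad (M : Model G κ d S A) (i j : ι) (s : S i) (a : A i) (θ : Params ι d) :
    EuclideanSpace ℝ (Fin d) :=
  gradient (fun x => Real.log (M.policy i s a (setBlock θ j x))) (θ j)

/-! ### Trajectories -/

/-- The local policy of agent `i` as a Markov kernel from parameters and local states. -/
def localPolicy (M : Model G κ d S A) (i : ι) : Kernel (Params ι d × S i) (A i) :=
  (Kernel.const _ (M.ref i)).withDensity fun x a => ENNReal.ofReal (M.policy i x.2 a x.1)

theorem measurable_policy_density (M : Model G κ d S A) (i : ι) :
    Measurable (Function.uncurry fun (x : Params ι d × S i) (a : A i) =>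
      ENNReal.ofReal (M.policy i x.2 a x.1)) := by
  have h : Measurable fun y : (Params ι d × S i) × A i => ((y.1.2, y.2), y.1.1) := by fun_prop
  exact ((M.policy_measurable i).comp h).ennreal_ofReal

instance (M : Model G κ d S A) (i : ι) : IsMarkovKernel (M.localPolicy i) :=
  ⟨fun x => ⟨by
    rw [localPolicy, Kernel.withDensity_apply' _ (M.measurable_policy_density i)]
    simpa using M.policy_lintegral i x.2 x.1⟩⟩

/-- The joint policy when agent `i` acts according to `π_i(· | s_i, ψ i)`, where `ψ i` is the copy
of the joint parameter held by agent `i`. -/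
def jointPolicy (M : Model G κ d S A) : Kernel ((ι → Params ι d) × (∀ i, S i)) (∀ i, A i) :=
  piKernel fun i => (M.localPolicy i).comap
    (fun x : (ι → Params ι d) × (∀ i, S i) => (x.1 i, x.2 i)) (by fun_prop)

instance (M : Model G κ d S A) : IsMarkovKernel M.jointPolicy := by
  unfold jointPolicy; infer_instance

/-- The global transition kernel, the product of the local ones. -/
def jointTrans (M : Model G κ d S A) : Kernel ((∀ i, S i) × (∀ i, A i)) (∀ i, S i) :=
  piKernel fun i => (M.trans i).comap
    (fun x : (∀ i, S i) × (∀ i, A i) => (x.1 i, x.2 i)) (by fun_prop)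

instance (M : Model G κ d S A) : IsMarkovKernel M.jointTrans := by
  unfold jointTrans; infer_instance

/-- Law of `(s_0, a_0)` under the copies `ψ`; the copies are carried along. -/
def startKernel (M : Model G κ d S A) :
    Kernel (ι → Params ι d) ((ι → Params ι d) × ((∀ i, S i) × (∀ i, A i))) :=
  Kernel.id ×ₖ (Kernel.const _ M.init ⊗ₖ M.jointPolicy)

instance (M : Model G κ d S A) : IsMarkovKernel M.startKernel := by
  unfold startKernel; infer_instance

/-- Law of `(s_{τ+1}, a_{τ+1})` given `(s_τ, a_τ)` under the copies `ψ`; the copies are carried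
along unchanged. -/
def stepKernel (M : Model G κ d S A) :
    Kernel ((ι → Params ι d) × ((∀ i, S i) × (∀ i, A i)))
      ((ι → Params ι d) × ((∀ i, S i) × (∀ i, A i))) :=
  Kernel.deterministic Prod.fst measurable_fst ×ₖ
    (M.jointTrans.comap Prod.snd measurable_snd ⊗ₖ
      M.jointPolicy.comap (fun x => (x.1.1, x.2)) (by fun_prop))

instance (M : Model G κ d S A) : IsMarkovKernel M.stepKernel := by
  unfold stepKernel; infer_instance

/-- Law of the infinite state-action trajectory `(s_τ, a_τ)_{τ ≥ 0}` when `s_0 ∼ ρ` and agent `i`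
executes `π_i(· | s_i, ψ i)` at all times, as a kernel in the copies `ψ`. -/
def pathKernel (M : Model G κ d S A) :
    Kernel (ι → Params ι d) (ℕ → (∀ i, S i) × (∀ i, A i)) :=
  ((Kernel.traj (X := fun _ => (ι → Params ι d) × ((∀ i, S i) × (∀ i, A i)))
      (fun n => M.stepKernel.comap (fun h => h ⟨n, Finset.mem_Iic.2 le_rfl⟩) (by fun_prop)) 0) ∘ₖ
    (M.startKernel.map fun x (_ : Finset.Iic 0) => x)).map fun x n => (x n).2

instance (M : Model G κ d S A) : IsMarkovKernel M.pathKernel := by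
  unfold pathKernel
  have : IsMarkovKernel (M.startKernel.map fun x (_ : Finset.Iic 0) => x) :=
    Kernel.IsMarkovKernel.map _ (by fun_prop)
  exact Kernel.IsMarkovKernel.map _ (by fun_prop)

/-- The objective: expected discounted cumulative reward, averaged over the agents, when all
agents use the same joint parameter `θ`. -/
def J (M : Model G κ d S A) (θ : Params ι d) : ℝ :=
  ∫ ω, (1 / (Fintype.card ι : ℝ)) *
    ∑' t : ℕ, ∑ i, M.discount ^ t * M.reward i (ω t).1 (ω t).2 ∂(M.pathKernel fun _ => θ)

/-! ### The algorithm -/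

/-- The state of the algorithm: the true parameters `θ` and the intermediate variables, `x.2 i`
being the family `(θ̆^i_j)_j` held by agent `i`. -/
abbrev AlgState (ι : Type*) (d : ℕ) : Type _ := Params ι d × (ι → Params ι d)

/-- What is sampled in one iteration: the horizons `(T₁, T₂)` and a trajectory. -/
abbrev Sample (S A : ι → Type*) : Type _ := (ℕ × ℕ) × (ℕ → (∀ i, S i) × (∀ i, A i))

/-- The local parameter estimates `θ̂^i_{j,t}` in iteration `t = k + 1`. -/
def estimate (G : SimpleGraph ι) (k : ℕ) (x : AlgState ι d) (i : ι) : Params ι d :=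
  (1 / pushSum G (k + 1) i) • ∑ l ∈ nbhd G 1 i, weight G i l • x.2 l

/-- The estimate `Q̂_i` of the neighbours' averaged `Q`-function, from the rewards at times
`T₁, …, T₁ + T₂`. -/
def estQ (M : Model G κ d S A) (i : ι) (z : Sample S A) : ℝ :=
  (1 / (Fintype.card ι : ℝ)) * ∑ τ ∈ Finset.range (z.1.2 + 1),
    M.discount ^ ((τ : ℝ) / 2) *
      ∑ j ∈ nbhd G (κ + 1) i, M.reward j (z.2 (z.1.1 + τ)).1 (z.2 (z.1.1 + τ)).2

/-- The estimate `ĝ_i`, from the state-action pairs at time `T₁` and the copies `ψ i` of agent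
`i`. -/
def estScore (M : Model G κ d S A) (i : ι) (ψ : ι → Params ι d) (z : Sample S A) :
    EuclideanSpace ℝ (Fin d) :=
  ∑ j ∈ nbhd G κ i, M.logGrad j i ((z.2 z.1.1).1 j) ((z.2 z.1.1).2 j) (ψ i)

/-- The stochastic policy gradient of agent `i`. -/
def estGrad (M : Model G κ d S A) (i : ι) (ψ : ι → Params ι d) (z : Sample S A) :
    EuclideanSpace ℝ (Fin d) :=
  (1 / (1 - M.discount)) • M.estQ i z • M.estScore i ψ z

/-- Update of the true parameters in iteration `t = k + 1` with learning rate `η`. -/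
def nextParams (M : Model G κ d S A) (k : ℕ) (η : ℝ) (x : AlgState ι d) (z : Sample S A) :
    Params ι d :=
  WithLp.toLp 2 fun i => x.1 i + η • M.estGrad i (estimate G k x) z

/-- Update of the intermediate variables in iteration `t = k + 1` with learning rate `η`. -/
def nextAux (M : Model G κ d S A) (k : ℕ) (η : ℝ) (x : AlgState ι d) (z : Sample S A) (i : ι) :
    Params ι d :=
  open Classical in
  WithLp.toLp 2 fun j => (∑ l ∈ nbhd G 1 i, weight G i l • x.2 l j) +
    if j ∈ nbhd G 1 i then
      (weight G i j * (Fintype.card ι : ℝ)) • (M.nextParams k η x z j - x.1 j)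
    else 0

/-- The full update of the algorithm in iteration `t = k + 1`. -/
def update (M : Model G κ d S A) (k : ℕ) (η : ℝ) (x : AlgState ι d) (z : Sample S A) :
    AlgState ι d :=
  (M.nextParams k η x z, M.nextAux k η x z)

/-! Measurability of the update, so that it defines a Markov kernel. -/

theorem measurable_setBlock (j : ι) :
    Measurable fun x : Params ι d × EuclideanSpace ℝ (Fin d) => setBlock x.1 j x.2 := by
  refine (WithLp.measurable_toLp 2 _).comp (measurable_pi_lambda _ fun k => ?_)
  by_cases h : k = j
  · subst h
    simpa using measurable_snd
  · simp only [Function.update_of_ne h]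
    fun_prop

theorem differentiableAt_logPolicy (M : Model G κ d S A) (i j : ι) (s : S i) (a : A i)
    (θ : Params ι d) :
    DifferentiableAt ℝ (fun x => Real.log (M.policy i s a (setBlock θ j x))) (θ j) := by
  by_cases h : j ∈ nbhd G κ i
  · exact M.policy_diff i j h s a θ
  · have hc : (fun x => Real.log (M.policy i s a (setBlock θ j x))) =
        fun _ => Real.log (M.policy i s a θ) := by
      funext x
      congr 1
      refine M.policy_local i s a _ _ fun k hk => ?_
      have hkj : k ≠ j := fun e => h (e ▸ hk)
      simp [setBlock, Function.update_of_ne hkj]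
    rw [hc]
    exact differentiableAt_const _

theorem measurable_logGrad (M : Model G κ d S A) (i j : ι) :
    Measurable fun x : (S i × A i) × Params ι d => M.logGrad i j x.1.1 x.1.2 x.2 := by
  have hF : Measurable fun y : ((S i × A i) × Params ι d) × EuclideanSpace ℝ (Fin d) =>
      Real.log (M.policy i y.1.1.1 y.1.1.2 (setBlock y.1.2 j y.2)) := by
    have hs : Measurable fun y : ((S i × A i) × Params ι d) × EuclideanSpace ℝ (Fin d) =>
        setBlock y.1.2 j y.2 :=
      (measurable_setBlock j).comp (by fun_prop :
        Measurable fun y : ((S i × A i) × Params ι d) × EuclideanSpace ℝ (Fin d) => (y.1.2, y.2))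
    have h1 : Measurable fun y : ((S i × A i) × Params ι d) × EuclideanSpace ℝ (Fin d) =>
        y.1.1 := measurable_fst.comp measurable_fst
    exact Real.measurable_log.comp ((M.policy_measurable i).comp (h1.prodMk hs))
  have key : ∀ e : EuclideanSpace ℝ (Fin d), Measurable fun x : (S i × A i) × Params ι d =>
      inner ℝ (M.logGrad i j x.1.1 x.1.2 x.2) e := by
    intro e
    refine measurable_of_tendsto_metrizable (f := fun (n : ℕ) (x : (S i × A i) × Params ι d) =>
      ((n : ℝ) + 1) * (Real.log (M.policy i x.1.1 x.1.2 (setBlock x.2 j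
        (x.2 j + ((n : ℝ) + 1)⁻¹ • e))) -
        Real.log (M.policy i x.1.1 x.1.2 (setBlock x.2 j (x.2 j))))) (fun n => ?_) ?_
    · have h1 : Measurable fun x : (S i × A i) × Params ι d =>
          (x, x.2 j + ((n : ℝ) + 1)⁻¹ • e) := by fun_prop
      have h2 : Measurable fun x : (S i × A i) × Params ι d => (x, x.2 j) := by fun_prop
      exact ((hF.comp h1).sub (hF.comp h2)).const_mul _
    · rw [tendsto_pi_nhds]
      intro x
      have hd := (M.differentiableAt_logPolicy i j x.1.1 x.1.2 x.2).hasGradientAt.hasFDerivAt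
      have hl := hd.hasLineDerivAt e
      have ht : Filter.Tendsto (fun n : ℕ => ((n : ℝ) + 1)⁻¹) Filter.atTop
          (nhdsWithin 0 {0}ᶜ) := by
        refine tendsto_nhdsWithin_iff.2 ⟨?_, Filter.Eventually.of_forall fun n => ?_⟩
        · simpa [one_div] using tendsto_one_div_add_atTop_nhds_zero_nat (𝕜 := ℝ)
        · have : (0 : ℝ) < (n : ℝ) + 1 := by positivity
          simpa using this.ne'
      have := hl.tendsto_slope_zero.comp ht
      simpa [Function.comp_def, logGrad] using this
  have hm : Measurable fun x : (S i × A i) × Params ι d =>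
      (WithLp.toLp 2 fun c => inner ℝ (M.logGrad i j x.1.1 x.1.2 x.2)
        (EuclideanSpace.single c (1 : ℝ)) : EuclideanSpace ℝ (Fin d)) :=
    (WithLp.measurable_toLp 2 _).comp (measurable_pi_lambda _ fun c => key _)
  convert hm using 2 with x
  ext c
  simp [EuclideanSpace.inner_single_right]

theorem measurable_estimate (k : ℕ) :
    Measurable fun x : AlgState ι d => estimate G k x := by
  refine measurable_pi_lambda _ fun i => ?_
  unfold estimate
  fun_prop

theorem measurable_at_time {X : Type*} [MeasurableSpace X] :
    Measurable fun y : (ℕ → X) × ℕ => y.1 y.2 :=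
  measurable_from_prod_countable_left fun n => measurable_pi_apply n

theorem measurable_rewardAt (M : Model G κ d S A) (j : ι) (τ : ℕ) : Measurable fun z : Sample S A =>
    M.reward j (z.2 (z.1.1 + τ)).1 (z.2 (z.1.1 + τ)).2 := by
  have h1 : Measurable fun z : Sample S A => z.1.1 + τ :=
    (measurable_of_countable fun n : ℕ => n + τ).comp (measurable_fst.comp measurable_fst)
  have h2 : Measurable fun z : Sample S A => z.2 (z.1.1 + τ) :=
    measurable_at_time.comp (measurable_snd.prodMk h1)
  exact (M.reward_measurable j).comp h2

theorem measurable_estQ (M : Model G κ d S A) (i : ι) : Measurable (M.estQ i) := by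
  have hn : ∀ n : ℕ, Measurable fun z : Sample S A =>
      (1 / (Fintype.card ι : ℝ)) * ∑ τ ∈ Finset.range (n + 1), M.discount ^ ((τ : ℝ) / 2) *
        ∑ j ∈ nbhd G (κ + 1) i, M.reward j (z.2 (z.1.1 + τ)).1 (z.2 (z.1.1 + τ)).2 := fun n =>
    (Finset.measurable_sum _ fun τ _ =>
      (Finset.measurable_sum _ fun j _ => M.measurable_rewardAt j τ).const_mul _).const_mul _
  have hz : Measurable fun z : Sample S A => (z, z.1.2) :=
    measurable_id.prodMk (measurable_snd.comp measurable_fst)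
  have h := (measurable_from_prod_countable_left (f := fun y : Sample S A × ℕ =>
      (1 / (Fintype.card ι : ℝ)) * ∑ τ ∈ Finset.range (y.2 + 1), M.discount ^ ((τ : ℝ) / 2) *
        ∑ j ∈ nbhd G (κ + 1) i,
          M.reward j (y.1.2 (y.1.1.1 + τ)).1 (y.1.2 (y.1.1.1 + τ)).2) hn).comp hz
  unfold estQ
  exact h

theorem measurable_estScore (M : Model G κ d S A) (i : ι) :
    Measurable fun y : (ι → Params ι d) × Sample S A => M.estScore i y.1 y.2 := by
  unfold estScore
  refine Finset.measurable_sum _ fun j _ => ?_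
  have h : Measurable fun y : (ι → Params ι d) × Sample S A => y.2.2 y.2.1.1 :=
    measurable_at_time.comp
      (by fun_prop : Measurable fun y : (ι → Params ι d) × Sample S A => (y.2.2, y.2.1.1))
  have h' : Measurable fun y : (ι → Params ι d) × Sample S A =>
      (((y.2.2 y.2.1.1).1 j, (y.2.2 y.2.1.1).2 j), y.1 i) :=
    (((measurable_pi_apply j).comp h.fst).prodMk ((measurable_pi_apply j).comp h.snd)).prodMk
      (by fun_prop)
  exact (M.measurable_logGrad j i).comp h'

theorem measurable_update (M : Model G κ d S A) (k : ℕ) (η : ℝ) :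
    Measurable fun y : AlgState ι d × Sample S A => M.update k η y.1 y.2 := by
  have hg : ∀ i, Measurable fun y : AlgState ι d × Sample S A =>
      M.estGrad i (estimate G k y.1) y.2 := fun i => by
    have h1 : Measurable fun y : AlgState ι d × Sample S A => M.estQ i y.2 :=
      (M.measurable_estQ i).comp measurable_snd
    have h2 : Measurable fun y : AlgState ι d × Sample S A => (estimate G k y.1, y.2) :=
      ((measurable_estimate k).comp measurable_fst).prodMk measurable_snd
    exact (h1.smul ((M.measurable_estScore i).comp h2)).const_smul (1 / (1 - M.discount))
  have hp : Measurable fun y : AlgState ι d × Sample S A => M.nextParams k η y.1 y.2 :=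
    (WithLp.measurable_toLp 2 _).comp (measurable_pi_lambda _ fun i =>
      (by fun_prop : Measurable fun y : AlgState ι d × Sample S A => y.1.1 i).add
        ((hg i).const_smul η))
  refine hp.prodMk (measurable_pi_lambda _ fun i =>
    (WithLp.measurable_toLp 2 _).comp (measurable_pi_lambda _ fun j => ?_))
  refine Measurable.add (by fun_prop) ?_
  split_ifs
  · fun_prop
  · fun_prop

/-- Law of the sample of one iteration when the copies `ψ` are executed: `T₁ ∼ Geom(1 - γ)` and
`T₂ ∼ Geom(1 - γ^{1/2})` on `{0, 1, 2, …}`, and a trajectory, all three independent. -/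
def sampleKernel (M : Model G κ d S A) : Kernel (ι → Params ι d) (Sample S A) :=
  Kernel.const _ ((geometricMeasure ⟨1 - M.discount,
      sub_nonneg.2 M.discount_lt_one.le, sub_le_self 1 M.discount_pos.le⟩).prod
    (geometricMeasure ⟨1 - √M.discount,
      sub_nonneg.2 (Real.sqrt_le_one.2 M.discount_lt_one.le),
      sub_le_self 1 (Real.sqrt_nonneg _)⟩)) ×ₖ M.pathKernel

instance (M : Model G κ d S A) : IsMarkovKernel M.sampleKernel := by
  unfold sampleKernel; infer_instance

/-- One iteration `t = k + 1` of the algorithm with learning rates `η`. -/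
def iterKernel (M : Model G κ d S A) (η : ℕ → ℝ) (k : ℕ) :
    Kernel (AlgState ι d) (AlgState ι d) :=
  (Kernel.id ×ₖ M.sampleKernel.comap (estimate G k) (measurable_estimate k)).map
    fun y => M.update k (η (k + 1)) y.1 y.2

instance (M : Model G κ d S A) (η : ℕ → ℝ) (k : ℕ) : IsMarkovKernel (M.iterKernel η k) :=
  Kernel.IsMarkovKernel.map _ (M.measurable_update k _)

/-- Law of the sequence of states of the algorithm with learning rates `(η_t)_{t ≥ 1}`, started
from `θ_1 = θ̆_1 = 0`; coordinate `k` is the state with (one-based) iteration index `k + 1`. -/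
def dscp (M : Model G κ d S A) (η : ℕ → ℝ) : Measure (ℕ → AlgState ι d) :=
  Kernel.trajMeasure (X := fun _ => AlgState ι d) (Measure.dirac 0) fun n =>
    (M.iterKernel η n).comap (fun h => h ⟨n, Finset.mem_Iic.2 le_rfl⟩) (by fun_prop)

instance (M : Model G κ d S A) (η : ℕ → ℝ) : IsProbabilityMeasure (M.dscp η) := by
  unfold dscp; infer_instance

/-- The policy parameter `θ_t`, `t ≥ 1`, along a run of the algorithm. -/
def param (t : ℕ) (x : ℕ → AlgState ι d) : Params ι d := (x (t - 1)).1

/-! ### Assumptions -/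

/-- All rewards are bounded by `R`. -/
def RewardBound (M : Model G κ d S A) (R : ℝ) : Prop := ∀ i s a, |M.reward i s a| ≤ R

/-- All gradients `∇_{θ_j} log π_i`, `j` a `κ`-hop neighbour of `i`, are bounded by `B`. -/
def LogGradBound (M : Model G κ d S A) (B : ℝ) : Prop :=
  ∀ i, ∀ j ∈ nbhd G κ i, ∀ s a θ, ‖M.logGrad i j s a θ‖ ≤ B

/-- All gradients `∇_{θ_j} log π_i`, `j` a `κ`-hop neighbour of `i`, are `L`-Lipschitz in `θ`. -/
def LogGradLipschitz (M : Model G κ d S A) (L : ℝ) : Prop :=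
  ∀ i, ∀ j ∈ nbhd G κ i, ∀ s a θ θ',
    ‖M.logGrad i j s a θ - M.logGrad i j s a θ'‖ ≤ L * ‖θ - θ'‖

end Model
end
end DSCP

/-!
The algorithm is a perturbed stochastic gradient ascent: the objective is smooth, the stochastic
gradients are bounded and unbiased up to the disagreement of the agents, and the disagreement decays
fast enough for the usual descent argument.

*Smoothness.* Policies act on bounded measurable functions of the state-action pair as operators
`policyOp`, and the objective is a discounted occupancy, `J_eq_occOp`. Expanding the likelihood ratio
`exp (logRatio)` gives the policy operator a quadratic expansion in the copies `ψ` of the parameters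
held by the agents (`norm_policyOp_expansion_le`), and the performance difference identity
`occ_sub_occ` carries it over to the occupancy (`abs_occOp_expansion_le`). This is the policy
gradient theorem with an explicit remainder `O(‖ψ' - ψ‖²)`. It needs only bounded and Lipschitz
blockwise gradients of the log-policies, which are combined into a first-order expansion by changing
one block of the parameter at a time (`abs_log_policy_sub_le`).

*Unbiasedness.* Transitions and policies factor over the agents, so the occupancy of a reward that
does not involve agent `j` does not react to the copy held by agent `j`, and its derivative in that
direction vanishes (`occOp_logGradFn_mul_eq_zero`). Hence the rewards dropped by the truncation to
`κ + 1` hops contribute nothing. The two geometric horizons produce exactly the discounted sums of the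
policy gradient theorem (`inner_meanGrad`), so that the mean stochastic gradient `meanGrad` is
`∇J` when all copies agree (`hasGradientAt_J`); in general it is Lipschitz in the copies
(`norm_meanGrad_sub_le`).

*Consensus.* The intermediate variables minus the push-sum weights times the true parameters form a
family with sum zero that undergoes averaging plus an input of the size of the learning rate. On such
families averaging contracts the energy weighted by inverse neighbourhood sizes (`exists_gap`): on a
connected graph only multiples of the neighbourhood sizes dissipate no energy, and the unit sphere is
compact. So the squared consensus errors obey `e (k + 1) = q e k + b η²` with `q < 1`
(`ae_nearConsensus`), and their sum is at most a multiple of `∑ η²`.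

*Descent.* One iteration raises the expected objective by at least
`(η / 2) ‖∇J‖²` minus multiples of `η e` and `η²` (`integral_J_update_ge`). The objective is bounded
and `∑ η_t² ≤ C² ∑ 1 / t²`, so telescoping bounds `∑ η_t 𝔼 ‖∇J(θ_t)‖²` by a constant that depends only
on the graph, `γ`, `R`, `B`, `L` and `C` (`sum_integral_norm_gradient_sq_le`). Neighbourhood sizes
enter this constant only through the bound `N`, and adding the two sizes to it makes it strictly
increasing in both.
-/

namespace DSCP

set_option linter.unusedSectionVars false

noncomputable section

/-! ### Perturbation of discounted occupancies -/

section Occupancy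

variable {E V : Type*} [NormedAddCommGroup E] [NormedSpace ℝ E] [CompleteSpace E]
  [NormedAddCommGroup V] [NormedSpace ℝ V] {γ : ℝ}

/-- The resolvent `∑ γⁿ Tⁿ` of an operator `T`. -/
def resolv (γ : ℝ) (T : E →L[ℝ] E) : E →L[ℝ] E := ∑' n : ℕ, (γ • T) ^ n

theorem norm_discount_smul_le (hγ₀ : 0 ≤ γ) {T : E →L[ℝ] E} (hT : ‖T‖ ≤ 1) : ‖γ • T‖ ≤ γ := by
  rw [norm_smul, Real.norm_of_nonneg hγ₀]
  exact mul_le_of_le_one_right hγ₀ hT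

theorem resolv_mul (hγ₀ : 0 ≤ γ) (hγ₁ : γ < 1) {T : E →L[ℝ] E} (hT : ‖T‖ ≤ 1) :
    resolv γ T * (1 - γ • T) = 1 :=
  geom_series_mul_neg _ ((norm_discount_smul_le hγ₀ hT).trans_lt hγ₁)

theorem mul_resolv (hγ₀ : 0 ≤ γ) (hγ₁ : γ < 1) {T : E →L[ℝ] E} (hT : ‖T‖ ≤ 1) :
    (1 - γ • T) * resolv γ T = 1 :=
  mul_neg_geom_series _ ((norm_discount_smul_le hγ₀ hT).trans_lt hγ₁)

theorem norm_resolv_le (hγ₀ : 0 ≤ γ) (hγ₁ : γ < 1) {T : E →L[ℝ] E} (hT : ‖T‖ ≤ 1) :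
    ‖resolv γ T‖ ≤ 1 / (1 - γ) := by
  have h := norm_discount_smul_le hγ₀ hT
  refine (tsum_geometric_le_of_norm_lt_one _ (h.trans_lt hγ₁)).trans ?_
  have h1 : ‖(1 : E →L[ℝ] E)‖ ≤ 1 := ContinuousLinearMap.norm_id_le
  have h2 : (1 - ‖γ • T‖)⁻¹ ≤ (1 - γ)⁻¹ :=
    inv_anti₀ (by linarith) (by linarith)
  rw [one_div]
  linarith

theorem hasSum_resolv (hγ₀ : 0 ≤ γ) (hγ₁ : γ < 1) {T : E →L[ℝ] E} (hT : ‖T‖ ≤ 1) (f : E) :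
    HasSum (fun n : ℕ => γ ^ n • (T ^ n) f) (resolv γ T f) := by
  have h := (summable_geometric_of_norm_lt_one (x := γ • T)
    ((norm_discount_smul_le hγ₀ hT).trans_lt hγ₁)).hasSum
  have := (ContinuousLinearMap.apply ℝ E f).hasSum h
  simpa [Function.comp_def, smul_pow, resolv] using this

/-- The discounted occupancy functional: start with `ρ`, alternate the policy operator `Q` and the
transition operator `P`, and discount by `γ`. -/
def occ (γ : ℝ) (ρ : V →L[ℝ] ℝ) (P : V →L[ℝ] E) (Q : E →L[ℝ] V) : E →L[ℝ] ℝ :=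
  (ρ ∘L Q) ∘L resolv γ (P ∘L Q)

variable {ρ : V →L[ℝ] ℝ} {P : V →L[ℝ] E} {Q Q' : E →L[ℝ] V}

theorem norm_comp_le_one {E V W : Type*} [NormedAddCommGroup E] [NormedSpace ℝ E]
    [NormedAddCommGroup V] [NormedSpace ℝ V] [NormedAddCommGroup W] [NormedSpace ℝ W]
    {f : V →L[ℝ] W} {g : E →L[ℝ] V} (hf : ‖f‖ ≤ 1) (hg : ‖g‖ ≤ 1) : ‖f ∘L g‖ ≤ 1 :=
  (f.opNorm_comp_le g).trans (mul_le_one₀ hf (norm_nonneg _) hg)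

theorem norm_occ_le (hγ₀ : 0 ≤ γ) (hγ₁ : γ < 1) (hρ : ‖ρ‖ ≤ 1) (hP : ‖P‖ ≤ 1) (hQ : ‖Q‖ ≤ 1) :
    ‖occ γ ρ P Q‖ ≤ 1 / (1 - γ) := by
  refine (ContinuousLinearMap.opNorm_comp_le _ _).trans ?_
  have h1 := norm_comp_le_one hρ hQ
  have h2 := norm_resolv_le hγ₀ hγ₁ (norm_comp_le_one hP hQ)
  calc _ ≤ 1 * (1 / (1 - γ)) := by gcongr
    _ = _ := one_mul _

/-- The occupancy of states, before the action is drawn. -/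
def stateOcc (γ : ℝ) (ρ : V →L[ℝ] ℝ) (P : V →L[ℝ] E) (Q : E →L[ℝ] V) : V →L[ℝ] ℝ :=
  ρ + γ • (occ γ ρ P Q ∘L P)

theorem norm_stateOcc_le (hγ₀ : 0 ≤ γ) (hγ₁ : γ < 1) (hρ : ‖ρ‖ ≤ 1) (hP : ‖P‖ ≤ 1)
    (hQ : ‖Q‖ ≤ 1) : ‖stateOcc γ ρ P Q‖ ≤ 1 / (1 - γ) := by
  have h1 : ‖occ γ ρ P Q ∘L P‖ ≤ 1 / (1 - γ) :=
    (ContinuousLinearMap.opNorm_comp_le _ _).trans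
      ((mul_le_of_le_one_right (norm_nonneg _) hP).trans (norm_occ_le hγ₀ hγ₁ hρ hP hQ))
  calc ‖stateOcc γ ρ P Q‖ ≤ ‖ρ‖ + ‖γ • (occ γ ρ P Q ∘L P)‖ := norm_add_le _ _
    _ ≤ 1 + γ * (1 / (1 - γ)) := by
        rw [norm_smul, Real.norm_of_nonneg hγ₀]; gcongr
    _ = 1 / (1 - γ) := by
        have : (1 - γ) ≠ 0 := by linarith
        field_simp; ring

theorem stateOcc_comp (hγ₀ : 0 ≤ γ) (hγ₁ : γ < 1) (hP : ‖P‖ ≤ 1) (hQ : ‖Q‖ ≤ 1) :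
    stateOcc γ ρ P Q ∘L Q = occ γ ρ P Q := by
  have h := resolv_mul hγ₀ hγ₁ (norm_comp_le_one hP hQ)
  ext f
  have hf := congrArg (fun T : E →L[ℝ] E => (ρ ∘L Q) (T f)) h
  simp [occ, stateOcc] at hf ⊢
  linarith

/-- The performance difference identity: replacing `Q` by `Q'` changes the occupancy by
`ν_{Q'} (Q' - Q) R_Q`, where `ν_{Q'}` is the state occupancy and `R_Q` the resolvent. -/
theorem occ_sub_occ (hγ₀ : 0 ≤ γ) (hγ₁ : γ < 1) (hP : ‖P‖ ≤ 1) (hQ : ‖Q‖ ≤ 1)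
    (hQ' : ‖Q'‖ ≤ 1) :
    occ γ ρ P Q' - occ γ ρ P Q =
      (stateOcc γ ρ P Q' ∘L (Q' - Q)) ∘L resolv γ (P ∘L Q) := by
  have h := mul_resolv hγ₀ hγ₁ (norm_comp_le_one hP hQ)
  have h' := stateOcc_comp (ρ := ρ) hγ₀ hγ₁ hP hQ'
  ext f
  have hf := congrArg (fun T : E →L[ℝ] E => occ γ ρ P Q' (T f)) h
  have hf' := congrArg (fun T : E →L[ℝ] ℝ => T (resolv γ (P ∘L Q) f)) h'
  simp only [ContinuousLinearMap.comp_apply, mul_apply_eq_comp,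
    sub_apply, one_apply_eq_self,
    smul_apply, map_sub, map_smul, smul_eq_mul] at hf hf' ⊢
  rw [hf', ← hf]
  simp [stateOcc, occ]
  ring

theorem norm_occ_sub_le (hγ₀ : 0 ≤ γ) (hγ₁ : γ < 1) (hρ : ‖ρ‖ ≤ 1) (hP : ‖P‖ ≤ 1)
    (hQ : ‖Q‖ ≤ 1) (hQ' : ‖Q'‖ ≤ 1) :
    ‖occ γ ρ P Q' - occ γ ρ P Q‖ ≤ (1 / (1 - γ)) ^ 2 * ‖Q' - Q‖ := by
  have hg : 0 ≤ 1 / (1 - γ) := by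
    have : 0 < 1 - γ := by linarith
    positivity
  rw [occ_sub_occ hγ₀ hγ₁ hP hQ hQ']
  calc _ ≤ ‖stateOcc γ ρ P Q'‖ * ‖Q' - Q‖ * ‖resolv γ (P ∘L Q)‖ :=
        (ContinuousLinearMap.opNorm_comp_le _ _).trans
          (by gcongr; exact ContinuousLinearMap.opNorm_comp_le _ _)
    _ ≤ (1 / (1 - γ)) * ‖Q' - Q‖ * (1 / (1 - γ)) := by
        gcongr
        · exact norm_stateOcc_le hγ₀ hγ₁ hρ hP hQ'
        · exact norm_resolv_le hγ₀ hγ₁ (norm_comp_le_one hP hQ)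
    _ = _ := by ring

theorem norm_resolv_sub_le (hγ₀ : 0 ≤ γ) (hγ₁ : γ < 1) (hP : ‖P‖ ≤ 1)
    (hQ : ‖Q‖ ≤ 1) (hQ' : ‖Q'‖ ≤ 1) :
    ‖resolv γ (P ∘L Q') - resolv γ (P ∘L Q)‖ ≤ (1 / (1 - γ)) ^ 2 * ‖Q' - Q‖ := by
  have hg : 0 ≤ 1 / (1 - γ) := by
    have : 0 < 1 - γ := by linarith
    positivity
  have h1 := resolv_mul hγ₀ hγ₁ (norm_comp_le_one hP hQ')
  have h2 := mul_resolv hγ₀ hγ₁ (norm_comp_le_one hP hQ)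
  have key : resolv γ (P ∘L Q') - resolv γ (P ∘L Q) =
      resolv γ (P ∘L Q') * (γ • (P ∘L (Q' - Q))) * resolv γ (P ∘L Q) := by
    have h3 : γ • (P ∘L (Q' - Q)) = (1 - γ • (P ∘L Q)) - (1 - γ • (P ∘L Q')) := by
      rw [ContinuousLinearMap.comp_sub, smul_sub]; abel
    rw [h3, mul_sub, sub_mul, h1, one_mul, mul_assoc, h2, mul_one]
  rw [key]
  calc _ ≤ ‖resolv γ (P ∘L Q')‖ * ‖γ • (P ∘L (Q' - Q))‖ * ‖resolv γ (P ∘L Q)‖ :=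
        (norm_mul_le _ _).trans (by gcongr; exact norm_mul_le _ _)
    _ ≤ (1 / (1 - γ)) * ‖Q' - Q‖ * (1 / (1 - γ)) := by
        gcongr
        · exact norm_resolv_le hγ₀ hγ₁ (norm_comp_le_one hP hQ')
        · rw [norm_smul, Real.norm_of_nonneg hγ₀]
          calc γ * ‖P ∘L (Q' - Q)‖ ≤ 1 * (‖P‖ * ‖Q' - Q‖) := by
                gcongr
                exact ContinuousLinearMap.opNorm_comp_le _ _
            _ ≤ 1 * (1 * ‖Q' - Q‖) := by gcongr
            _ = _ := by ring
        · exact norm_resolv_le hγ₀ hγ₁ (norm_comp_le_one hP hQ)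
    _ = _ := by ring

/-- First-order expansion of the occupancy. If `Q ∘ S` is the first-order change of the policy
operator, then `f ↦ occ (S (R_Q f))` is that of the occupancy. -/
theorem abs_occ_sub_sub_le (hγ₀ : 0 ≤ γ) (hγ₁ : γ < 1) (hρ : ‖ρ‖ ≤ 1) (hP : ‖P‖ ≤ 1)
    (hQ : ‖Q‖ ≤ 1) (hQ' : ‖Q'‖ ≤ 1) (S : E →L[ℝ] E) (f : E) :
    |occ γ ρ P Q' f - occ γ ρ P Q f - occ γ ρ P Q (S (resolv γ (P ∘L Q) f))| ≤
      (1 / (1 - γ)) ^ 3 * (‖Q' - Q - Q ∘L S‖ + ‖Q' - Q‖ * ‖S‖) * ‖f‖ := by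
  have hpos : 0 < 1 - γ := by linarith
  have hg : 1 ≤ 1 / (1 - γ) := by
    rw [le_div_iff₀ hpos]; linarith
  set q := resolv γ (P ∘L Q) f with hq
  have hqn : ‖q‖ ≤ 1 / (1 - γ) * ‖f‖ :=
    ((resolv γ (P ∘L Q)).le_opNorm f).trans (by
      gcongr; exact norm_resolv_le hγ₀ hγ₁ (norm_comp_le_one hP hQ))
  have h1 : occ γ ρ P Q' f - occ γ ρ P Q f = stateOcc γ ρ P Q' ((Q' - Q) q) := by
    have := congrArg (fun T : E →L[ℝ] ℝ => T f) (occ_sub_occ (ρ := ρ) hγ₀ hγ₁ hP hQ hQ')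
    simpa using this
  have h2 : occ γ ρ P Q (S q) = stateOcc γ ρ P Q (Q (S q)) := by
    rw [← stateOcc_comp hγ₀ hγ₁ hP hQ]; rfl
  have h3 : stateOcc γ ρ P Q' - stateOcc γ ρ P Q =
      γ • ((occ γ ρ P Q' - occ γ ρ P Q) ∘L P) := by
    ext v; simp [stateOcc]; ring
  have h4 : ‖stateOcc γ ρ P Q' - stateOcc γ ρ P Q‖ ≤ (1 / (1 - γ)) ^ 2 * ‖Q' - Q‖ := by
    rw [h3, norm_smul, Real.norm_of_nonneg hγ₀]
    calc _ ≤ 1 * (‖occ γ ρ P Q' - occ γ ρ P Q‖ * ‖P‖) := by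
          gcongr; exact ContinuousLinearMap.opNorm_comp_le _ _
      _ ≤ 1 * (((1 / (1 - γ)) ^ 2 * ‖Q' - Q‖) * 1) := by
          gcongr; exact norm_occ_sub_le hγ₀ hγ₁ hρ hP hQ hQ'
      _ = _ := by ring
  have h5 : occ γ ρ P Q' f - occ γ ρ P Q f - occ γ ρ P Q (S q) =
      stateOcc γ ρ P Q' ((Q' - Q - Q ∘L S) q) +
        (stateOcc γ ρ P Q' - stateOcc γ ρ P Q) (Q (S q)) := by
    rw [h1, h2]; simp
  rw [h5, ← Real.norm_eq_abs]
  calc _ ≤ ‖stateOcc γ ρ P Q'‖ * (‖Q' - Q - Q ∘L S‖ * ‖q‖) +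
        ‖stateOcc γ ρ P Q' - stateOcc γ ρ P Q‖ * (‖Q‖ * (‖S‖ * ‖q‖)) := by
        refine (norm_add_le _ _).trans (add_le_add ?_ ?_)
        · refine (ContinuousLinearMap.le_opNorm _ _).trans ?_
          gcongr; exact ContinuousLinearMap.le_opNorm _ _
        · refine (ContinuousLinearMap.le_opNorm _ _).trans ?_
          gcongr
          refine (ContinuousLinearMap.le_opNorm _ _).trans ?_
          gcongr; exact ContinuousLinearMap.le_opNorm _ _
    _ ≤ (1 / (1 - γ)) * (‖Q' - Q - Q ∘L S‖ * (1 / (1 - γ) * ‖f‖)) +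
        ((1 / (1 - γ)) ^ 2 * ‖Q' - Q‖) * (1 * (‖S‖ * (1 / (1 - γ) * ‖f‖))) := by
        gcongr
        exact norm_stateOcc_le hγ₀ hγ₁ hρ hP hQ'
    _ = (1 / (1 - γ)) ^ 2 * (‖Q' - Q - Q ∘L S‖ * ‖f‖) +
        (1 / (1 - γ)) ^ 3 * (‖Q' - Q‖ * ‖S‖ * ‖f‖) := by ring
    _ ≤ (1 / (1 - γ)) ^ 3 * (‖Q' - Q - Q ∘L S‖ * ‖f‖) +
        (1 / (1 - γ)) ^ 3 * (‖Q' - Q‖ * ‖S‖ * ‖f‖) := by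
        gcongr
        norm_num
    _ = _ := by ring

end Occupancy

/-! ### Bounded measurable functions -/

/-- The subalgebra of measurable functions among all bounded real functions. -/
def boundedMeasurable (X : Type*) [MeasurableSpace X] : Subalgebra ℝ (lp (fun _ : X => ℝ) ⊤) where
  carrier := {f | Measurable fun x => f x}
  mul_mem' hf hg := by
    simp only [Set.mem_ofPred_eq] at *
    exact hf.mul hg
  add_mem' hf hg := by
    simp only [Set.mem_ofPred_eq] at *
    exact hf.add hg
  algebraMap_mem' r := by
    have : (fun x => (algebraMap ℝ (lp (fun _ : X => ℝ) ⊤) r : lp (fun _ : X => ℝ) ⊤) x) =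
        fun _ => r := by
      funext x
      rw [Algebra.algebraMap_eq_smul_one]
      simp
    simp only [Set.mem_ofPred_eq, this]
    exact measurable_const

/-- The Banach algebra of bounded measurable real functions with the supremum norm. -/
def BM (X : Type*) [MeasurableSpace X] : Type _ := boundedMeasurable X

namespace BM

instance (X : Type*) [MeasurableSpace X] : NormedCommRing (BM X) :=
  inferInstanceAs (NormedCommRing (boundedMeasurable X))

instance (X : Type*) [MeasurableSpace X] : NormedAlgebra ℝ (BM X) :=
  inferInstanceAs (NormedAlgebra ℝ (boundedMeasurable X))

instance (X : Type*) [MeasurableSpace X] : NormedSpace ℝ (BM X) :=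
  NormedAlgebra.toNormedSpace _

variable {X Y : Type*} [MeasurableSpace X] [MeasurableSpace Y]

/-- The underlying function. -/
def toFun (f : BM X) : X → ℝ := f.1

instance : CoeFun (BM X) fun _ => X → ℝ := ⟨toFun⟩

theorem measurable (f : BM X) : Measurable fun x => f x := f.2

@[ext] theorem ext {f g : BM X} (h : ∀ x, f x = g x) : f = g :=
  Subtype.ext (lp.ext (funext h))

theorem abs_apply_le (f : BM X) (x : X) : |f x| ≤ ‖f‖ :=
  lp.norm_apply_le_norm ENNReal.top_ne_zero f.1 x

theorem norm_le {f : BM X} {c : ℝ} (hc : 0 ≤ c) (h : ∀ x, |f x| ≤ c) : ‖f‖ ≤ c :=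
  lp.norm_le_of_forall_le (f := f.1) hc h

/-- The element given by a bounded measurable function. -/
def mk (f : X → ℝ) (hf : Measurable f) (c : ℝ) (h : ∀ x, |f x| ≤ c) : BM X :=
  ⟨⟨f, memℓp_infty ⟨c, by rintro _ ⟨x, rfl⟩; exact h x⟩⟩, hf⟩

@[simp] theorem mk_apply (f : X → ℝ) (hf : Measurable f) (c : ℝ) (h : ∀ x, |f x| ≤ c) (x : X) :
    mk f hf c h x = f x := rfl

@[simp] theorem add_apply (f g : BM X) (x : X) : (f + g) x = f x + g x := rfl
@[simp] theorem sub_apply (f g : BM X) (x : X) : (f - g) x = f x - g x := rfl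
@[simp] theorem mul_apply (f g : BM X) (x : X) : (f * g) x = f x * g x := rfl
@[simp] theorem smul_apply (c : ℝ) (f : BM X) (x : X) : (c • f) x = c * f x := rfl
@[simp] theorem zero_apply (x : X) : (0 : BM X) x = 0 := rfl

theorem sum_apply {ι : Type*} (s : Finset ι) (f : ι → BM X) (x : X) :
    (∑ i ∈ s, f i) x = ∑ i ∈ s, f i x := by
  classical
  induction s using Finset.induction_on with
  | empty => simp
  | insert a s ha ih => rw [Finset.sum_insert ha, Finset.sum_insert ha, add_apply, ih]

/-- Evaluation at a point. -/
def eval (x : X) : BM X →L[ℝ] ℝ :=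
  LinearMap.mkContinuous ⟨⟨fun f => f x, fun _ _ => rfl⟩, fun _ _ => rfl⟩ 1
    fun f => (abs_apply_le f x).trans_eq (one_mul _).symm

@[simp] theorem eval_apply (x : X) (f : BM X) : eval x f = f x := rfl

instance : CompleteSpace (BM X) := by
  have : IsClosed (boundedMeasurable X : Set (lp (fun _ : X => ℝ) ⊤)) := by
    refine isClosed_of_closure_subset fun f hf => ?_
    obtain ⟨u, hu, hlim⟩ := mem_closure_iff_seq_limit.1 hf
    refine measurable_of_tendsto_metrizable (f := fun n x => u n x) hu ?_
    rw [tendsto_pi_nhds]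
    intro x
    refine tendsto_iff_norm_sub_tendsto_zero.2 ?_
    refine squeeze_zero (fun _ => norm_nonneg _) (fun n => ?_)
      (tendsto_iff_norm_sub_tendsto_zero.1 hlim)
    exact lp.norm_apply_le_norm ENNReal.top_ne_zero (u n - f) x
  exact this.completeSpace_coe

theorem integrable (f : BM X) (μ : Measure X) [IsFiniteMeasure μ] : Integrable (fun x => f x) μ :=
  Integrable.of_bound f.measurable.aestronglyMeasurable ‖f‖
    (Filter.Eventually.of_forall fun x => f.abs_apply_le x)

theorem abs_integral_le (f : BM X) (μ : Measure X) [IsProbabilityMeasure μ] :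
    |∫ x, f x ∂μ| ≤ ‖f‖ := by
  have := norm_integral_le_of_norm_le_const (μ := μ) (f := fun x => f x)
    (Filter.Eventually.of_forall fun x => f.abs_apply_le x)
  simpa using this

/-- Integration against a probability measure. -/
def integral (μ : Measure X) [IsProbabilityMeasure μ] : BM X →L[ℝ] ℝ :=
  LinearMap.mkContinuous ⟨⟨fun f => ∫ x, f x ∂μ, fun f g =>
    integral_add (f.integrable μ) (g.integrable μ)⟩, fun c _ => integral_const_mul c _⟩ 1
    fun f => (f.abs_integral_le μ).trans_eq (one_mul _).symm

theorem norm_integral_le (μ : Measure X) [IsProbabilityMeasure μ] : ‖integral μ‖ ≤ 1 :=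
  LinearMap.mkContinuous_norm_le _ zero_le_one _

/-- The action of a Markov kernel on bounded measurable functions. -/
def ofKernel (K : Kernel X Y) [IsMarkovKernel K] : BM Y →L[ℝ] BM X :=
  LinearMap.mkContinuous
    ⟨⟨fun f => mk (fun x => ∫ y, f y ∂(K x))
        (StronglyMeasurable.integral_kernel f.measurable.stronglyMeasurable).measurable ‖f‖
        fun x => f.abs_integral_le (K x),
      fun f g => ext fun x => integral_add (f.integrable _) (g.integrable _)⟩,
      fun c f => ext fun x => integral_const_mul c _⟩ 1
    fun f => by
      rw [one_mul]
      exact norm_le (norm_nonneg _) fun x => f.abs_integral_le (K x)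

theorem ofKernel_apply (K : Kernel X Y) [IsMarkovKernel K] (f : BM Y) (x : X) :
    ofKernel K f x = ∫ y, f y ∂(K x) := rfl

theorem norm_ofKernel_le (K : Kernel X Y) [IsMarkovKernel K] : ‖ofKernel K‖ ≤ 1 :=
  LinearMap.mkContinuous_norm_le _ zero_le_one _

/-- Multiplication by a bounded measurable function. -/
def mulOp (g : BM X) : BM X →L[ℝ] BM X := ContinuousLinearMap.mul ℝ (BM X) g

theorem mulOp_apply (g f : BM X) : mulOp g f = g * f := rfl

theorem norm_mulOp_le (g : BM X) : ‖mulOp g‖ ≤ ‖g‖ :=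
  ContinuousLinearMap.opNorm_mul_apply_le ℝ (BM X) g

/-- Composition of a bounded measurable function with a measurable map. -/
def comp (f : BM Y) (u : X → Y) (hu : Measurable u) : BM X :=
  mk (fun x => f (u x)) (f.measurable.comp hu) ‖f‖ fun x => f.abs_apply_le (u x)

end BM

/-! ### Change of measure for product policies -/

/-- Densities multiply under products of probability measures. -/
theorem pi_withDensity {ι : Type*} [Fintype ι] {α : ι → Type*} [∀ i, MeasurableSpace (α i)]
    {μ ν : ∀ i, Measure (α i)} [∀ i, IsProbabilityMeasure (μ i)] [∀ i, IsProbabilityMeasure (ν i)]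
    {f : ∀ i, α i → ENNReal} (hf : ∀ i, Measurable (f i))
    (h : ∀ i, ν i = (μ i).withDensity (f i)) :
    Measure.pi ν = (Measure.pi μ).withDensity fun a => ∏ i, f i (a i) := by
  refine Measure.pi_eq fun s hs => ?_
  rw [withDensity_apply _ (MeasurableSet.univ_pi hs), ← lintegral_indicator (MeasurableSet.univ_pi hs)]
  have h1 : (Set.univ.pi s).indicator (fun a => ∏ i, f i (a i)) =
      fun a : ∀ i, α i => ∏ i, (s i).indicator (f i) (a i) := by
    funext a
    by_cases ha : a ∈ Set.univ.pi s
    · rw [Set.indicator_of_mem ha]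
      exact Finset.prod_congr rfl fun i _ => (Set.indicator_of_mem (ha i trivial) _).symm
    · rw [Set.indicator_of_notMem ha]
      simp only [Set.mem_pi, Set.mem_univ, true_implies, not_forall] at ha
      obtain ⟨i, hi⟩ := ha
      exact (Finset.prod_eq_zero (Finset.mem_univ i) (Set.indicator_of_notMem hi _)).symm
  have hm : ∀ i, Measurable ((s i).indicator (f i)) := fun i => (hf i).indicator (hs i)
  rw [h1, lintegral_prod_eq_prod_lintegral_of_indepFun Finset.univ
    (fun i (a : ∀ i, α i) => (s i).indicator (f i) (a i))
    (iIndepFun_pi (X := fun i => (s i).indicator (f i)) fun i => (hm i).aemeasurable)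
    (fun i => (hm i).comp (measurable_pi_apply i))]
  refine Finset.prod_congr rfl fun i _ => ?_
  rw [h i, withDensity_apply _ (hs i), ← lintegral_indicator (hs i)]
  exact (measurePreserving_eval μ i).lintegral_comp (hm i)

namespace Model

variable {ι : Type*} [Fintype ι] [DecidableEq ι] {G : SimpleGraph ι} {κ d : ℕ}
  {S A : ι → Type*} [∀ i, MeasurableSpace (S i)] [∀ i, MeasurableSpace (A i)]

theorem localPolicy_apply (M : Model G κ d S A) (i : ι) (θ : Params ι d) (s : S i) :
    M.localPolicy i (θ, s) = (M.ref i).withDensity fun a => ENNReal.ofReal (M.policy i s a θ) := by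
  rw [localPolicy, Kernel.withDensity_apply _ (M.measurable_policy_density i)]
  rfl

theorem measurable_policy_action (M : Model G κ d S A) (i : ι) (s : S i) (θ : Params ι d) :
    Measurable fun a => M.policy i s a θ :=
  (M.policy_measurable i).comp (by fun_prop : Measurable fun a : A i => ((s, a), θ))

/-- The log-likelihood ratio of the joint action under the copies `ψ'` and `ψ`. -/
def logRatio (M : Model G κ d S A) (ψ ψ' : ι → Params ι d) (x : (∀ i, S i) × (∀ i, A i)) : ℝ :=
  ∑ i, (Real.log (M.policy i (x.1 i) (x.2 i) (ψ' i)) - Real.log (M.policy i (x.1 i) (x.2 i) (ψ i)))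

theorem measurable_log_policy (M : Model G κ d S A) (i : ι) (θ : Params ι d) :
    Measurable fun x : (∀ i, S i) × (∀ i, A i) => Real.log (M.policy i (x.1 i) (x.2 i) θ) := by
  have h : Measurable fun x : (∀ i, S i) × (∀ i, A i) => ((x.1 i, x.2 i), θ) := by fun_prop
  exact Real.measurable_log.comp ((M.policy_measurable i).comp h)

theorem measurable_logRatio (M : Model G κ d S A) (ψ ψ' : ι → Params ι d) :
    Measurable (M.logRatio ψ ψ') :=
  Finset.measurable_sum _ fun i _ =>
    (M.measurable_log_policy i (ψ' i)).sub (M.measurable_log_policy i (ψ i))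

theorem jointPolicy_apply (M : Model G κ d S A) (ψ : ι → Params ι d) (s : ∀ i, S i) :
    M.jointPolicy (ψ, s) = Measure.pi fun i => M.localPolicy i (ψ i, s i) := rfl

theorem localPolicy_eq_withDensity (M : Model G κ d S A) (i : ι) (θ θ' : Params ι d) (s : S i) :
    M.localPolicy i (θ', s) = (M.localPolicy i (θ, s)).withDensity fun a =>
      ENNReal.ofReal (Real.exp (Real.log (M.policy i s a θ') - Real.log (M.policy i s a θ))) := by
  rw [localPolicy_apply, localPolicy_apply, ← withDensity_mul]
  · congr 1
    funext a
    have h := M.policy_pos i s a θ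
    have h' := M.policy_pos i s a θ'
    rw [Pi.mul_apply, ← ENNReal.ofReal_mul h.le, Real.exp_sub, Real.exp_log h, Real.exp_log h',
      mul_div_cancel₀ _ h.ne']
  · exact (M.measurable_policy_action i s θ).ennreal_ofReal
  · exact (Real.measurable_exp.comp ((Real.measurable_log.comp
      (M.measurable_policy_action i s θ')).sub (Real.measurable_log.comp
      (M.measurable_policy_action i s θ)))).ennreal_ofReal

theorem jointPolicy_eq_withDensity (M : Model G κ d S A) (ψ ψ' : ι → Params ι d) (s : ∀ i, S i) :
    M.jointPolicy (ψ', s) = (M.jointPolicy (ψ, s)).withDensity fun a =>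
      ENNReal.ofReal (Real.exp (M.logRatio ψ ψ' (s, a))) := by
  rw [jointPolicy_apply, jointPolicy_apply, pi_withDensity
    (fun i => (Real.measurable_exp.comp ((Real.measurable_log.comp
      (M.measurable_policy_action i (s i) (ψ' i))).sub (Real.measurable_log.comp
      (M.measurable_policy_action i (s i) (ψ i))))).ennreal_ofReal)
    (fun i => M.localPolicy_eq_withDensity i (ψ i) (ψ' i) (s i))]
  congr 1
  funext a
  rw [logRatio, Real.exp_sum, ENNReal.ofReal_prod_of_nonneg fun i _ => (Real.exp_pos _).le]
  rfl

/-- Change of measure between the joint policies of two families of copies. -/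
theorem integral_jointPolicy_change (M : Model G κ d S A) (ψ ψ' : ι → Params ι d) (s : ∀ i, S i)
    (f : (∀ i, A i) → ℝ) :
    ∫ a, f a ∂(M.jointPolicy (ψ', s)) =
      ∫ a, Real.exp (M.logRatio ψ ψ' (s, a)) * f a ∂(M.jointPolicy (ψ, s)) := by
  have hm : Measurable fun a => Real.exp (M.logRatio ψ ψ' (s, a)) :=
    Real.measurable_exp.comp ((M.measurable_logRatio ψ ψ').comp (by fun_prop))
  rw [M.jointPolicy_eq_withDensity ψ ψ' s, integral_withDensity_eq_integral_toReal_smul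
    hm.ennreal_ofReal (Filter.Eventually.of_forall fun a => ENNReal.ofReal_lt_top)]
  simp [ENNReal.toReal_ofReal (Real.exp_pos _).le]

/-! ### Expansion of the log-policies -/

theorem logGrad_eq_zero (M : Model G κ d S A) {i j : ι} (h : j ∉ nbhd G κ i) (s : S i) (a : A i)
    (θ : Params ι d) : M.logGrad i j s a θ = 0 := by
  have hc : (fun x => Real.log (M.policy i s a (setBlock θ j x))) =
      fun _ => Real.log (M.policy i s a θ) := by
    funext x
    congr 1
    refine M.policy_local i s a _ _ fun k hk => ?_
    have hkj : k ≠ j := fun e => h (e ▸ hk)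
    simp [setBlock, Function.update_of_ne hkj]
  rw [logGrad, hc]
  simp [gradient]

theorem norm_logGrad_le {M : Model G κ d S A} {B : ℝ} (hB : 0 ≤ B) (h : M.LogGradBound B) (i j : ι)
    (s : S i) (a : A i) (θ : Params ι d) : ‖M.logGrad i j s a θ‖ ≤ B := by
  by_cases hj : j ∈ nbhd G κ i
  · exact h i j hj s a θ
  · rw [M.logGrad_eq_zero hj, norm_zero]; exact hB

theorem norm_logGrad_sub_le {M : Model G κ d S A} {L : ℝ} (hL : 0 ≤ L) (h : M.LogGradLipschitz L)
    (i j : ι) (s : S i) (a : A i) (θ θ' : Params ι d) :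
    ‖M.logGrad i j s a θ - M.logGrad i j s a θ'‖ ≤ L * ‖θ - θ'‖ := by
  by_cases hj : j ∈ nbhd G κ i
  · exact h i j hj s a θ θ'
  · rw [M.logGrad_eq_zero hj, M.logGrad_eq_zero hj, sub_zero, norm_zero]; positivity

theorem setBlock_same (θ : Params ι d) (j : ι) (x : EuclideanSpace ℝ (Fin d)) :
    setBlock θ j x j = x := by simp [setBlock]

theorem setBlock_setBlock (θ : Params ι d) (j : ι) (x y : EuclideanSpace ℝ (Fin d)) :
    setBlock (setBlock θ j x) j y = setBlock θ j y := by simp [setBlock]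

theorem setBlock_self (θ : Params ι d) (j : ι) : setBlock θ j (θ j) = θ := by
  simp [setBlock]

theorem setBlock_sub_setBlock (θ : Params ι d) (j : ι) (x y : EuclideanSpace ℝ (Fin d)) :
    setBlock θ j x - setBlock θ j y = PiLp.single 2 j (x - y) := by
  ext k c
  by_cases hk : k = j
  · subst hk; simp [setBlock]
  · simp [setBlock, hk]

theorem norm_setBlock_sub (θ : Params ι d) (j : ι) (x y : EuclideanSpace ℝ (Fin d)) :
    ‖setBlock θ j x - setBlock θ j y‖ = ‖x - y‖ := by
  rw [setBlock_sub_setBlock]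
  exact PiLp.norm_single 2 (fun _ : ι => EuclideanSpace ℝ (Fin d)) j (x - y)

theorem abs_log_policy_setBlock_sub_le {M : Model G κ d S A} {L : ℝ} (hL : 0 ≤ L)
    (h : M.LogGradLipschitz L) (i j : ι) (s : S i) (a : A i) (θ : Params ι d)
    (y : EuclideanSpace ℝ (Fin d)) :
    |Real.log (M.policy i s a (setBlock θ j y)) - Real.log (M.policy i s a θ) -
      inner ℝ (M.logGrad i j s a θ) (y - θ j)| ≤ L * ‖y - θ j‖ ^ 2 := by
  set f : EuclideanSpace ℝ (Fin d) → ℝ := fun x => Real.log (M.policy i s a (setBlock θ j x))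
  have hd : ∀ x, HasFDerivAt f (InnerProductSpace.toDual ℝ _ (M.logGrad i j s a (setBlock θ j x))) x := by
    intro x
    have h1 := (M.differentiableAt_logPolicy i j s a (setBlock θ j x)).hasGradientAt.hasFDerivAt
    simpa only [setBlock_setBlock, setBlock_same, logGrad] using h1
  have hb := (convex_segment (θ j) y).norm_image_sub_le_of_norm_hasFDerivWithin_le'
    (f := f) (φ := InnerProductSpace.toDual ℝ _ (M.logGrad i j s a θ)) (C := L * ‖y - θ j‖)
    (fun x _ => (hd x).hasFDerivWithinAt) (fun x hx => ?_)
    (left_mem_segment ℝ (θ j) y) (right_mem_segment ℝ (θ j) y)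
  · simp only [f, setBlock_self, InnerProductSpace.toDual_apply_apply, Real.norm_eq_abs] at hb
    rw [pow_two, ← mul_assoc]
    exact hb
  · rw [← map_sub, LinearIsometryEquiv.norm_map]
    refine (norm_logGrad_sub_le hL h i j s a _ _).trans ?_
    have h2 : ‖setBlock θ j x - θ‖ = ‖x - θ j‖ := by
      have := norm_setBlock_sub θ j x (θ j)
      rwa [setBlock_self] at this
    rw [h2]
    gcongr
    obtain ⟨u, v, hu, hv, huv, rfl⟩ := hx
    have h3 : u • θ j + v • y - θ j = v • (y - θ j) := by
      rw [eq_sub_iff_add_eq.2 huv]; module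
    rw [h3, norm_smul, Real.norm_of_nonneg hv]
    exact mul_le_of_le_one_left (norm_nonneg _) (by linarith)

/-- Changing the blocks of the parameter one at a time turns the blockwise gradients into a
first-order expansion of the log-policy in the whole parameter. -/
theorem abs_log_policy_sub_le {M : Model G κ d S A} {L : ℝ} (hL : 0 ≤ L)
    (h : M.LogGradLipschitz L) (i : ι) (s : S i) (a : A i) (θ θ' : Params ι d) :
    |Real.log (M.policy i s a θ') - Real.log (M.policy i s a θ) -
      ∑ j, inner ℝ (M.logGrad i j s a θ) (θ' j - θ j)| ≤
        2 * Fintype.card ι * L * ‖θ' - θ‖ ^ 2 := by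
  let θm : Finset ι → Params ι d := fun t => WithLp.toLp 2 fun j => if j ∈ t then θ' j else θ j
  have hθm : ∀ t, ‖θm t - θ‖ ≤ ‖θ' - θ‖ := fun t => by
    rw [PiLp.norm_eq_of_L2, PiLp.norm_eq_of_L2]
    refine Real.sqrt_le_sqrt (Finset.sum_le_sum fun j _ => ?_)
    gcongr
    simp only [θm, PiLp.sub_apply]
    split_ifs
    · exact le_rfl
    · simp
  have hstep : ∀ t : Finset ι, |Real.log (M.policy i s a (θm t)) - Real.log (M.policy i s a θ) -
      ∑ j ∈ t, inner ℝ (M.logGrad i j s a θ) (θ' j - θ j)| ≤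
        2 * t.card * L * ‖θ' - θ‖ ^ 2 := by
    intro t
    induction t using Finset.induction_on with
    | empty =>
      have : θm ∅ = θ := by ext; simp [θm]
      simp [this]
    | insert j t hj ih =>
      have h1 : θm (insert j t) = setBlock (θm t) j (θ' j) := by
        ext k c
        by_cases hk : k = j
        · subst hk; simp [θm, setBlock]
        · simp [θm, setBlock, hk]
      have h2 : θm t j = θ j := by simp [θm, hj]
      have h3 := abs_log_policy_setBlock_sub_le hL h i j s a (θm t) (θ' j)
      rw [← h1, h2] at h3
      have hjn : ‖θ' j - θ j‖ ≤ ‖θ' - θ‖ := PiLp.norm_apply_le (θ' - θ) j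
      have h4 : |inner ℝ (M.logGrad i j s a (θm t)) (θ' j - θ j) -
          inner ℝ (M.logGrad i j s a θ) (θ' j - θ j)| ≤ L * ‖θ' - θ‖ ^ 2 := by
        rw [← inner_sub_left]
        calc _ ≤ ‖M.logGrad i j s a (θm t) - M.logGrad i j s a θ‖ * ‖θ' j - θ j‖ :=
              abs_real_inner_le_norm _ _
          _ ≤ (L * ‖θ' - θ‖) * ‖θ' - θ‖ := by
              gcongr
              exact (norm_logGrad_sub_le hL h i j s a _ _).trans (by gcongr; exact hθm t)
          _ = _ := by ring
      have h5 : L * ‖θ' j - θ j‖ ^ 2 ≤ L * ‖θ' - θ‖ ^ 2 := by gcongr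
      rw [Finset.sum_insert hj, Finset.card_insert_of_notMem hj]
      push_cast
      rw [abs_le] at *
      constructor <;> linarith
  have := hstep Finset.univ
  have hu : θm Finset.univ = θ' := by ext; simp [θm]
  rwa [hu, Finset.card_univ] at this

/-- The derivative at `ψ` of the joint log-policy in the direction `δ`. -/
def score (M : Model G κ d S A) (ψ δ : ι → Params ι d) (x : (∀ i, S i) × (∀ i, A i)) : ℝ :=
  ∑ i, ∑ j, inner ℝ (M.logGrad i j (x.1 i) (x.2 i) (ψ i)) (δ i j)

theorem measurable_logGrad_at (M : Model G κ d S A) (i j : ι) (θ : Params ι d) :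
    Measurable fun x : (∀ i, S i) × (∀ i, A i) => M.logGrad i j (x.1 i) (x.2 i) θ := by
  have h : Measurable fun x : (∀ i, S i) × (∀ i, A i) => ((x.1 i, x.2 i), θ) := by fun_prop
  exact (M.measurable_logGrad i j).comp h

theorem measurable_score (M : Model G κ d S A) (ψ δ : ι → Params ι d) :
    Measurable (M.score ψ δ) :=
  Finset.measurable_sum _ fun i _ => Finset.measurable_sum _ fun j _ =>
    (M.measurable_logGrad_at i j (ψ i)).inner measurable_const

theorem abs_score_le {M : Model G κ d S A} {B : ℝ} (hB : 0 ≤ B) (h : M.LogGradBound B)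
    (ψ δ : ι → Params ι d) (x : (∀ i, S i) × (∀ i, A i)) :
    |M.score ψ δ x| ≤ (Fintype.card ι) ^ 2 * B * ‖δ‖ := by
  have h1 : ∀ i j, |inner ℝ (M.logGrad i j (x.1 i) (x.2 i) (ψ i)) (δ i j)| ≤ B * ‖δ‖ := fun i j =>
    (abs_real_inner_le_norm _ _).trans (mul_le_mul (norm_logGrad_le hB h i j _ _ _)
      ((PiLp.norm_apply_le (δ i) j).trans (norm_le_pi_norm δ i)) (norm_nonneg _) hB)
  calc |M.score ψ δ x| ≤ ∑ i : ι, ∑ j : ι, B * ‖δ‖ :=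
        (Finset.abs_sum_le_sum_abs _ _).trans (Finset.sum_le_sum fun i _ =>
          (Finset.abs_sum_le_sum_abs _ _).trans (Finset.sum_le_sum fun j _ => h1 i j))
    _ = _ := by simp; ring

theorem abs_logRatio_sub_score_le {M : Model G κ d S A} {L : ℝ} (hL : 0 ≤ L)
    (h : M.LogGradLipschitz L) (ψ ψ' : ι → Params ι d) (x : (∀ i, S i) × (∀ i, A i)) :
    |M.logRatio ψ ψ' x - M.score ψ (ψ' - ψ) x| ≤
      2 * (Fintype.card ι) ^ 2 * L * ‖ψ' - ψ‖ ^ 2 := by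
  rw [logRatio, score, ← Finset.sum_sub_distrib]
  calc _ ≤ ∑ i : ι, 2 * Fintype.card ι * L * ‖ψ' - ψ‖ ^ 2 :=
        (Finset.abs_sum_le_sum_abs _ _).trans (Finset.sum_le_sum fun i _ =>
          (abs_log_policy_sub_le hL h i (x.1 i) (x.2 i) (ψ i) (ψ' i)).trans (by
            gcongr; exact norm_le_pi_norm (ψ' - ψ) i))
    _ = _ := by simp; ring

/-! ### Policy and transition operators -/

/-- The policy kernel from states to state-action pairs. -/
def policyKernel (M : Model G κ d S A) (ψ : ι → Params ι d) :
    Kernel (∀ i, S i) ((∀ i, S i) × (∀ i, A i)) :=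
  Kernel.id ×ₖ M.jointPolicy.comap (fun s => (ψ, s)) (by fun_prop)

instance (M : Model G κ d S A) (ψ : ι → Params ι d) : IsMarkovKernel (M.policyKernel ψ) := by
  unfold policyKernel; infer_instance

/-- The policy operator: averaging over the action. -/
def policyOp (M : Model G κ d S A) (ψ : ι → Params ι d) :
    BM ((∀ i, S i) × (∀ i, A i)) →L[ℝ] BM (∀ i, S i) :=
  BM.ofKernel (M.policyKernel ψ)

theorem policyOp_apply (M : Model G κ d S A) (ψ : ι → Params ι d)
    (f : BM ((∀ i, S i) × (∀ i, A i))) (s : ∀ i, S i) :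
    M.policyOp ψ f s = ∫ a, f (s, a) ∂(M.jointPolicy (ψ, s)) := by
  rw [policyOp, BM.ofKernel_apply, policyKernel, Kernel.prod_apply, Kernel.id_apply,
    Measure.dirac_prod, integral_map (by fun_prop) f.measurable.aestronglyMeasurable]
  rfl

theorem norm_policyOp_le (M : Model G κ d S A) (ψ : ι → Params ι d) : ‖M.policyOp ψ‖ ≤ 1 :=
  BM.norm_ofKernel_le _

/-- The score as a bounded measurable function. -/
def scoreFn (M : Model G κ d S A) {B : ℝ} (hB : 0 ≤ B) (h : M.LogGradBound B)
    (ψ δ : ι → Params ι d) : BM ((∀ i, S i) × (∀ i, A i)) :=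
  BM.mk (M.score ψ δ) (M.measurable_score ψ δ) _ (abs_score_le hB h ψ δ)

theorem norm_scoreFn_le (M : Model G κ d S A) {B : ℝ} (hB : 0 ≤ B) (h : M.LogGradBound B)
    (ψ δ : ι → Params ι d) : ‖M.scoreFn hB h ψ δ‖ ≤ (Fintype.card ι) ^ 2 * B * ‖δ‖ :=
  BM.norm_le (by positivity) (abs_score_le hB h ψ δ)

/-- A constant for the first- and second-order expansions of the policy operator. It dominates the
coefficients of the first-order term and of the remainder of the log-likelihood ratio; the summand
`1` makes the perturbations `δ` with `lipConst * ‖δ‖ ≤ 1` have norm at most `1`. -/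
def lipConst (N : ℕ) (B L : ℝ) : ℝ := (N : ℝ) ^ 2 * B + 2 * (N : ℝ) ^ 2 * L + 1

theorem one_le_lipConst (N : ℕ) {B L : ℝ} (hB : 0 ≤ B) (hL : 0 ≤ L) : 1 ≤ lipConst N B L := by
  unfold lipConst
  have : 0 ≤ (N : ℝ) ^ 2 * B + 2 * (N : ℝ) ^ 2 * L := by positivity
  linarith

theorem abs_integral_jointPolicy_weight_le (M : Model G κ d S A) (ψ : ι → Params ι d)
    (s : ∀ i, S i) {w : (∀ i, A i) → ℝ} {c : ℝ} (hw : ∀ a, |w a| ≤ c)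
    (f : BM ((∀ i, S i) × (∀ i, A i))) :
    |∫ a, w a * f (s, a) ∂(M.jointPolicy (ψ, s))| ≤ c * ‖f‖ := by
  have := norm_integral_le_of_norm_le_const (μ := M.jointPolicy (ψ, s))
    (f := fun a => w a * f (s, a)) (C := c * ‖f‖) (Filter.Eventually.of_forall fun a => by
      rw [norm_mul]
      exact mul_le_mul (hw a) (f.abs_apply_le _) (norm_nonneg _) ((abs_nonneg _).trans (hw a)))
  simpa using this

/-- The policy operator is Lipschitz in the copies and has the quadratic expansion whose linear term
is multiplication by the score: the likelihood-ratio form of the derivative. -/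
theorem norm_policyOp_expansion_le {M : Model G κ d S A} {B L : ℝ} (hB : 0 ≤ B) (hL : 0 ≤ L)
    (hMB : M.LogGradBound B) (hML : M.LogGradLipschitz L) (ψ ψ' : ι → Params ι d) :
    ‖M.policyOp ψ' - M.policyOp ψ‖ ≤ 2 * lipConst (Fintype.card ι) B L * ‖ψ' - ψ‖ ∧
    ‖M.policyOp ψ' - M.policyOp ψ -
      M.policyOp ψ ∘L BM.mulOp (M.scoreFn hB hMB ψ (ψ' - ψ))‖ ≤
        3 * lipConst (Fintype.card ι) B L ^ 2 * ‖ψ' - ψ‖ ^ 2 := by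
  set k := lipConst (Fintype.card ι) B L with hk
  set δ := ψ' - ψ
  have hk1 : 1 ≤ k := one_le_lipConst _ hB hL
  have hS := M.norm_scoreFn_le hB hMB ψ δ
  have hbk : (Fintype.card ι : ℝ) ^ 2 * B ≤ k := by
    rw [hk, lipConst]
    have : 0 ≤ 2 * (Fintype.card ι : ℝ) ^ 2 * L := by positivity
    linarith
  have hSk : ‖M.scoreFn hB hMB ψ δ‖ ≤ k * ‖δ‖ := hS.trans (by gcongr)
  by_cases hδ : k * ‖δ‖ ≤ 1
  · -- Small perturbations: compare the likelihood ratio `exp ℓ` with its expansion pointwise.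
    have hδ1 : ‖δ‖ ≤ 1 := (le_mul_of_one_le_left (norm_nonneg _) hk1).trans hδ
    have hℓ : ∀ x, |M.logRatio ψ ψ' x| ≤ k * ‖δ‖ := fun x => by
      have h1 := abs_logRatio_sub_score_le hL hML ψ ψ' x
      have h2 := abs_score_le hB hMB ψ (ψ' - ψ) x
      have h3 : 2 * (Fintype.card ι : ℝ) ^ 2 * L * ‖δ‖ ^ 2 ≤
          2 * (Fintype.card ι : ℝ) ^ 2 * L * ‖δ‖ := by
        gcongr
        rw [pow_two]
        exact mul_le_of_le_one_left (norm_nonneg _) hδ1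
      have h4 : k * ‖δ‖ = (Fintype.card ι : ℝ) ^ 2 * B * ‖δ‖ +
          2 * (Fintype.card ι : ℝ) ^ 2 * L * ‖δ‖ + ‖δ‖ := by rw [hk, lipConst]; ring
      have h5 := norm_nonneg δ
      rw [h4]
      rw [abs_le] at *
      constructor <;> linarith
    have hchange : ∀ (f : BM ((∀ i, S i) × (∀ i, A i))) (s : ∀ i, S i),
        Integrable (fun a => Real.exp (M.logRatio ψ ψ' (s, a)) * f (s, a))
          (M.jointPolicy (ψ, s)) := fun f s => by
      refine Integrable.of_bound (C := Real.exp (k * ‖δ‖) * ‖f‖) ?_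
        (Filter.Eventually.of_forall fun a => ?_)
      · exact ((Real.measurable_exp.comp ((M.measurable_logRatio ψ ψ').comp (by fun_prop))).mul
          (f.measurable.comp (by fun_prop))).aestronglyMeasurable
      · rw [norm_mul, Real.norm_of_nonneg (Real.exp_pos _).le]
        gcongr
        · exact (le_abs_self _).trans (hℓ _)
        · exact f.abs_apply_le _
    have hint : ∀ (f : BM ((∀ i, S i) × (∀ i, A i))) (s : ∀ i, S i),
        Integrable (fun a => f (s, a)) (M.jointPolicy (ψ, s)) := fun f s =>
      Integrable.of_bound (C := ‖f‖) (f.measurable.comp (by fun_prop)).aestronglyMeasurable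
        (Filter.Eventually.of_forall fun a => f.abs_apply_le _)
    constructor
    · refine ContinuousLinearMap.opNorm_le_bound _ (by positivity) fun f => ?_
      refine BM.norm_le (by positivity) fun s => ?_
      rw [sub_apply, BM.sub_apply, policyOp_apply, policyOp_apply,
        M.integral_jointPolicy_change ψ ψ' s, ← integral_sub (hchange f s) (hint f s)]
      simp only [← sub_one_mul]
      refine M.abs_integral_jointPolicy_weight_le ψ s (fun a => ?_) f
      refine (Real.abs_exp_sub_one_le ((hℓ _).trans hδ)).trans ?_
      have := hℓ (s, a)
      linarith
    · refine ContinuousLinearMap.opNorm_le_bound _ (by positivity) fun f => ?_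
      refine BM.norm_le (by positivity) fun s => ?_
      have hi3 := hint (M.scoreFn hB hMB ψ δ * f) s
      have hi12 : Integrable (fun a => Real.exp (M.logRatio ψ ψ' (s, a)) * f (s, a) - f (s, a))
          (M.jointPolicy (ψ, s)) := (hchange f s).sub (hint f s)
      rw [sub_apply, sub_apply, BM.sub_apply, BM.sub_apply, ContinuousLinearMap.comp_apply,
        BM.mulOp_apply, policyOp_apply, policyOp_apply, policyOp_apply,
        M.integral_jointPolicy_change ψ ψ' s, ← integral_sub (hchange f s) (hint f s),
        ← integral_sub hi12 hi3]
      have he : ∀ a, Real.exp (M.logRatio ψ ψ' (s, a)) * f (s, a) - f (s, a) -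
          (M.scoreFn hB hMB ψ δ * f) (s, a) =
          (Real.exp (M.logRatio ψ ψ' (s, a)) - 1 - M.score ψ δ (s, a)) * f (s, a) := fun a => by
        rw [BM.mul_apply, scoreFn, BM.mk_apply]; ring
      simp only [he]
      refine M.abs_integral_jointPolicy_weight_le ψ s (fun a => ?_) f
      have h1 := Real.abs_exp_sub_one_sub_id_le ((hℓ (s, a)).trans hδ)
      have h2 := abs_logRatio_sub_score_le hL hML ψ ψ' (s, a)
      have h3 : (M.logRatio ψ ψ' (s, a)) ^ 2 ≤ k ^ 2 * ‖δ‖ ^ 2 := by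
        rw [← sq_abs, ← mul_pow]
        gcongr
        exact hℓ _
      have h4 : 2 * (Fintype.card ι : ℝ) ^ 2 * L * ‖δ‖ ^ 2 ≤ k ^ 2 * ‖δ‖ ^ 2 := by
        gcongr
        calc 2 * (Fintype.card ι : ℝ) ^ 2 * L ≤ k := by
              rw [hk, lipConst]
              have : 0 ≤ (Fintype.card ι : ℝ) ^ 2 * B := by positivity
              linarith
          _ ≤ k ^ 2 := by nlinarith
      have h5 : 0 ≤ k ^ 2 * ‖δ‖ ^ 2 := by positivity
      rw [abs_le] at *
      constructor <;> linarith
  · -- Large perturbations: the trivial bounds suffice.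
    have hδ' : 1 ≤ k * ‖δ‖ := (not_le.1 hδ).le
    have h1 : ‖M.policyOp ψ' - M.policyOp ψ‖ ≤ 2 :=
      (norm_sub_le _ _).trans (by linarith [M.norm_policyOp_le ψ, M.norm_policyOp_le ψ'])
    have h2 : ‖M.policyOp ψ ∘L BM.mulOp (M.scoreFn hB hMB ψ δ)‖ ≤ k * ‖δ‖ := by
      refine (ContinuousLinearMap.opNorm_comp_le _ _).trans ?_
      refine (mul_le_of_le_one_left (norm_nonneg _) (M.norm_policyOp_le ψ)).trans ?_
      exact (BM.norm_mulOp_le _).trans hSk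
    constructor
    · linarith
    · refine (norm_sub_le _ _).trans ?_
      have h3 : k * ‖δ‖ ≤ (k * ‖δ‖) ^ 2 := by nlinarith
      have h4 : (k * ‖δ‖) ^ 2 = k ^ 2 * ‖δ‖ ^ 2 := by ring
      nlinarith

end Model

/-! ### Independence of the local chains -/

/-- A function that does not see coordinate `j` has the same integral under two product measures that
differ only in coordinate `j`. -/
theorem integral_pi_eq_of_update {ι : Type*} [Fintype ι] [DecidableEq ι] {α : ι → Type*}
    [∀ i, MeasurableSpace (α i)] {μ ν : ∀ i, Measure (α i)} [∀ i, IsProbabilityMeasure (μ i)]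
    [∀ i, IsProbabilityMeasure (ν i)] {j : ι} (h : ∀ i, i ≠ j → μ i = ν i) {f : (∀ i, α i) → ℝ}
    (hf : Measurable f) (hfj : ∀ a x, f (Function.update a j x) = f a) :
    ∫ a, f a ∂(Measure.pi μ) = ∫ a, f a ∂(Measure.pi ν) := by
  obtain ⟨x₀⟩ : Nonempty (α j) := nonempty_of_isProbabilityMeasure (μ j)
  -- Overwriting coordinate `j` by the constant `x₀` turns both measures into the same measure.
  let g : ∀ i, α i → α i := Function.update (fun i => id) j fun _ => x₀
  have hgm : ∀ i, Measurable (g i) := fun i => by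
    by_cases hi : i = j
    · subst hi; simp [g]
    · simp only [g, Function.update_of_ne hi]; exact measurable_id
  have hg : ∀ a : ∀ i, α i, (fun i => g i (a i)) = Function.update a j x₀ := fun a => by
    funext i
    by_cases hi : i = j
    · subst hi; simp [g]
    · simp [g, hi]
  have hgμ : ∀ (μ : ∀ i, Measure (α i)) [∀ i, IsProbabilityMeasure (μ i)],
      ∫ a, f a ∂(Measure.pi μ) = ∫ a, f a ∂(Measure.pi fun i => (μ i).map (g i)) := by
    intro μ _
    have hp : ∀ i, IsProbabilityMeasure ((μ i).map (g i)) := fun i =>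
      Measure.isProbabilityMeasure_map (hgm i).aemeasurable
    have hgm' : Measurable fun (a : ∀ i, α i) i => g i (a i) :=
      measurable_pi_lambda _ fun i => (hgm i).comp (measurable_pi_apply i)
    rw [← Measure.pi_map_pi fun i => (hgm i).aemeasurable,
      integral_map hgm'.aemeasurable hf.aestronglyMeasurable]
    simp only [hg, hfj]
  rw [hgμ μ, hgμ ν]
  congr 2
  funext i
  by_cases hi : i = j
  · subst hi; simp [g, Measure.map_const]
  · rw [h i hi]

namespace Model

variable {ι : Type*} [Fintype ι] [DecidableEq ι] {G : SimpleGraph ι} {κ d : ℕ}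
  {S A : ι → Type*} [∀ i, MeasurableSpace (S i)] [∀ i, MeasurableSpace (A i)]

/-- The transition operator: averaging over the next state. -/
def transOp (M : Model G κ d S A) : BM (∀ i, S i) →L[ℝ] BM ((∀ i, S i) × (∀ i, A i)) :=
  BM.ofKernel M.jointTrans

theorem norm_transOp_le (M : Model G κ d S A) : ‖M.transOp‖ ≤ 1 := BM.norm_ofKernel_le _

/-- Averaging over the initial state. -/
def initOp (M : Model G κ d S A) : BM (∀ i, S i) →L[ℝ] ℝ := BM.integral M.init

theorem norm_initOp_le (M : Model G κ d S A) : ‖M.initOp‖ ≤ 1 := BM.norm_integral_le _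

/-- The one-step operator on functions of state-action pairs. -/
def stepOp (M : Model G κ d S A) (ψ : ι → Params ι d) :
    BM ((∀ i, S i) × (∀ i, A i)) →L[ℝ] BM ((∀ i, S i) × (∀ i, A i)) :=
  M.transOp ∘L M.policyOp ψ

theorem norm_stepOp_le (M : Model G κ d S A) (ψ : ι → Params ι d) : ‖M.stepOp ψ‖ ≤ 1 :=
  norm_comp_le_one M.norm_transOp_le (M.norm_policyOp_le ψ)

/-- The discounted state-action value functions under the copies `ψ`, as an operator applied to
rewards. -/
def valueOp (M : Model G κ d S A) (ψ : ι → Params ι d) :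
    BM ((∀ i, S i) × (∀ i, A i)) →L[ℝ] BM ((∀ i, S i) × (∀ i, A i)) :=
  resolv M.discount (M.stepOp ψ)

/-- The discounted state-action occupancy under the copies `ψ`. -/
def occOp (M : Model G κ d S A) (ψ : ι → Params ι d) : BM ((∀ i, S i) × (∀ i, A i)) →L[ℝ] ℝ :=
  occ M.discount M.initOp M.transOp (M.policyOp ψ)

/-- `f` does not depend on the state and action of agent `j`. -/
def Ignores (j : ι) (f : BM ((∀ i, S i) × (∀ i, A i))) : Prop :=
  ∀ s a x y, f (Function.update s j x, Function.update a j y) = f (s, a)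

theorem Ignores.left {j : ι} {f : BM ((∀ i, S i) × (∀ i, A i))} (h : Ignores j f)
    (s : ∀ i, S i) (a : ∀ i, A i) (x : S j) : f (Function.update s j x, a) = f (s, a) := by
  simpa using h s a x (a j)

theorem Ignores.right {j : ι} {f : BM ((∀ i, S i) × (∀ i, A i))} (h : Ignores j f)
    (s : ∀ i, S i) (a : ∀ i, A i) (y : A j) : f (s, Function.update a j y) = f (s, a) := by
  simpa using h s a (s j) y

theorem policyOp_congr (M : Model G κ d S A) {ψ ψ' : ι → Params ι d} {j : ι}
    (hψ : ∀ i, i ≠ j → ψ i = ψ' i) {f : BM ((∀ i, S i) × (∀ i, A i))} (hf : Ignores j f) :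
    M.policyOp ψ f = M.policyOp ψ' f := by
  ext s
  rw [policyOp_apply, policyOp_apply, jointPolicy_apply, jointPolicy_apply]
  exact integral_pi_eq_of_update (fun i hi => by rw [hψ i hi])
    (f.measurable.comp (by fun_prop)) (hf.right s)

theorem policyOp_update (M : Model G κ d S A) (ψ : ι → Params ι d) {j : ι}
    {f : BM ((∀ i, S i) × (∀ i, A i))} (hf : Ignores j f) (s : ∀ i, S i) (x : S j) :
    M.policyOp ψ f (Function.update s j x) = M.policyOp ψ f s := by
  rw [policyOp_apply, policyOp_apply, jointPolicy_apply, jointPolicy_apply]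
  simp only [hf.left]
  exact integral_pi_eq_of_update (fun i hi => by rw [Function.update_of_ne hi])
    (f.measurable.comp (by fun_prop)) (hf.right s)

theorem jointTrans_apply (M : Model G κ d S A) (x : (∀ i, S i) × (∀ i, A i)) :
    M.jointTrans x = Measure.pi fun i => M.trans i (x.1 i, x.2 i) := rfl

theorem Ignores.stepOp (M : Model G κ d S A) (ψ : ι → Params ι d) {j : ι}
    {f : BM ((∀ i, S i) × (∀ i, A i))} (hf : Ignores j f) : Ignores j (M.stepOp ψ f) := by
  intro s a x y
  rw [Model.stepOp, ContinuousLinearMap.comp_apply, transOp, BM.ofKernel_apply, BM.ofKernel_apply,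
    jointTrans_apply, jointTrans_apply]
  exact integral_pi_eq_of_update (fun i hi => by
    simp only [Function.update_of_ne hi]) (M.policyOp ψ f).measurable (M.policyOp_update ψ hf)

/-- As the local chains evolve independently, the iterates of a function ignoring agent `j` still
ignore it and do not depend on the copy of agent `j`. -/
theorem stepOp_pow_congr (M : Model G κ d S A) {ψ ψ' : ι → Params ι d} {j : ι}
    (hψ : ∀ i, i ≠ j → ψ i = ψ' i) {f : BM ((∀ i, S i) × (∀ i, A i))} (hf : Ignores j f) (n : ℕ) :
    (M.stepOp ψ ^ n) f = (M.stepOp ψ' ^ n) f ∧ Ignores j ((M.stepOp ψ ^ n) f) := by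
  induction n with
  | zero => exact ⟨rfl, hf⟩
  | succ n ih =>
    simp only [pow_succ', mul_apply_eq_comp]
    refine ⟨?_, ih.2.stepOp M ψ⟩
    rw [← ih.1]
    exact congrArg M.transOp (M.policyOp_congr hψ ih.2)

theorem hasSum_valueOp (M : Model G κ d S A) (ψ : ι → Params ι d)
    (f : BM ((∀ i, S i) × (∀ i, A i))) :
    HasSum (fun n : ℕ => M.discount ^ n • (M.stepOp ψ ^ n) f) (M.valueOp ψ f) :=
  hasSum_resolv M.discount_pos.le M.discount_lt_one (M.norm_stepOp_le ψ) f

theorem valueOp_congr (M : Model G κ d S A) {ψ ψ' : ι → Params ι d} {j : ι}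
    (hψ : ∀ i, i ≠ j → ψ i = ψ' i) {f : BM ((∀ i, S i) × (∀ i, A i))} (hf : Ignores j f) :
    M.valueOp ψ f = M.valueOp ψ' f := by
  refine (M.hasSum_valueOp ψ f).unique ?_
  simp only [(M.stepOp_pow_congr hψ hf _).1]
  exact M.hasSum_valueOp ψ' f

theorem Ignores.valueOp (M : Model G κ d S A) (ψ : ι → Params ι d) {j : ι}
    {f : BM ((∀ i, S i) × (∀ i, A i))} (hf : Ignores j f) : Ignores j (M.valueOp ψ f) := by
  intro s a x y
  have h1 := (BM.eval (Function.update s j x, Function.update a j y)).hasSum (M.hasSum_valueOp ψ f)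
  have h2 := (BM.eval (s, a)).hasSum (M.hasSum_valueOp ψ f)
  simp only [map_smul, BM.eval_apply,
    (M.stepOp_pow_congr (ψ := ψ) (fun _ _ => rfl) hf _).2 s a x y] at h1 h2
  exact h1.unique h2

/-- The occupancy of a function that ignores agent `j` is unaffected by the copy of agent `j`. -/
theorem occOp_congr (M : Model G κ d S A) {ψ ψ' : ι → Params ι d} {j : ι}
    (hψ : ∀ i, i ≠ j → ψ i = ψ' i) {f : BM ((∀ i, S i) × (∀ i, A i))} (hf : Ignores j f) :
    M.occOp ψ f = M.occOp ψ' f := by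
  change M.initOp (M.policyOp ψ (M.valueOp ψ f)) = M.initOp (M.policyOp ψ' (M.valueOp ψ' f))
  rw [← M.valueOp_congr hψ hf, M.policyOp_congr hψ (hf.valueOp M ψ)]

/-! ### The policy gradient -/

theorem norm_valueOp_le (M : Model G κ d S A) (ψ : ι → Params ι d) :
    ‖M.valueOp ψ‖ ≤ 1 / (1 - M.discount) :=
  norm_resolv_le M.discount_pos.le M.discount_lt_one (M.norm_stepOp_le ψ)

theorem norm_occOp_le (M : Model G κ d S A) (ψ : ι → Params ι d) :
    ‖M.occOp ψ‖ ≤ 1 / (1 - M.discount) :=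
  norm_occ_le M.discount_pos.le M.discount_lt_one M.norm_initOp_le M.norm_transOp_le
    (M.norm_policyOp_le ψ)

theorem one_le_horizon (M : Model G κ d S A) : 1 ≤ 1 / (1 - M.discount) := by
  have h1 := M.discount_pos
  have h2 := M.discount_lt_one
  rw [le_div_iff₀ (by linarith)]; linarith

theorem norm_occOp_sub_le {M : Model G κ d S A} {B L : ℝ} (hB : 0 ≤ B) (hL : 0 ≤ L)
    (hMB : M.LogGradBound B) (hML : M.LogGradLipschitz L) (ψ ψ' : ι → Params ι d) :
    ‖M.occOp ψ' - M.occOp ψ‖ ≤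
      (1 / (1 - M.discount)) ^ 2 * (2 * lipConst (Fintype.card ι) B L * ‖ψ' - ψ‖) :=
  (norm_occ_sub_le M.discount_pos.le M.discount_lt_one M.norm_initOp_le M.norm_transOp_le
    (M.norm_policyOp_le ψ) (M.norm_policyOp_le ψ')).trans (by
      gcongr; exact (norm_policyOp_expansion_le hB hL hMB hML ψ ψ').1)

theorem norm_valueOp_sub_le {M : Model G κ d S A} {B L : ℝ} (hB : 0 ≤ B) (hL : 0 ≤ L)
    (hMB : M.LogGradBound B) (hML : M.LogGradLipschitz L) (ψ ψ' : ι → Params ι d) :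
    ‖M.valueOp ψ' - M.valueOp ψ‖ ≤
      (1 / (1 - M.discount)) ^ 2 * (2 * lipConst (Fintype.card ι) B L * ‖ψ' - ψ‖) :=
  (norm_resolv_sub_le M.discount_pos.le M.discount_lt_one M.norm_transOp_le
    (M.norm_policyOp_le ψ) (M.norm_policyOp_le ψ')).trans (by
      gcongr; exact (norm_policyOp_expansion_le hB hL hMB hML ψ ψ').1)

/-- Quadratic expansion of the occupancy in the copies: the policy gradient theorem with an
explicit remainder. -/
theorem abs_occOp_expansion_le {M : Model G κ d S A} {B L : ℝ} (hB : 0 ≤ B) (hL : 0 ≤ L)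
    (hMB : M.LogGradBound B) (hML : M.LogGradLipschitz L) (ψ ψ' : ι → Params ι d)
    (f : BM ((∀ i, S i) × (∀ i, A i))) :
    |M.occOp ψ' f - M.occOp ψ f - M.occOp ψ (M.scoreFn hB hMB ψ (ψ' - ψ) * M.valueOp ψ f)| ≤
      5 * (1 / (1 - M.discount)) ^ 3 * lipConst (Fintype.card ι) B L ^ 2 * ‖ψ' - ψ‖ ^ 2 * ‖f‖ := by
  obtain ⟨h1, h2⟩ := norm_policyOp_expansion_le hB hL hMB hML ψ ψ'
  set k := lipConst (Fintype.card ι) B L with hk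
  have hk0 : 0 ≤ k := zero_le_one.trans (one_le_lipConst _ hB hL)
  have hg := M.one_le_horizon
  have hS : ‖BM.mulOp (M.scoreFn hB hMB ψ (ψ' - ψ))‖ ≤ k * ‖ψ' - ψ‖ := by
    refine (BM.norm_mulOp_le _).trans ((M.norm_scoreFn_le hB hMB ψ _).trans ?_)
    gcongr
    rw [hk, lipConst]
    have : 0 ≤ 2 * (Fintype.card ι : ℝ) ^ 2 * L := by positivity
    linarith
  refine (abs_occ_sub_sub_le M.discount_pos.le M.discount_lt_one M.norm_initOp_le
    M.norm_transOp_le (M.norm_policyOp_le ψ) (M.norm_policyOp_le ψ')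
    (BM.mulOp (M.scoreFn hB hMB ψ (ψ' - ψ))) f).trans ?_
  calc _ ≤ (1 / (1 - M.discount)) ^ 3 * (3 * k ^ 2 * ‖ψ' - ψ‖ ^ 2 +
        (2 * k * ‖ψ' - ψ‖) * (k * ‖ψ' - ψ‖)) * ‖f‖ := by gcongr
    _ = _ := by ring

/-- The derivative of the local log-policy of agent `i` with respect to block `j` in direction
`v`, as a function of the state-action pair. -/
def logGradFn (M : Model G κ d S A) {B : ℝ} (hB : 0 ≤ B) (h : M.LogGradBound B) (i j : ι)
    (θ : Params ι d) (v : EuclideanSpace ℝ (Fin d)) : BM ((∀ i, S i) × (∀ i, A i)) :=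
  BM.mk (fun x => inner ℝ (M.logGrad i j (x.1 i) (x.2 i) θ) v)
    ((M.measurable_logGrad_at i j θ).inner measurable_const) (B * ‖v‖) fun x =>
      (abs_real_inner_le_norm _ _).trans (by gcongr; exact norm_logGrad_le hB h i j _ _ _)

theorem logGradFn_eq_zero (M : Model G κ d S A) {B : ℝ} (hB : 0 ≤ B) (h : M.LogGradBound B)
    {i j : ι} (hj : j ∉ nbhd G κ i) (θ : Params ι d) (v : EuclideanSpace ℝ (Fin d)) :
    M.logGradFn hB h i j θ v = 0 := by
  ext x
  rw [logGradFn, BM.mk_apply, M.logGrad_eq_zero hj, inner_zero_left, BM.zero_apply]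

theorem norm_logGradFn_le (M : Model G κ d S A) {B : ℝ} (hB : 0 ≤ B) (h : M.LogGradBound B)
    (i j : ι) (θ : Params ι d) (v : EuclideanSpace ℝ (Fin d)) :
    ‖M.logGradFn hB h i j θ v‖ ≤ B * ‖v‖ :=
  BM.norm_le (by positivity) fun x =>
      (abs_real_inner_le_norm _ _).trans (by gcongr; exact norm_logGrad_le hB h i j _ _ _)

theorem norm_logGradFn_sub_le (M : Model G κ d S A) {B L : ℝ} (hB : 0 ≤ B) (hL : 0 ≤ L)
    (h : M.LogGradBound B) (hML : M.LogGradLipschitz L)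
    (i j : ι) (θ θ' : Params ι d) (v : EuclideanSpace ℝ (Fin d)) :
    ‖M.logGradFn hB h i j θ' v - M.logGradFn hB h i j θ v‖ ≤ L * ‖θ' - θ‖ * ‖v‖ :=
  BM.norm_le (by positivity) fun x => by
    rw [BM.sub_apply, logGradFn, logGradFn, BM.mk_apply, BM.mk_apply, ← inner_sub_left]
    exact (abs_real_inner_le_norm _ _).trans
      (by gcongr; exact norm_logGrad_sub_le hL hML i j _ _ _ _)

theorem scoreFn_eq_sum (M : Model G κ d S A) {B : ℝ} (hB : 0 ≤ B) (h : M.LogGradBound B)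
    (ψ δ : ι → Params ι d) :
    M.scoreFn hB h ψ δ = ∑ i, ∑ j, M.logGradFn hB h i j (ψ i) (δ i j) := by
  ext x
  simp only [BM.sum_apply]
  rfl

theorem scoreFn_smul (M : Model G κ d S A) {B : ℝ} (hB : 0 ≤ B) (h : M.LogGradBound B)
    (ψ δ : ι → Params ι d) (t : ℝ) : M.scoreFn hB h ψ (t • δ) = t • M.scoreFn hB h ψ δ := by
  ext x
  rw [BM.smul_apply, scoreFn, scoreFn, BM.mk_apply, BM.mk_apply, score, score, Finset.mul_sum]
  refine Finset.sum_congr rfl fun i _ => ?_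
  rw [Finset.mul_sum]
  refine Finset.sum_congr rfl fun j _ => ?_
  rw [← inner_smul_right]; rfl

theorem scoreFn_single (M : Model G κ d S A) {B : ℝ} (hB : 0 ≤ B) (h : M.LogGradBound B)
    (ψ : ι → Params ι d) (i j : ι) (v : EuclideanSpace ℝ (Fin d)) :
    M.scoreFn hB h ψ (Pi.single j (PiLp.single 2 i v)) = M.logGradFn hB h j i (ψ j) v := by
  ext x
  rw [scoreFn, logGradFn, BM.mk_apply, BM.mk_apply, score,
    Finset.sum_eq_single_of_mem j (Finset.mem_univ j), Finset.sum_eq_single_of_mem i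
    (Finset.mem_univ i)]
  · simp
  · intro i' _ hi
    simp [hi]
  · intro j' _ hj
    refine Finset.sum_eq_zero fun i' _ => ?_
    simp [hj]

/-- Since the occupancy of a function ignoring agent `j` does not react to the copy of agent `j`,
its derivative in that direction vanishes. This is why distant rewards can be dropped from the
policy gradient. -/
theorem occOp_logGradFn_mul_eq_zero {M : Model G κ d S A} {B L : ℝ} (hB : 0 ≤ B) (hL : 0 ≤ L)
    (hMB : M.LogGradBound B) (hML : M.LogGradLipschitz L) (ψ : ι → Params ι d) (i j : ι)
    (v : EuclideanSpace ℝ (Fin d)) {f : BM ((∀ i, S i) × (∀ i, A i))} (hf : Ignores j f) :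
    M.occOp ψ (M.logGradFn hB hMB j i (ψ j) v * M.valueOp ψ f) = 0 := by
  set δ : ι → Params ι d := Pi.single j (PiLp.single 2 i v) with hδ
  set D := M.occOp ψ (M.logGradFn hB hMB j i (ψ j) v * M.valueOp ψ f) with hD
  set K := 5 * (1 / (1 - M.discount)) ^ 3 * lipConst (Fintype.card ι) B L ^ 2 * ‖δ‖ ^ 2 * ‖f‖
  have hK : 0 ≤ K := by
    have := M.one_le_horizon
    positivity
  have key : ∀ t : ℝ, 0 < t → |D| ≤ K * t := by
    intro t ht
    have h1 := abs_occOp_expansion_le hB hL hMB hML ψ (ψ + t • δ) f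
    have h2 : M.occOp (ψ + t • δ) f = M.occOp ψ f := by
      refine M.occOp_congr (fun i' hi => ?_) hf
      simp [hδ, hi]
    rw [add_sub_cancel_left, h2, scoreFn_smul, scoreFn_single, sub_self, zero_sub, abs_neg,
      smul_mul_assoc, map_smul, smul_eq_mul, abs_mul, abs_of_pos ht, norm_smul,
      Real.norm_of_nonneg ht.le] at h1
    have h3 : t * |D| ≤ t * (K * t) := h1.trans_eq (by simp only [K]; ring)
    exact le_of_mul_le_mul_left h3 ht
  have hlim : |D| ≤ 0 := by
    refine ge_of_tendsto (f := fun t : ℝ => K * t) (x := nhdsWithin 0 (Set.Ioi 0)) ?_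
      (Filter.eventually_of_mem self_mem_nhdsWithin key)
    have : Filter.Tendsto (fun t : ℝ => K * t) (nhds 0) (nhds (K * 0)) :=
      (continuous_const.mul continuous_id).tendsto 0
    rw [mul_zero] at this
    exact this.mono_left nhdsWithin_le_nhds
  exact abs_eq_zero.1 (le_antisymm hlim (abs_nonneg _))

/-- The reward of agent `l` as a bounded measurable function. -/
def rewardFn (M : Model G κ d S A) {R : ℝ} (hR : M.RewardBound R) (l : ι) :
    BM ((∀ i, S i) × (∀ i, A i)) :=
  BM.mk (fun x => M.reward l x.1 x.2) (M.reward_measurable l) R fun x => hR l x.1 x.2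

theorem norm_rewardFn_le (M : Model G κ d S A) {R : ℝ} (hR₀ : 0 ≤ R) (hR : M.RewardBound R)
    (l : ι) : ‖M.rewardFn hR l‖ ≤ R :=
  BM.norm_le hR₀ fun x => hR l x.1 x.2

theorem ignores_rewardFn (M : Model G κ d S A) {R : ℝ} (hR : M.RewardBound R) {j l : ι}
    (h : j ∉ nbhd G 1 l) : Ignores j (M.rewardFn hR l) := by
  intro s a x y
  refine M.reward_local l _ _ _ _ (fun i hi => ?_) fun i hi => ?_ <;>
  · have : i ≠ j := fun e => h (e ▸ hi)
    simp [this]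

theorem mem_nbhd {k : ℕ} {i j : ι} : j ∈ nbhd G k i ↔ G.edist i j ≤ k := by
  simp [nbhd]

theorem mem_nbhd_comm {k : ℕ} {i j : ι} : j ∈ nbhd G k i ↔ i ∈ nbhd G k j := by
  rw [mem_nbhd, mem_nbhd, SimpleGraph.edist_comm]

theorem mem_nbhd_add {k m : ℕ} {i j l : ι} (h1 : j ∈ nbhd G k i) (h2 : l ∈ nbhd G m j) :
    l ∈ nbhd G (k + m) i := by
  rw [mem_nbhd] at *
  push_cast
  exact SimpleGraph.edist_triangle.trans (add_le_add h1 h2)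

/-- The mean of the stochastic gradient of agent `i` under the copies `ψ`, paired with `v`. -/
def meanPairing (M : Model G κ d S A) {B R : ℝ} (hB : 0 ≤ B) (hMB : M.LogGradBound B)
    (hR : M.RewardBound R) (ψ : ι → Params ι d) (i : ι) (v : EuclideanSpace ℝ (Fin d)) : ℝ :=
  (1 / (Fintype.card ι : ℝ)) * M.occOp ψ ((∑ j ∈ nbhd G κ i, M.logGradFn hB hMB j i (ψ i) v) *
    M.valueOp ψ (∑ l ∈ nbhd G (κ + 1) i, M.rewardFn hR l))

/-- On the diagonal, where all copies agree, the truncated means add up to the full policy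
gradient. -/
theorem sum_meanPairing_diag {M : Model G κ d S A} {B L R : ℝ} (hB : 0 ≤ B) (hL : 0 ≤ L)
    (hMB : M.LogGradBound B) (hML : M.LogGradLipschitz L) (hR : M.RewardBound R)
    (θ δ : Params ι d) :
    ∑ i, M.meanPairing hB hMB hR (fun _ => θ) i (δ i) =
      (1 / (Fintype.card ι : ℝ)) * M.occOp (fun _ => θ) (M.scoreFn hB hMB (fun _ => θ) (fun _ => δ) *
        M.valueOp (fun _ => θ) (∑ l, M.rewardFn hR l)) := by
  set ψ : ι → Params ι d := fun _ => θ with hψ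
  let b : ι → ι → ι → ℝ := fun i j l =>
    M.occOp ψ (M.logGradFn hB hMB j i θ (δ i) * M.valueOp ψ (M.rewardFn hR l))
  have hb1 : ∀ i j l, j ∉ nbhd G κ i → b i j l = 0 := fun i j l h => by
    simp only [b]
    rw [M.logGradFn_eq_zero hB hMB (fun h' => h (mem_nbhd_comm.1 h')), zero_mul, map_zero]
  have hb2 : ∀ i j l, j ∉ nbhd G 1 l → b i j l = 0 := fun i j l h =>
    occOp_logGradFn_mul_eq_zero hB hL hMB hML ψ i j (δ i) (M.ignores_rewardFn hR h)
  have h1 : ∀ i, M.meanPairing hB hMB hR ψ i (δ i) =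
      (1 / (Fintype.card ι : ℝ)) * ∑ j, ∑ l, b i j l := fun i => by
    rw [meanPairing, map_sum, Finset.sum_mul_sum, map_sum]
    congr 1
    rw [← Finset.sum_subset (Finset.subset_univ (nbhd G κ i)) fun j _ hj =>
      Finset.sum_eq_zero fun l _ => hb1 i j l hj]
    refine Finset.sum_congr rfl fun j hj => ?_
    rw [map_sum, ← Finset.sum_subset (Finset.subset_univ (nbhd G (κ + 1) i)) fun l _ hl =>
      hb2 i j l fun h => hl (mem_nbhd_add hj (mem_nbhd_comm.1 h))]
  rw [Finset.sum_congr rfl fun i _ => h1 i, ← Finset.mul_sum, scoreFn_eq_sum, map_sum,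
    Finset.sum_mul_sum, map_sum, Finset.sum_comm]
  congr 1
  refine Finset.sum_congr rfl fun j _ => ?_
  rw [map_sum, Finset.sum_comm]
  refine Finset.sum_congr rfl fun l _ => ?_
  rw [Finset.sum_mul, map_sum]

theorem one_div_card_le_one : 1 / (Fintype.card ι : ℝ) ≤ 1 := by
  rcases Nat.eq_zero_or_pos (Fintype.card ι) with h | h
  · simp [h]
  · rw [div_le_one (by exact_mod_cast h)]
    exact_mod_cast h

theorem norm_sum_rewardFn_le (M : Model G κ d S A) {R : ℝ} (hR₀ : 0 ≤ R) (hR : M.RewardBound R)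
    (s : Finset ι) : ‖∑ l ∈ s, M.rewardFn hR l‖ ≤ Fintype.card ι * R := by
  calc _ ≤ ∑ l ∈ s, R := norm_sum_le_of_le _ fun l _ => M.norm_rewardFn_le hR₀ hR l
    _ = s.card * R := by simp
    _ ≤ _ := by gcongr; exact Finset.card_le_univ s

/-- The Lipschitz constant of the mean stochastic gradients in the copies. -/
def meanLip (N : ℕ) (γ R B L : ℝ) : ℝ :=
  4 * lipConst N B L * (1 / (1 - γ)) ^ 3 * (N : ℝ) ^ 2 * B * R +
    (1 / (1 - γ)) ^ 2 * (N : ℝ) ^ 2 * L * R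

theorem abs_meanPairing_sub_le {M : Model G κ d S A} {B L R : ℝ} (hB : 0 ≤ B) (hL : 0 ≤ L)
    (hR₀ : 0 ≤ R) (hMB : M.LogGradBound B) (hML : M.LogGradLipschitz L) (hR : M.RewardBound R)
    (ψ ψ' : ι → Params ι d) (i : ι) (v : EuclideanSpace ℝ (Fin d)) :
    |M.meanPairing hB hMB hR ψ' i v - M.meanPairing hB hMB hR ψ i v| ≤
      meanLip (Fintype.card ι) M.discount R B L * ‖ψ' - ψ‖ * ‖v‖ := by
  set r := ∑ l ∈ nbhd G (κ + 1) i, M.rewardFn hR l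
  set a := ∑ j ∈ nbhd G κ i, M.logGradFn hB hMB j i (ψ i) v with ha
  set a' := ∑ j ∈ nbhd G κ i, M.logGradFn hB hMB j i (ψ' i) v with ha'
  set k := lipConst (Fintype.card ι) B L
  set N : ℝ := (Fintype.card ι : ℝ)
  set g := 1 / (1 - M.discount)
  have hg : 1 ≤ g := M.one_le_horizon
  have hk : 1 ≤ k := one_le_lipConst _ hB hL
  have hcard : ((nbhd G κ i).card : ℝ) ≤ N := by
    exact Nat.cast_le.2 (Finset.card_le_univ _)
  have hr : ‖r‖ ≤ N * R := M.norm_sum_rewardFn_le hR₀ hR _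
  have hq : ∀ φ, ‖M.valueOp φ r‖ ≤ g * (N * R) := fun φ =>
    ((M.valueOp φ).le_opNorm r).trans (by gcongr; exact M.norm_valueOp_le φ)
  have hqs : ‖M.valueOp ψ' r - M.valueOp ψ r‖ ≤ g ^ 2 * (2 * k * ‖ψ' - ψ‖) * (N * R) := by
    rw [← sub_apply]
    exact ((M.valueOp ψ' - M.valueOp ψ).le_opNorm r).trans (by
      gcongr; exact norm_valueOp_sub_le hB hL hMB hML ψ ψ')
  have hna : ∀ φ : ι → Params ι d,
      ‖∑ j ∈ nbhd G κ i, M.logGradFn hB hMB j i (φ i) v‖ ≤ N * (B * ‖v‖) := fun φ => by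
    calc _ ≤ ∑ j ∈ nbhd G κ i, B * ‖v‖ := norm_sum_le_of_le _ fun j _ =>
          M.norm_logGradFn_le hB hMB j i _ v
      _ = (nbhd G κ i).card * (B * ‖v‖) := by simp
      _ ≤ _ := by gcongr
  have hnas : ‖a' - a‖ ≤ N * (L * ‖ψ' - ψ‖ * ‖v‖) := by
    rw [ha, ha', ← Finset.sum_sub_distrib]
    calc _ ≤ ∑ j ∈ nbhd G κ i, L * ‖ψ' - ψ‖ * ‖v‖ := norm_sum_le_of_le _ fun j _ =>
          (M.norm_logGradFn_sub_le hB hL hMB hML j i _ _ v).trans (by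
            gcongr; exact norm_le_pi_norm (ψ' - ψ) i)
      _ = (nbhd G κ i).card * (L * ‖ψ' - ψ‖ * ‖v‖) := by simp
      _ ≤ _ := by gcongr
  have hsplit : M.occOp ψ' (a' * M.valueOp ψ' r) - M.occOp ψ (a * M.valueOp ψ r) =
      (M.occOp ψ' - M.occOp ψ) (a' * M.valueOp ψ' r) + M.occOp ψ ((a' - a) * M.valueOp ψ' r) +
        M.occOp ψ (a * (M.valueOp ψ' r - M.valueOp ψ r)) := by
    simp only [sub_apply, sub_mul, mul_sub, map_sub]; ring
  have hmain : |M.occOp ψ' (a' * M.valueOp ψ' r) - M.occOp ψ (a * M.valueOp ψ r)| ≤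
      meanLip (Fintype.card ι) M.discount R B L * ‖ψ' - ψ‖ * ‖v‖ := by
    rw [hsplit, ← Real.norm_eq_abs]
    calc _ ≤ ‖(M.occOp ψ' - M.occOp ψ) (a' * M.valueOp ψ' r)‖ +
          ‖M.occOp ψ ((a' - a) * M.valueOp ψ' r)‖ +
          ‖M.occOp ψ (a * (M.valueOp ψ' r - M.valueOp ψ r))‖ := norm_add₃_le
      _ ≤ (g ^ 2 * (2 * k * ‖ψ' - ψ‖)) * ((N * (B * ‖v‖)) * (g * (N * R))) +
          g * ((N * (L * ‖ψ' - ψ‖ * ‖v‖)) * (g * (N * R))) +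
          g * ((N * (B * ‖v‖)) * (g ^ 2 * (2 * k * ‖ψ' - ψ‖) * (N * R))) := by
          gcongr
          · refine (ContinuousLinearMap.le_opNorm _ _).trans ?_
            gcongr
            · exact norm_occOp_sub_le hB hL hMB hML ψ ψ'
            · exact (norm_mul_le _ _).trans (by gcongr; exacts [hna ψ', hq ψ'])
          · refine (ContinuousLinearMap.le_opNorm _ _).trans ?_
            gcongr
            · exact M.norm_occOp_le ψ
            · exact (norm_mul_le _ _).trans (by gcongr; exact hq ψ')
          · refine (ContinuousLinearMap.le_opNorm _ _).trans ?_
            gcongr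
            · exact M.norm_occOp_le ψ
            · exact (norm_mul_le _ _).trans (by gcongr; exact hna ψ)
      _ = _ := by simp only [meanLip, N, k, g]; ring
  rw [meanPairing, meanPairing, ← mul_sub, abs_mul, abs_of_nonneg (by positivity)]
  exact (mul_le_of_le_one_left (abs_nonneg _) one_div_card_le_one).trans hmain

end Model

/-! ### Markov chains and their trajectories -/

section Chain

variable {Y : Type*} [MeasurableSpace Y]

/-- The law of a Markov chain with initial law `μ₀` and transition kernels `k n`. -/
def chain (μ₀ : Measure Y) (k : ℕ → Kernel Y Y) [∀ n, IsMarkovKernel (k n)] : Measure (ℕ → Y) :=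
  Kernel.trajMeasure (X := fun _ => Y) μ₀ fun n =>
    (k n).comap (fun h => h ⟨n, Finset.mem_Iic.2 le_rfl⟩) (by fun_prop)

variable (μ₀ : Measure Y) [IsProbabilityMeasure μ₀] (k : ℕ → Kernel Y Y) [∀ n, IsMarkovKernel (k n)]

instance : IsProbabilityMeasure (chain μ₀ k) := by unfold chain; infer_instance

/-- The Markov property: the last state can be averaged given the path up to time `n`. -/
theorem integral_chain_succ (n : ℕ) {Φ : (Finset.Iic n → Y) × Y → ℝ} (hΦ : Measurable Φ) {c : ℝ}
    (hc : ∀ p, |Φ p| ≤ c) :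
    ∫ x, Φ (fun i => x i, x (n + 1)) ∂(chain μ₀ k) =
      ∫ x, ∫ z, Φ (fun i => x i, z) ∂(k n (x n)) ∂(chain μ₀ k) := by
  have h := Kernel.map_frestrictLe_trajMeasure_compProd_eq_map_trajMeasure (X := fun _ => Y)
    (κ := fun n => (k n).comap (fun h => h ⟨n, Finset.mem_Iic.2 le_rfl⟩) (by fun_prop))
    (μ₀ := μ₀) (a := n)
  have hm : Measurable fun x : ℕ → Y => (Preorder.frestrictLe (π := fun _ => Y) n x, x (n + 1)) := by
    fun_prop
  have h1 : ∫ x, Φ (fun i => x i, x (n + 1)) ∂(chain μ₀ k) = ∫ p, Φ p ∂((chain μ₀ k).map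
      fun x => (Preorder.frestrictLe (π := fun _ => Y) n x, x (n + 1))) := by
    rw [integral_map hm.aemeasurable hΦ.aestronglyMeasurable]; rfl
  have hprob : IsProbabilityMeasure ((chain μ₀ k).map (Preorder.frestrictLe (π := fun _ => Y) n)) :=
    Measure.isProbabilityMeasure_map (by fun_prop)
  rw [h1, chain, ← h, Measure.integral_compProd]
  · rw [integral_map (by fun_prop)]
    · rfl
    · exact (hΦ.stronglyMeasurable.integral_kernel_prod_right').aestronglyMeasurable
  · exact Integrable.of_bound hΦ.aestronglyMeasurable c (Filter.Eventually.of_forall hc)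

theorem integral_chain_zero {F : Y → ℝ} (hF : Measurable F) :
    ∫ x, F (x 0) ∂(chain μ₀ k) = ∫ y, F y ∂μ₀ := by
  have h : (chain μ₀ k).map (fun x => x 0) = μ₀ := by
    have h1 : (fun x : ℕ → Y => x 0) =
        (fun x : Finset.Iic 0 → Y => x ⟨0, Finset.mem_Iic.2 le_rfl⟩) ∘
          Preorder.frestrictLe (π := fun _ => Y) 0 := rfl
    rw [chain, Kernel.trajMeasure, h1, ← Measure.map_map (by fun_prop) (by fun_prop),
      Measure.map_comp _ _ (by fun_prop), Kernel.traj_map_frestrictLe, Kernel.partialTraj_self,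
      Measure.id_comp, Measure.map_map (by fun_prop) (by fun_prop)]
    exact Measure.map_id
  conv_rhs => rw [← h]
  rw [integral_map (measurable_pi_apply 0).aemeasurable hF.aestronglyMeasurable]

theorem integral_chain_next (n : ℕ) {F : Y → ℝ} (hF : Measurable F) {c : ℝ}
    (hc : ∀ y, |F y| ≤ c) :
    ∫ x, F (x (n + 1)) ∂(chain μ₀ k) = ∫ x, ∫ z, F z ∂(k n (x n)) ∂(chain μ₀ k) :=
  integral_chain_succ μ₀ k n (Φ := fun p => F p.2) (by fun_prop) fun p => hc p.2

theorem integral_chain_pow (K : Kernel Y Y) [IsMarkovKernel K] (F : BM Y) (n : ℕ) :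
    ∫ x, F (x n) ∂(chain μ₀ fun _ => K) = ∫ y, (BM.ofKernel K ^ n) F y ∂μ₀ := by
  induction n generalizing F with
  | zero => exact integral_chain_zero μ₀ _ F.measurable
  | succ n ih =>
    rw [integral_chain_next μ₀ _ n F.measurable F.abs_apply_le, pow_succ, mul_apply_eq_comp]
    exact ih (BM.ofKernel K F)

theorem integral_chain_mul (K : Kernel Y Y) [IsMarkovKernel K] (F H : BM Y) (n m : ℕ) :
    ∫ x, F (x n) * H (x (n + m)) ∂(chain μ₀ fun _ => K) =
      ∫ y, (BM.ofKernel K ^ n) (F * (BM.ofKernel K ^ m) H) y ∂μ₀ := by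
  rw [← integral_chain_pow]
  induction m generalizing H with
  | zero => rfl
  | succ m ih =>
    have h := integral_chain_succ μ₀ (fun _ => K) (n + m)
      (Φ := fun p => F (p.1 ⟨n, Finset.mem_Iic.2 (Nat.le_add_right n m)⟩) * H p.2) (by
        exact (F.measurable.comp ((measurable_pi_apply _).comp measurable_fst)).mul
          (H.measurable.comp measurable_snd)) (c := ‖F‖ * ‖H‖) (fun p => by
        rw [abs_mul]
        exact mul_le_mul (F.abs_apply_le _) (H.abs_apply_le _) (abs_nonneg _) (norm_nonneg _))
    simp only [integral_const_mul] at h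
    rw [pow_succ, mul_apply_eq_comp, ← ih (BM.ofKernel K H)]
    exact h

end Chain

namespace Model

variable {ι : Type*} [Fintype ι] [DecidableEq ι] {G : SimpleGraph ι} {κ d : ℕ}
  {S A : ι → Type*} [∀ i, MeasurableSpace (S i)] [∀ i, MeasurableSpace (A i)]

/-- The section at fixed copies `ψ` of a function of copies and state-action pairs. -/
def sec (ψ : ι → Params ι d) (F : BM ((ι → Params ι d) × ((∀ i, S i) × (∀ i, A i)))) :
    BM ((∀ i, S i) × (∀ i, A i)) :=
  F.comp (fun x => (ψ, x)) (by fun_prop)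

theorem integral_stepKernel (M : Model G κ d S A) (ψ : ι → Params ι d)
    (x : (∀ i, S i) × (∀ i, A i)) (F : BM ((ι → Params ι d) × ((∀ i, S i) × (∀ i, A i)))) :
    ∫ y, F y ∂(M.stepKernel (ψ, x)) = M.stepOp ψ (sec ψ F) x := by
  have hint : Integrable (fun y => F (ψ, y)) ((M.jointTrans.comap Prod.snd measurable_snd ⊗ₖ
      M.jointPolicy.comap (fun x : ((ι → Params ι d) × ((∀ i, S i) × (∀ i, A i))) × (∀ i, S i) =>
        (x.1.1, x.2)) (by fun_prop)) (ψ, x)) :=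
    Integrable.of_bound (F.measurable.comp (by fun_prop)).aestronglyMeasurable ‖F‖
      (Filter.Eventually.of_forall fun y => F.abs_apply_le _)
  rw [stepKernel, Kernel.prod_apply, Kernel.deterministic_apply, Measure.dirac_prod,
    integral_map (by fun_prop) F.measurable.aestronglyMeasurable, ProbabilityTheory.integral_compProd hint]
  change _ = ∫ s, M.policyOp ψ (sec ψ F) s ∂(M.jointTrans x)
  simp only [policyOp_apply]
  rfl

theorem integral_startKernel (M : Model G κ d S A) (ψ : ι → Params ι d)
    (F : BM ((ι → Params ι d) × ((∀ i, S i) × (∀ i, A i)))) :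
    ∫ y, F y ∂(M.startKernel ψ) = M.initOp (M.policyOp ψ (sec ψ F)) := by
  have hint : Integrable (fun y => F (ψ, y))
      ((Kernel.const (ι → Params ι d) M.init ⊗ₖ M.jointPolicy) ψ) :=
    Integrable.of_bound (F.measurable.comp (by fun_prop)).aestronglyMeasurable ‖F‖
      (Filter.Eventually.of_forall fun y => F.abs_apply_le _)
  rw [startKernel, Kernel.prod_apply, Kernel.id_apply, Measure.dirac_prod,
    integral_map (by fun_prop) F.measurable.aestronglyMeasurable, ProbabilityTheory.integral_compProd hint]
  change _ = ∫ s, M.policyOp ψ (sec ψ F) s ∂M.init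
  simp only [policyOp_apply]
  rfl

theorem sec_ofKernel_pow (M : Model G κ d S A) (ψ : ι → Params ι d)
    (F : BM ((ι → Params ι d) × ((∀ i, S i) × (∀ i, A i)))) (n : ℕ) :
    sec ψ ((BM.ofKernel M.stepKernel ^ n) F) = (M.stepOp ψ ^ n) (sec ψ F) := by
  induction n with
  | zero => rfl
  | succ n ih =>
    rw [pow_succ', pow_succ', mul_apply_eq_comp, mul_apply_eq_comp, ← ih]
    ext x
    exact M.integral_stepKernel ψ x _

theorem pathKernel_apply (M : Model G κ d S A) (ψ : ι → Params ι d) :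
    M.pathKernel ψ = (chain (M.startKernel ψ) fun _ => M.stepKernel).map fun x n => (x n).2 := by
  rw [pathKernel, Kernel.map_apply _ (by fun_prop), Kernel.comp_apply,
    Kernel.map_apply _ (by fun_prop)]
  rfl

/-- Correlations along a trajectory in terms of the policy and step operators. -/
theorem integral_path_mul (M : Model G κ d S A) (ψ : ι → Params ι d)
    (f g : BM ((∀ i, S i) × (∀ i, A i))) (n m : ℕ) :
    ∫ ω, f (ω n) * g (ω (n + m)) ∂(M.pathKernel ψ) =
      M.initOp (M.policyOp ψ ((M.stepOp ψ ^ n) (f * (M.stepOp ψ ^ m) g))) := by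
  have hmeas : Measurable fun ω : ℕ → (∀ i, S i) × (∀ i, A i) => f (ω n) * g (ω (n + m)) :=
    (f.measurable.comp (measurable_pi_apply n)).mul (g.measurable.comp (measurable_pi_apply _))
  have hsnd : Measurable fun (x : ℕ → (ι → Params ι d) × ((∀ i, S i) × (∀ i, A i))) n =>
      (x n).2 := by fun_prop
  rw [pathKernel_apply, integral_map hsnd.aemeasurable hmeas.aestronglyMeasurable]
  let F : BM ((ι → Params ι d) × ((∀ i, S i) × (∀ i, A i))) := f.comp Prod.snd measurable_snd
  let H : BM ((ι → Params ι d) × ((∀ i, S i) × (∀ i, A i))) := g.comp Prod.snd measurable_snd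
  refine (integral_chain_mul (M.startKernel ψ) M.stepKernel F H n m).trans ?_
  rw [integral_startKernel, sec_ofKernel_pow]
  have h1 : sec ψ (F * (BM.ofKernel M.stepKernel ^ m) H) =
      sec ψ F * sec ψ ((BM.ofKernel M.stepKernel ^ m) H) := rfl
  rw [h1, sec_ofKernel_pow]
  rfl

theorem integral_path (M : Model G κ d S A) (ψ : ι → Params ι d)
    (f : BM ((∀ i, S i) × (∀ i, A i))) (n : ℕ) :
    ∫ ω, f (ω n) ∂(M.pathKernel ψ) = M.initOp (M.policyOp ψ ((M.stepOp ψ ^ n) f)) := by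
  have h1 : (1 : BM ((∀ i, S i) × (∀ i, A i))) = BM.mk (fun _ => 1) measurable_const 1 (by simp) :=
    rfl
  have h := M.integral_path_mul ψ f 1 n 0
  simp only [h1, BM.mk_apply, mul_one] at h
  rw [h, ← h1]
  simp

theorem hasSum_occOp (M : Model G κ d S A) (ψ : ι → Params ι d)
    (f : BM ((∀ i, S i) × (∀ i, A i))) :
    HasSum (fun n : ℕ => M.discount ^ n * M.initOp (M.policyOp ψ ((M.stepOp ψ ^ n) f)))
      (M.occOp ψ f) := by
  have h := (M.initOp ∘L M.policyOp ψ).hasSum (M.hasSum_valueOp ψ f)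
  simp only [ContinuousLinearMap.comp_apply, map_smul, smul_eq_mul] at h
  exact h

/-- The objective is the discounted occupancy applied to the average reward. -/
theorem J_eq_occOp (M : Model G κ d S A) {R : ℝ} (hR : M.RewardBound R) (θ : Params ι d) :
    M.J θ = (1 / (Fintype.card ι : ℝ)) * M.occOp (fun _ => θ) (∑ l, M.rewardFn hR l) := by
  set r := ∑ l, M.rewardFn hR l with hr
  have hpt : ∀ (ω : ℕ → (∀ i, S i) × (∀ i, A i)) (t : ℕ),
      ∑ i, M.discount ^ t * M.reward i (ω t).1 (ω t).2 = M.discount ^ t * r (ω t) := fun ω t => by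
    rw [hr, BM.sum_apply, Finset.mul_sum]; rfl
  have hγ := M.discount_pos.le
  have hm : ∀ t : ℕ, Measurable fun ω : ℕ → (∀ i, S i) × (∀ i, A i) => M.discount ^ t * r (ω t) :=
    fun t => (r.measurable.comp (measurable_pi_apply t)).const_mul _
  have hbd : ∀ (t : ℕ) (ω : ℕ → (∀ i, S i) × (∀ i, A i)),
      ‖M.discount ^ t * r (ω t)‖ ≤ M.discount ^ t * ‖r‖ := fun t ω => by
    rw [norm_mul, Real.norm_of_nonneg (by positivity)]
    gcongr
    exact r.abs_apply_le _
  have hsum : Summable fun t : ℕ => M.discount ^ t * ‖r‖ :=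
    (summable_geometric_of_lt_one hγ M.discount_lt_one).mul_right _
  have h1 := integral_tsum_of_summable_integral_norm (μ := M.pathKernel fun _ => θ)
    (F := fun (t : ℕ) ω => M.discount ^ t * r (ω t))
    (fun t => Integrable.of_bound (hm t).aestronglyMeasurable _
      (Filter.Eventually.of_forall (hbd t)))
    (hsum.of_nonneg_of_le (fun t => integral_nonneg fun ω => norm_nonneg _) fun t => by
      have := norm_integral_le_of_norm_le_const (μ := M.pathKernel fun _ => θ)
        (f := fun ω => ‖M.discount ^ t * r (ω t)‖) (C := M.discount ^ t * ‖r‖)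
        (Filter.Eventually.of_forall fun ω => by rw [norm_norm]; exact hbd t ω)
      simpa using (le_abs_self _).trans this)
  rw [J, integral_const_mul]
  simp only [hpt]
  rw [← h1, ← (M.hasSum_occOp (fun _ => θ) r).tsum_eq]
  congr 2
  funext t
  rw [integral_const_mul, integral_path]

/-! ### The stochastic gradient is unbiased up to consensus -/

theorem sqrt_pow_eq_rpow {γ : ℝ} (hγ : 0 ≤ γ) (τ : ℕ) : γ ^ ((τ : ℝ) / 2) = √γ ^ τ := by
  rw [Real.sqrt_eq_rpow, ← Real.rpow_natCast, ← Real.rpow_mul hγ]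
  congr 1
  ring

theorem sqrt_discount_lt_one (M : Model G κ d S A) : √M.discount < 1 := by
  have := Real.sqrt_lt_sqrt M.discount_pos.le M.discount_lt_one
  simpa using this

theorem abs_estQ_le {M : Model G κ d S A} {R : ℝ} (hR₀ : 0 ≤ R) (hR : M.RewardBound R) (i : ι)
    (z : Sample S A) : |M.estQ i z| ≤ Fintype.card ι * R * (1 / (1 - √M.discount)) := by
  have hγ := M.discount_pos.le
  have hs1 := M.sqrt_discount_lt_one
  have hs0 := Real.sqrt_nonneg M.discount
  have h1 : ∀ τ, |∑ j ∈ nbhd G (κ + 1) i, M.reward j (z.2 (z.1.1 + τ)).1 (z.2 (z.1.1 + τ)).2| ≤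
      Fintype.card ι * R := fun τ => by
    calc _ ≤ ∑ j ∈ nbhd G (κ + 1) i, R :=
          (Finset.abs_sum_le_sum_abs _ _).trans (Finset.sum_le_sum fun j _ => hR j _ _)
      _ = (nbhd G (κ + 1) i).card * R := by simp
      _ ≤ _ := by gcongr; exact Finset.card_le_univ _
  rw [estQ, abs_mul, abs_of_nonneg (by positivity)]
  refine (mul_le_of_le_one_left (abs_nonneg _) one_div_card_le_one).trans ?_
  calc _ ≤ ∑ τ ∈ Finset.range (z.1.2 + 1), √M.discount ^ τ * (Fintype.card ι * R) := by
        refine (Finset.abs_sum_le_sum_abs _ _).trans (Finset.sum_le_sum fun τ _ => ?_)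
        rw [abs_mul, sqrt_pow_eq_rpow hγ, abs_of_nonneg (by positivity)]
        gcongr
        exact h1 τ
    _ = (∑ τ ∈ Finset.range (z.1.2 + 1), √M.discount ^ τ) * (Fintype.card ι * R) := by
        rw [Finset.sum_mul]
    _ ≤ (1 / (1 - √M.discount)) * (Fintype.card ι * R) := by
        gcongr
        rw [one_div, ← tsum_geometric_of_lt_one hs0 hs1]
        exact (summable_geometric_of_lt_one hs0 hs1).sum_le_tsum _ fun τ _ => by positivity
    _ = _ := by ring

theorem norm_estScore_le {M : Model G κ d S A} {B : ℝ} (hB : 0 ≤ B) (hMB : M.LogGradBound B)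
    (i : ι) (ψ : ι → Params ι d) (z : Sample S A) :
    ‖M.estScore i ψ z‖ ≤ Fintype.card ι * B := by
  calc _ ≤ ∑ j ∈ nbhd G κ i, B := norm_sum_le_of_le _ fun j _ => norm_logGrad_le hB hMB j i _ _ _
    _ = (nbhd G κ i).card * B := by simp
    _ ≤ _ := by gcongr; exact Finset.card_le_univ _

/-- A bound for the stochastic gradients. -/
def gradBound (N : ℕ) (γ R B : ℝ) : ℝ :=
  1 / (1 - γ) * (N * R * (1 / (1 - √γ)) * (N * B))

theorem norm_estGrad_le {M : Model G κ d S A} {B R : ℝ} (hB : 0 ≤ B) (hR₀ : 0 ≤ R)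
    (hMB : M.LogGradBound B) (hR : M.RewardBound R) (i : ι) (ψ : ι → Params ι d)
    (z : Sample S A) : ‖M.estGrad i ψ z‖ ≤ gradBound (Fintype.card ι) M.discount R B := by
  have hg : 0 ≤ 1 / (1 - M.discount) := zero_le_one.trans M.one_le_horizon
  have hs := M.sqrt_discount_lt_one
  have hs' : 0 ≤ 1 / (1 - √M.discount) := one_div_nonneg.2 (by linarith)
  rw [estGrad, norm_smul, norm_smul, Real.norm_of_nonneg hg, gradBound]
  gcongr
  · exact abs_estQ_le hR₀ hR i z
  · exact norm_estScore_le hB hMB i ψ z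

theorem measurable_estGrad (M : Model G κ d S A) (i : ι) (ψ : ι → Params ι d) :
    Measurable (M.estGrad i ψ) :=
  ((M.measurable_estQ i).smul ((M.measurable_estScore i).comp (by fun_prop :
    Measurable fun z : Sample S A => (ψ, z)))).const_smul (1 / (1 - M.discount))

theorem integrable_estGrad {M : Model G κ d S A} {B R : ℝ} (hB : 0 ≤ B) (hR₀ : 0 ≤ R)
    (hMB : M.LogGradBound B) (hR : M.RewardBound R) (i : ι) (ψ : ι → Params ι d) :
    Integrable (M.estGrad i ψ) (M.sampleKernel ψ) :=
  Integrable.of_bound (M.measurable_estGrad i ψ).aestronglyMeasurable _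
    (Filter.Eventually.of_forall (norm_estGrad_le hB hR₀ hMB hR i ψ))

/-- The mean of the stochastic gradients under the copies `ψ`. -/
def meanGrad (M : Model G κ d S A) (ψ : ι → Params ι d) : Params ι d :=
  WithLp.toLp 2 fun i => ∫ z, M.estGrad i ψ z ∂(M.sampleKernel ψ)

theorem inner_estGrad {M : Model G κ d S A} {B R : ℝ} (hB : 0 ≤ B)
    (hMB : M.LogGradBound B) (hR : M.RewardBound R) (i : ι) (ψ : ι → Params ι d)
    (v : EuclideanSpace ℝ (Fin d)) (z : Sample S A) :
    inner ℝ v (M.estGrad i ψ z) = 1 / (1 - M.discount) * (1 / (Fintype.card ι : ℝ)) *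
      ∑ τ ∈ Finset.range (z.1.2 + 1), √M.discount ^ τ *
        ((∑ j ∈ nbhd G κ i, M.logGradFn hB hMB j i (ψ i) v) (z.2 z.1.1) *
          (∑ l ∈ nbhd G (κ + 1) i, M.rewardFn hR l) (z.2 (z.1.1 + τ))) := by
  have h1 : inner ℝ v (M.estScore i ψ z) =
      (∑ j ∈ nbhd G κ i, M.logGradFn hB hMB j i (ψ i) v) (z.2 z.1.1) := by
    rw [estScore, inner_sum, BM.sum_apply]
    exact Finset.sum_congr rfl fun j _ => real_inner_comm _ _
  rw [estGrad, inner_smul_right, inner_smul_right, h1, estQ, Finset.mul_sum, Finset.sum_mul,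
    Finset.mul_sum, Finset.mul_sum]
  refine Finset.sum_congr rfl fun τ _ => ?_
  rw [sqrt_pow_eq_rpow M.discount_pos.le, BM.sum_apply (nbhd G (κ + 1) i)]
  simp only [rewardFn, BM.mk_apply]
  ring

/-- Truncating a discounted sum at an independent geometric time multiplies the discount factors:
`∑ₙ (1 - q) qⁿ ∑_{τ ≤ n} x_τ = ∑_τ q^τ x_τ`. -/
theorem tsum_geometric_mul_sum_range {q : ℝ} (hq₀ : 0 ≤ q) (hq₁ : q < 1) {x : ℕ → ℝ} {c : ℝ}
    (hx : ∀ n, |x n| ≤ c) :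
    ∑' n : ℕ, q ^ n * (1 - q) * ∑ τ ∈ Finset.range (n + 1), x τ = ∑' τ : ℕ, q ^ τ * x τ := by
  have h1 : Summable fun n : ℕ => ‖q ^ n * x n‖ := by
    refine ((summable_geometric_of_lt_one hq₀ hq₁).mul_right c).of_nonneg_of_le
      (fun n => norm_nonneg _) fun n => ?_
    rw [norm_mul, Real.norm_of_nonneg (by positivity)]
    gcongr
    exact hx n
  have h2 : Summable fun n : ℕ => ‖q ^ n‖ := (summable_geometric_of_lt_one hq₀ hq₁).norm
  have h3 := tsum_mul_tsum_eq_tsum_sum_range_of_summable_norm h1 h2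
  rw [tsum_geometric_of_lt_one hq₀ hq₁] at h3
  have hq : 1 - q ≠ 0 := by linarith
  rw [← div_eq_mul_inv, div_eq_iff hq, ← tsum_mul_right] at h3
  rw [h3]
  refine tsum_congr fun n => ?_
  rw [mul_right_comm, Finset.mul_sum]
  congr 1
  refine Finset.sum_congr rfl fun τ hτ => ?_
  have : q ^ n = q ^ τ * q ^ (n - τ) := by
    rw [← pow_add, Nat.add_sub_cancel' (Nat.lt_succ_iff.1 (Finset.mem_range.1 hτ))]
  rw [this]; ring

theorem abs_initOp_policyOp_le (M : Model G κ d S A) (ψ : ι → Params ι d)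
    (f : BM ((∀ i, S i) × (∀ i, A i))) : |M.initOp (M.policyOp ψ f)| ≤ ‖f‖ :=
  ((M.initOp ∘L M.policyOp ψ).le_opNorm f).trans (mul_le_of_le_one_left (norm_nonneg _)
    (norm_comp_le_one M.norm_initOp_le (M.norm_policyOp_le ψ)))

theorem norm_stepOp_pow_le (M : Model G κ d S A) (ψ : ι → Params ι d) (n : ℕ)
    (f : BM ((∀ i, S i) × (∀ i, A i))) : ‖(M.stepOp ψ ^ n) f‖ ≤ ‖f‖ := by
  induction n with
  | zero => exact le_rfl
  | succ n ih =>
    rw [pow_succ', mul_apply_eq_comp]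
    exact ((M.stepOp ψ).le_opNorm _).trans
      ((mul_le_of_le_one_left (norm_nonneg _) (M.norm_stepOp_le ψ)).trans ih)

/-- The random horizons make the stochastic gradient an unbiased estimate of the truncated policy
gradient: `T₁` produces the discounted occupancy, and `T₂` turns the weights `γ^{τ/2}` into `γ^τ`. -/
theorem inner_meanGrad {M : Model G κ d S A} {B R : ℝ} (hB : 0 ≤ B) (hR₀ : 0 ≤ R)
    (hMB : M.LogGradBound B) (hR : M.RewardBound R) (ψ : ι → Params ι d) (i : ι)
    (v : EuclideanSpace ℝ (Fin d)) :
    inner ℝ v (M.meanGrad ψ i) = M.meanPairing hB hMB hR ψ i v := by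
  set a := ∑ j ∈ nbhd G κ i, M.logGradFn hB hMB j i (ψ i) v with ha
  set r := ∑ l ∈ nbhd G (κ + 1) i, M.rewardFn hR l with hr
  have hγ₀ : 0 < M.discount := M.discount_pos
  have hγ₁ : M.discount < 1 := M.discount_lt_one
  have hs0 : 0 ≤ √M.discount := Real.sqrt_nonneg _
  have hs1 : √M.discount < 1 := M.sqrt_discount_lt_one
  have hint := integrable_estGrad hB hR₀ hMB hR i ψ
  change inner ℝ v (∫ z, M.estGrad i ψ z ∂(M.sampleKernel ψ)) = _
  rw [← integral_inner hint v]
  have hint' : Integrable (fun z => inner ℝ v (M.estGrad i ψ z)) (M.sampleKernel ψ) :=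
    hint.const_inner v
  rw [sampleKernel, Kernel.prod_apply, Kernel.const_apply] at hint' ⊢
  rw [integral_prod _ hint']
  let c : ℕ → ℕ → ℝ := fun t τ =>
    M.initOp (M.policyOp ψ ((M.stepOp ψ ^ t) (a * (M.stepOp ψ ^ τ) r)))
  have hpath : ∀ p : ℕ × ℕ, ∫ ω, inner ℝ v (M.estGrad i ψ (p, ω)) ∂(M.pathKernel ψ) =
      1 / (1 - M.discount) * (1 / (Fintype.card ι : ℝ)) *
        ∑ τ ∈ Finset.range (p.2 + 1), √M.discount ^ τ * c p.1 τ := fun p => by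
    simp only [inner_estGrad hB hMB hR i ψ v]
    rw [integral_const_mul, integral_finsetSum]
    · congr 1
      refine Finset.sum_congr rfl fun τ _ => ?_
      rw [integral_const_mul, integral_path_mul]
    · intro τ _
      refine Integrable.const_mul ?_ _
      refine Integrable.of_bound (C := ‖a‖ * ‖r‖) ((a.measurable.comp (measurable_pi_apply _)).mul
        (r.measurable.comp (measurable_pi_apply _))).aestronglyMeasurable
        (Filter.Eventually.of_forall fun ω => ?_)
      rw [norm_mul]
      exact mul_le_mul (a.abs_apply_le _) (r.abs_apply_le _) (norm_nonneg _) (norm_nonneg _)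
  have hintp := hint'.integral_prod_left
  simp only [hpath] at hintp ⊢
  rw [integral_prod _ hintp]
  have hp1 : (⟨1 - M.discount, sub_nonneg.2 M.discount_lt_one.le,
      sub_le_self 1 M.discount_pos.le⟩ : unitInterval) ≠ 0 := fun h => by
    have : 1 - M.discount = 0 := congrArg Subtype.val h
    linarith
  have hp2 : (⟨1 - √M.discount, sub_nonneg.2 (Real.sqrt_le_one.2 M.discount_lt_one.le),
      sub_le_self 1 (Real.sqrt_nonneg _)⟩ : unitInterval) ≠ 0 := fun h => by
    have : 1 - √M.discount = 0 := congrArg Subtype.val h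
    linarith
  rw [integral_geometricMeasure hp1]
  have hc : ∀ t τ, |c t τ| ≤ ‖a‖ * ‖r‖ := fun t τ =>
    (M.abs_initOp_policyOp_le ψ _).trans ((M.norm_stepOp_pow_le ψ t _).trans
      ((norm_mul_le _ _).trans (by gcongr; exact M.norm_stepOp_pow_le ψ τ r)))
  have hinner : ∀ t, ∫ n, 1 / (1 - M.discount) * (1 / (Fintype.card ι : ℝ)) *
        ∑ τ ∈ Finset.range (n + 1), √M.discount ^ τ * c t τ ∂(geometricMeasure ⟨1 - √M.discount,
          sub_nonneg.2 (Real.sqrt_le_one.2 M.discount_lt_one.le),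
          sub_le_self 1 (Real.sqrt_nonneg _)⟩) = 1 / (1 - M.discount) * (1 / (Fintype.card ι : ℝ)) *
      M.initOp (M.policyOp ψ ((M.stepOp ψ ^ t) (a * M.valueOp ψ r))) := fun t => by
    rw [integral_const_mul, integral_geometricMeasure hp2]
    congr 1
    simp only [sub_sub_cancel, smul_eq_mul]
    rw [tsum_geometric_mul_sum_range hs0 hs1 (c := ‖a‖ * ‖r‖) fun n => ?_]
    · have h1 := ((M.initOp ∘L M.policyOp ψ ∘L (M.stepOp ψ ^ t)) ∘L BM.mulOp a).hasSum
        (M.hasSum_valueOp ψ r)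
      simp only [ContinuousLinearMap.comp_apply, BM.mulOp_apply, map_smul,
        smul_eq_mul] at h1
      rw [← h1.tsum_eq]
      refine tsum_congr fun τ => ?_
      rw [← mul_assoc, ← mul_pow, Real.mul_self_sqrt hγ₀.le]
    · rw [abs_mul, abs_of_nonneg (by positivity)]
      exact (mul_le_of_le_one_left (abs_nonneg _) (pow_le_one₀ hs0 hs1.le)).trans (hc t n)
  simp only [hinner, sub_sub_cancel, smul_eq_mul]
  rw [meanPairing, ← ha, ← hr, ← (M.hasSum_occOp ψ (a * M.valueOp ψ r)).tsum_eq, ← tsum_mul_left]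
  refine tsum_congr fun t => ?_
  have : 1 - M.discount ≠ 0 := by linarith
  field_simp

end Model

namespace Model

variable {ι : Type*} [Fintype ι] [DecidableEq ι] {G : SimpleGraph ι} {κ d : ℕ}
  {S A : ι → Type*} [∀ i, MeasurableSpace (S i)] [∀ i, MeasurableSpace (A i)]

/-! ### Smoothness of the objective -/

theorem sum_norm_le_card_mul (x : Params ι d) : ∑ i, ‖x i‖ ≤ Fintype.card ι * ‖x‖ :=
  (Finset.sum_le_sum fun i _ => PiLp.norm_apply_le x i).trans_eq (by simp)

theorem norm_le_card_mul {x : Params ι d} {b : ℝ} (hb : 0 ≤ b) (h : ∑ i, inner ℝ (x i) (x i) ≤ b * ∑ i, ‖x i‖) :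
    ‖x‖ ≤ Fintype.card ι * b := by
  have h1 : ‖x‖ * ‖x‖ ≤ (Fintype.card ι * b) * ‖x‖ := by
    rw [← real_inner_self_eq_norm_mul_norm, PiLp.inner_apply]
    calc _ ≤ b * ∑ i, ‖x i‖ := h
      _ ≤ b * (Fintype.card ι * ‖x‖) := by gcongr; exact sum_norm_le_card_mul x
      _ = _ := by ring
  rcases (norm_nonneg x).eq_or_lt with h0 | h0
  · rw [← h0]; positivity
  · exact le_of_mul_le_mul_right h1 h0

theorem norm_le_card_mul_of_forall {x : Params ι d} {b : ℝ} (hb : 0 ≤ b) (h : ∀ i, ‖x i‖ ≤ b) :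
    ‖x‖ ≤ Fintype.card ι * b :=
  norm_le_card_mul hb (by
    rw [Finset.mul_sum]
    refine Finset.sum_le_sum fun i _ => ?_
    rw [real_inner_self_eq_norm_mul_norm]
    exact mul_le_mul_of_nonneg_right (h i) (norm_nonneg _))

/-- A bound for the quadratic remainder of the objective. -/
def smoothConst (N : ℕ) (γ R B L : ℝ) : ℝ :=
  5 * (1 / (1 - γ)) ^ 3 * lipConst N B L ^ 2 * (N * R)

theorem abs_J_expansion_le {M : Model G κ d S A} {B L R : ℝ} (hB : 0 ≤ B) (hL : 0 ≤ L)
    (hR₀ : 0 ≤ R) (hMB : M.LogGradBound B) (hML : M.LogGradLipschitz L) (hR : M.RewardBound R)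
    (θ θ' : Params ι d) :
    |M.J θ' - M.J θ - inner ℝ (M.meanGrad fun _ => θ) (θ' - θ)| ≤
      smoothConst (Fintype.card ι) M.discount R B L * ‖θ' - θ‖ ^ 2 := by
  have hg := M.one_le_horizon
  have hk : 0 ≤ lipConst (Fintype.card ι) B L := zero_le_one.trans (one_le_lipConst _ hB hL)
  have h1 : inner ℝ (M.meanGrad fun _ => θ) (θ' - θ) =
      (1 / (Fintype.card ι : ℝ)) * M.occOp (fun _ => θ)
        (M.scoreFn hB hMB (fun _ => θ) ((fun _ => θ') - fun _ => θ) *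
          M.valueOp (fun _ => θ) (∑ l, M.rewardFn hR l)) := by
    have h2 := sum_meanPairing_diag hB hL hMB hML hR θ (θ' - θ)
    refine Eq.trans ?_ h2
    rw [PiLp.inner_apply]
    refine Finset.sum_congr rfl fun i _ => ?_
    rw [← inner_meanGrad hB hR₀ hMB hR]
    exact real_inner_comm _ _
  rw [h1, M.J_eq_occOp hR, M.J_eq_occOp hR, ← mul_sub, ← mul_sub, abs_mul,
    abs_of_nonneg (by positivity)]
  refine (mul_le_of_le_one_left (abs_nonneg _) one_div_card_le_one).trans ?_
  refine (abs_occOp_expansion_le hB hL hMB hML (fun _ => θ) (fun _ => θ') _).trans ?_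
  have h3 : ‖(fun _ : ι => θ') - fun _ => θ‖ ≤ ‖θ' - θ‖ := pi_norm_const_le (θ' - θ)
  calc _ ≤ 5 * (1 / (1 - M.discount)) ^ 3 * lipConst (Fintype.card ι) B L ^ 2 * ‖θ' - θ‖ ^ 2 *
        (Fintype.card ι * R) := by
        gcongr
        exact M.norm_sum_rewardFn_le hR₀ hR _
    _ = _ := by rw [smoothConst]; ring

/-- The truncated stochastic gradients are unbiased when all copies agree. -/
theorem hasGradientAt_J {M : Model G κ d S A} {B L R : ℝ} (hB : 0 ≤ B) (hL : 0 ≤ L)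
    (hR₀ : 0 ≤ R) (hMB : M.LogGradBound B) (hML : M.LogGradLipschitz L) (hR : M.RewardBound R)
    (θ : Params ι d) : HasGradientAt M.J (M.meanGrad fun _ => θ) θ := by
  rw [hasGradientAt_iff_isLittleO]
  have h1 : (fun θ' => M.J θ' - M.J θ - inner ℝ (M.meanGrad fun _ => θ) (θ' - θ)) =O[nhds θ]
      fun θ' => ‖θ' - θ‖ ^ 2 :=
    Asymptotics.IsBigO.of_bound (smoothConst (Fintype.card ι) M.discount R B L)
      (Filter.Eventually.of_forall fun θ' => by
        rw [Real.norm_eq_abs, Real.norm_of_nonneg (by positivity)]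
        exact abs_J_expansion_le hB hL hR₀ hMB hML hR θ θ')
  refine h1.trans_isLittleO ?_
  have h2 : Filter.Tendsto (fun θ' => θ' - θ) (nhds θ) (nhds 0) :=
    (continuous_sub_right θ).tendsto' θ 0 (sub_self θ)
  exact (Asymptotics.isLittleO_norm_pow_id one_lt_two).comp_tendsto h2

theorem norm_meanGrad_le {M : Model G κ d S A} {B R : ℝ} (hB : 0 ≤ B)
    (hR₀ : 0 ≤ R) (hMB : M.LogGradBound B) (hR : M.RewardBound R) (ψ : ι → Params ι d) :
    ‖M.meanGrad ψ‖ ≤ Fintype.card ι * gradBound (Fintype.card ι) M.discount R B := by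
  have hb : ∀ i, ‖M.meanGrad ψ i‖ ≤ gradBound (Fintype.card ι) M.discount R B := fun i => by
    have := norm_integral_le_of_norm_le_const (μ := M.sampleKernel ψ) (f := M.estGrad i ψ)
      (Filter.Eventually.of_forall (norm_estGrad_le hB hR₀ hMB hR i ψ))
    rw [probReal_univ, mul_one] at this
    exact this
  rcases isEmpty_or_nonempty ι with h | ⟨⟨i⟩⟩
  · have : M.meanGrad ψ = 0 := by ext i; exact h.elim i
    simp [this]
  · exact norm_le_card_mul_of_forall ((norm_nonneg _).trans (hb i)) hb

theorem norm_meanGrad_sub_le {M : Model G κ d S A} {B L R : ℝ} (hB : 0 ≤ B) (hL : 0 ≤ L)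
    (hR₀ : 0 ≤ R) (hMB : M.LogGradBound B) (hML : M.LogGradLipschitz L) (hR : M.RewardBound R)
    (ψ ψ' : ι → Params ι d) :
    ‖M.meanGrad ψ' - M.meanGrad ψ‖ ≤
      Fintype.card ι * (meanLip (Fintype.card ι) M.discount R B L * ‖ψ' - ψ‖) := by
  have hg := M.one_le_horizon
  have hk : 0 ≤ lipConst (Fintype.card ι) B L := zero_le_one.trans (one_le_lipConst _ hB hL)
  have hm : 0 ≤ meanLip (Fintype.card ι) M.discount R B L := by unfold meanLip; positivity
  refine norm_le_card_mul (by positivity) ?_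
  rw [Finset.mul_sum]
  refine Finset.sum_le_sum fun i _ => ?_
  have h1 : inner ℝ ((M.meanGrad ψ' - M.meanGrad ψ) i) ((M.meanGrad ψ' - M.meanGrad ψ) i) =
      M.meanPairing hB hMB hR ψ' i ((M.meanGrad ψ' - M.meanGrad ψ) i) -
        M.meanPairing hB hMB hR ψ i ((M.meanGrad ψ' - M.meanGrad ψ) i) := by
    rw [← inner_meanGrad hB hR₀, ← inner_meanGrad hB hR₀, ← inner_sub_right]
    rfl
  rw [h1]
  exact (le_abs_self _).trans (abs_meanPairing_sub_le hB hL hR₀ hMB hML hR ψ ψ' i _)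

theorem abs_J_le {M : Model G κ d S A} {R : ℝ} (hR₀ : 0 ≤ R) (hR : M.RewardBound R)
    (θ : Params ι d) : |M.J θ| ≤ 1 / (1 - M.discount) * (Fintype.card ι * R) := by
  have hg := M.one_le_horizon
  rw [M.J_eq_occOp hR, abs_mul, abs_of_nonneg (by positivity)]
  refine (mul_le_of_le_one_left (abs_nonneg _) one_div_card_le_one).trans ?_
  refine ((M.occOp fun _ => θ).le_opNorm _).trans ?_
  gcongr
  · exact M.norm_occOp_le _
  · exact M.norm_sum_rewardFn_le hR₀ hR _

end Model

/-! ### Contraction of the averaging step -/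

section Consensus

variable {ι : Type*} [Fintype ι] [DecidableEq ι] (G : SimpleGraph ι)

/-- The size of the direct neighbourhood of agent `i`, as a real number. -/
def deg (i : ι) : ℝ := (nbhd G 1 i).card

theorem one_le_deg (i : ι) : 1 ≤ deg G i := by
  have : i ∈ nbhd G 1 i := by rw [Model.mem_nbhd]; simp
  have h : 1 ≤ (nbhd G 1 i).card := Finset.card_pos.2 ⟨i, this⟩
  exact Nat.one_le_cast.2 h

theorem deg_pos (i : ι) : 0 < deg G i := zero_lt_one.trans_le (one_le_deg G i)

theorem deg_le (i : ι) : deg G i ≤ Fintype.card ι := Nat.cast_le.2 (Finset.card_le_univ _)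

theorem weight_of_mem {i l : ι} (h : l ∈ nbhd G 1 i) : weight G i l = (deg G l)⁻¹ := by
  rw [weight, if_pos (Model.mem_nbhd_comm.1 h), one_div]; rfl

theorem weight_of_notMem {i l : ι} (h : l ∉ nbhd G 1 i) : weight G i l = 0 := by
  rw [weight, if_neg fun h' => h (Model.mem_nbhd_comm.1 h')]

theorem weight_nonneg (i l : ι) : 0 ≤ weight G i l := by
  unfold weight; split_ifs <;> positivity

theorem weight_le_one (i l : ι) : weight G i l ≤ 1 := by
  by_cases h : l ∈ nbhd G 1 i
  · rw [weight_of_mem G h]; exact inv_le_one_of_one_le₀ (one_le_deg G l)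
  · rw [weight_of_notMem G h]; exact zero_le_one

theorem sum_weight (l : ι) : ∑ i, weight G i l = 1 := by
  have h1 : ∀ i ∈ nbhd G 1 l, weight G i l = (deg G l)⁻¹ := fun i hi =>
    weight_of_mem G (Model.mem_nbhd_comm.1 hi)
  rw [← Finset.sum_subset (Finset.subset_univ (nbhd G 1 l)) fun i _ hi =>
    weight_of_notMem G fun h => hi (Model.mem_nbhd_comm.1 h), Finset.sum_congr rfl h1,
    Finset.sum_const, nsmul_eq_mul]
  exact mul_inv_cancel₀ (deg_pos G l).ne'

/-- Summing over all neighbourhoods counts every agent as often as the size of its own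
neighbourhood. -/
theorem sum_sum_nbhd (f : ι → ℝ) : ∑ i, ∑ l ∈ nbhd G 1 i, f l = ∑ l, deg G l * f l := by
  have h1 : ∀ i, ∑ l ∈ nbhd G 1 i, f l = ∑ l, if l ∈ nbhd G 1 i then f l else 0 := fun i => by
    rw [Finset.sum_ite_mem, Finset.univ_inter]
  simp only [h1]
  rw [Finset.sum_comm]
  refine Finset.sum_congr rfl fun l _ => ?_
  have h2 : ∀ i, (if l ∈ nbhd G 1 i then f l else 0) = if i ∈ nbhd G 1 l then f l else 0 :=
    fun i => if_congr Model.mem_nbhd_comm rfl rfl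
  simp only [h2]
  rw [Finset.sum_ite_mem, Finset.univ_inter, Finset.sum_const, nsmul_eq_mul]
  rfl

/-- One averaging step with the weight matrix. -/
def mix {V : Type*} [AddCommGroup V] [Module ℝ V] (y : ι → V) (i : ι) : V :=
  ∑ l ∈ nbhd G 1 i, weight G i l • y l

theorem mix_eq_sum_univ {V : Type*} [AddCommGroup V] [Module ℝ V] (y : ι → V) (i : ι) :
    mix G y i = ∑ l, weight G i l • y l :=
  Finset.sum_subset (Finset.subset_univ _) fun l _ hl => by
    rw [weight_of_notMem G hl, zero_smul]

theorem sum_mix {V : Type*} [AddCommGroup V] [Module ℝ V] (y : ι → V) :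
    ∑ i, mix G y i = ∑ l, y l := by
  simp only [mix_eq_sum_univ]
  rw [Finset.sum_comm]
  refine Finset.sum_congr rfl fun l _ => ?_
  rw [← Finset.sum_smul, sum_weight, one_smul]

theorem mix_eq {V : Type*} [AddCommGroup V] [Module ℝ V] (y : ι → V) (i : ι) :
    mix G y i = ∑ l ∈ nbhd G 1 i, (deg G l)⁻¹ • y l :=
  Finset.sum_congr rfl fun l hl => by rw [weight_of_mem G hl]

/-- The energy dissipated by one averaging step. -/
def dissipation (z : ι → ℝ) : ℝ :=
  ∑ i, ∑ l ∈ nbhd G 1 i, ((deg G l)⁻¹ * z l - (deg G i)⁻¹ * mix G z i) ^ 2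

/-- The weighted energy after one averaging step, as a variance decomposition. -/
theorem sum_sq_mix (z : ι → ℝ) :
    ∑ i, (deg G i)⁻¹ * mix G z i ^ 2 = ∑ i, (deg G i)⁻¹ * z i ^ 2 - dissipation G z := by
  have h1 : ∑ i, (deg G i)⁻¹ * z i ^ 2 = ∑ i, ∑ l ∈ nbhd G 1 i, ((deg G l)⁻¹ * z l) ^ 2 := by
    rw [sum_sum_nbhd G fun l => ((deg G l)⁻¹ * z l) ^ 2]
    refine Finset.sum_congr rfl fun i _ => ?_
    have := (deg_pos G i).ne'
    field_simp
  rw [h1, dissipation, ← Finset.sum_sub_distrib]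
  refine Finset.sum_congr rfl fun i _ => ?_
  have hd := (deg_pos G i).ne'
  have hm : mix G z i = ∑ l ∈ nbhd G 1 i, (deg G l)⁻¹ * z l := mix_eq G z i
  have h2 : ∑ l ∈ nbhd G 1 i, ((deg G l)⁻¹ * z l - (deg G i)⁻¹ * mix G z i) ^ 2 =
      ∑ l ∈ nbhd G 1 i, ((deg G l)⁻¹ * z l) ^ 2 -
        2 * ((deg G i)⁻¹ * mix G z i) * ∑ l ∈ nbhd G 1 i, (deg G l)⁻¹ * z l +
        deg G i * ((deg G i)⁻¹ * mix G z i) ^ 2 := by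
    have h3 : deg G i * ((deg G i)⁻¹ * mix G z i) ^ 2 =
        ∑ l ∈ nbhd G 1 i, ((deg G i)⁻¹ * mix G z i) ^ 2 := by
      rw [Finset.sum_const, nsmul_eq_mul]; rfl
    rw [h3, Finset.mul_sum, ← Finset.sum_sub_distrib, ← Finset.sum_add_distrib]
    exact Finset.sum_congr rfl fun l _ => by ring
  rw [h2, ← hm]
  field_simp
  ring

theorem dissipation_nonneg (z : ι → ℝ) : 0 ≤ dissipation G z :=
  Finset.sum_nonneg fun _ _ => Finset.sum_nonneg fun _ _ => sq_nonneg _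

variable {G}

/-- On a connected graph only multiples of the neighbourhood sizes dissipate no energy. -/
theorem eq_zero_of_dissipation_eq_zero (hG : G.Connected) {z : ι → ℝ} (h0 : ∑ i, z i = 0)
    (h : dissipation G z = 0) : z = 0 := by
  have hloc : ∀ i, ∀ l ∈ nbhd G 1 i, (deg G l)⁻¹ * z l = (deg G i)⁻¹ * mix G z i := by
    intro i l hl
    have h1 := (Finset.sum_eq_zero_iff_of_nonneg fun i _ =>
      Finset.sum_nonneg fun l _ => sq_nonneg _).1 h i (Finset.mem_univ i)
    have h2 := (Finset.sum_eq_zero_iff_of_nonneg fun l _ => sq_nonneg _).1 h1 l hl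
    exact sub_eq_zero.1 (pow_eq_zero_iff two_ne_zero |>.1 h2)
  have hadj : ∀ i j, G.Adj i j → (deg G i)⁻¹ * z i = (deg G j)⁻¹ * z j := by
    intro i j hij
    rw [hloc i i (by rw [Model.mem_nbhd]; simp), hloc i j (by
      rw [Model.mem_nbhd, SimpleGraph.edist_eq_one_iff_adj.2 hij]; simp)]
  have hconst : ∀ i j, (deg G i)⁻¹ * z i = (deg G j)⁻¹ * z j := by
    intro i j
    obtain ⟨w⟩ := hG.preconnected i j
    induction w with
    | nil => rfl
    | cons hij _ ih => exact (hadj _ _ hij).trans ih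
  funext i
  have hz : ∀ j, z j = ((deg G i)⁻¹ * z i) * deg G j := fun j => by
    rw [hconst i j]
    have := (deg_pos G j).ne'
    field_simp
  rw [Finset.sum_congr rfl fun j _ => hz j, ← Finset.mul_sum] at h0
  have hpos : 0 < ∑ j, deg G j := Finset.sum_pos (fun j _ => deg_pos G j) ⟨i, Finset.mem_univ i⟩
  have h1 := (mul_eq_zero.1 h0).resolve_right hpos.ne'
  exact (mul_eq_zero.1 h1).resolve_left (inv_pos.2 (deg_pos G i)).ne'

/-- Spectral gap of the averaging step on vectors with sum zero, by compactness of the unit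
sphere. -/
theorem exists_gap (hG : G.Connected) : ∃ ρ : ℝ, 0 ≤ ρ ∧ ρ < 1 ∧ ∀ z : ι → ℝ, ∑ i, z i = 0 →
    ∑ i, (deg G i)⁻¹ * mix G z i ^ 2 ≤ ρ * ∑ i, (deg G i)⁻¹ * z i ^ 2 := by
  let E : (ι → ℝ) → ℝ := fun z => ∑ i, (deg G i)⁻¹ * z i ^ 2
  have hE0 : ∀ z, 0 ≤ E z := fun z => Finset.sum_nonneg fun i _ =>
    mul_nonneg (inv_nonneg.2 (deg_pos G i).le) (sq_nonneg _)
  have hEc : Continuous E := by fun_prop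
  have hmixc : ∀ i, Continuous fun z : ι → ℝ => mix G z i := fun i => by unfold mix; fun_prop
  have hDc : Continuous (dissipation G) := by unfold dissipation; fun_prop
  have hterm : ∀ z i, (deg G i)⁻¹ * z i ^ 2 ≤ E z := fun z i =>
    Finset.single_le_sum (f := fun i => (deg G i)⁻¹ * z i ^ 2)
      (fun i _ => mul_nonneg (inv_nonneg.2 (deg_pos G i).le) (sq_nonneg _)) (Finset.mem_univ i)
  have hEz : ∀ z, E z = 0 → z = 0 := fun z h => by
    funext i
    have h1 := (hterm z i).trans_eq h
    have h2 : z i ^ 2 ≤ 0 := by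
      by_contra hc
      exact absurd h1 (not_le.2 (mul_pos (inv_pos.2 (deg_pos G i)) (not_le.1 hc)))
    exact pow_eq_zero_iff two_ne_zero |>.1 (le_antisymm h2 (sq_nonneg _))
  let K : Set (ι → ℝ) := {z | ∑ i, z i = 0 ∧ E z = 1}
  have hK : IsCompact K := by
    refine Metric.isCompact_of_isClosed_isBounded ?_ ?_
    · exact (isClosed_eq (by fun_prop) continuous_const).inter (isClosed_eq hEc continuous_const)
    · refine (Metric.isBounded_closedBall (x := (0 : ι → ℝ)) (r := Fintype.card ι)).subset fun z hz => ?_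
      rw [mem_closedBall_zero_iff, pi_norm_le_iff_of_nonneg (by positivity)]
      intro i
      have h1 := (hterm z i).trans_eq hz.2
      rw [inv_mul_le_iff₀ (deg_pos G i), mul_one] at h1
      have h2 := deg_le G i
      have h3 := one_le_deg G i
      refine abs_le_of_sq_le_sq (h1.trans (by nlinarith)) (by positivity)
  have hmixs : ∀ (c : ℝ) (z : ι → ℝ) i, mix G (c • z) i = c * mix G z i := fun c z i => by
    simp only [mix, Finset.mul_sum, Pi.smul_apply, smul_eq_mul]
    exact Finset.sum_congr rfl fun l _ => by ring
  have hDs : ∀ (c : ℝ) (z : ι → ℝ), dissipation G (c • z) = c ^ 2 * dissipation G z := fun c z => by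
    simp only [dissipation, hmixs, Finset.mul_sum, Pi.smul_apply, smul_eq_mul]
    exact Finset.sum_congr rfl fun i _ => Finset.sum_congr rfl fun l _ => by ring
  have hEs : ∀ (c : ℝ) (z : ι → ℝ), E (c • z) = c ^ 2 * E z := fun c z => by
    simp only [E, Finset.mul_sum, Pi.smul_apply, smul_eq_mul]
    exact Finset.sum_congr rfl fun i _ => by ring
  have hmem : ∀ z : ι → ℝ, ∑ i, z i = 0 → E z ≠ 0 → (√(E z))⁻¹ • z ∈ K := fun z hz hE => by
    constructor
    · simp only [Pi.smul_apply, smul_eq_mul, ← Finset.mul_sum, hz, mul_zero]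
    · rw [hEs, inv_pow, Real.sq_sqrt (hE0 z), inv_mul_cancel₀ hE]
  -- The least dissipation on the unit sphere is the gap.
  obtain ⟨m, hm, hmK⟩ : ∃ m : ℝ, 0 < m ∧ ∀ z ∈ K, m ≤ dissipation G z := by
    rcases K.eq_empty_or_nonempty with h | h
    · exact ⟨1, one_pos, fun z hz => by rw [h] at hz; exact hz.elim⟩
    · obtain ⟨z, hz, hmin⟩ := hK.exists_isMinOn h hDc.continuousOn
      refine ⟨dissipation G z, (dissipation_nonneg G z).lt_of_ne fun h0 => ?_,
        fun z' hz' => hmin hz'⟩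
      have := eq_zero_of_dissipation_eq_zero hG hz.1 h0.symm
      have h1 := hz.2
      rw [this] at h1
      simp [E] at h1
  refine ⟨max (1 - m) 0, le_max_right _ _, max_lt (by linarith) one_pos, fun z hz => ?_⟩
  rw [sum_sq_mix]
  change E z - dissipation G z ≤ max (1 - m) 0 * E z
  have hD : m * E z ≤ dissipation G z := by
    by_cases hE : E z = 0
    · rw [hE, mul_zero]; exact dissipation_nonneg G z
    · have h1 := hmK _ (hmem z hz hE)
      rw [hDs, inv_pow, Real.sq_sqrt (hE0 z)] at h1
      rwa [← div_eq_inv_mul, le_div_iff₀ ((hE0 z).lt_of_ne (Ne.symm hE))] at h1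
  have h2 : (1 - m) * E z ≤ max (1 - m) 0 * E z :=
    mul_le_mul_of_nonneg_right (le_max_left _ _) (hE0 z)
  linarith

theorem norm_sq_params {d : ℕ} (x : Params ι d) : ‖x‖ ^ 2 = ∑ j, ∑ c, x j c ^ 2 := by
  rw [PiLp.norm_sq_eq_of_L2]
  refine Finset.sum_congr rfl fun j _ => ?_
  rw [EuclideanSpace.norm_sq_eq]
  simp

/-- The spectral gap carries over from scalars to parameters, coordinate by coordinate. -/
theorem sum_norm_sq_mix_le {ρ : ℝ} (h : ∀ z : ι → ℝ, ∑ i, z i = 0 →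
    ∑ i, (deg G i)⁻¹ * mix G z i ^ 2 ≤ ρ * ∑ i, (deg G i)⁻¹ * z i ^ 2) {d : ℕ}
    {y : ι → Params ι d} (hy : ∑ i, y i = 0) :
    ∑ i, (deg G i)⁻¹ * ‖mix G y i‖ ^ 2 ≤ ρ * ∑ i, (deg G i)⁻¹ * ‖y i‖ ^ 2 := by
  have hsw : ∀ f : ι → Params ι d, ∑ i, (deg G i)⁻¹ * ‖f i‖ ^ 2 =
      ∑ j, ∑ c, ∑ i, (deg G i)⁻¹ * f i j c ^ 2 := fun f => by
    simp only [norm_sq_params, Finset.mul_sum]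
    rw [Finset.sum_comm]
    refine Finset.sum_congr rfl fun j _ => ?_
    rw [Finset.sum_comm]
  have happ : ∀ (s : Finset ι) (f : ι → Params ι d) (j : ι) (c : Fin d),
      (∑ l ∈ s, f l) j c = ∑ l ∈ s, f l j c := fun s f j c => by
    simp
  rw [hsw, hsw, Finset.mul_sum]
  refine Finset.sum_le_sum fun j _ => ?_
  rw [Finset.mul_sum]
  refine Finset.sum_le_sum fun c _ => ?_
  have h1 : ∀ i, mix G y i j c = mix G (fun l => y l j c) i := fun i => by
    rw [mix, happ]; rfl
  simp only [h1]
  refine h _ ?_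
  rw [← happ, hy]; rfl

/-- On vectors with sum zero the averaging step does not increase the weighted energy, and followed
by a perturbation it contracts with rate `q` up to `c` times the size of the perturbation. -/
def ConsensusRate (G : SimpleGraph ι) (q c : ℝ) : Prop :=
  ∀ (d : ℕ) (y e : ι → Params ι d), ∑ i, y i = 0 →
      ∑ i, (deg G i)⁻¹ * ‖mix G y i‖ ^ 2 ≤ ∑ i, (deg G i)⁻¹ * ‖y i‖ ^ 2 ∧
      ∑ i, (deg G i)⁻¹ * ‖mix G y i + e i‖ ^ 2 ≤
        q * ∑ i, (deg G i)⁻¹ * ‖y i‖ ^ 2 + c * ∑ i, ‖e i‖ ^ 2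

theorem exists_consensus_rate (hG : G.Connected) :
    ∃ q c : ℝ, 0 ≤ q ∧ q < 1 ∧ 0 ≤ c ∧ ConsensusRate G q c := by
  obtain ⟨ρ, hρ0, hρ1, hρ⟩ := exists_gap hG
  set s := (1 - ρ) / 2 with hs
  have hs0 : 0 < s := by rw [hs]; linarith
  refine ⟨(1 + ρ) / 2, 1 + s⁻¹, by linarith, by linarith, by positivity, fun d y e hy => ?_⟩
  have hE : 0 ≤ ∑ i, (deg G i)⁻¹ * ‖y i‖ ^ 2 := Finset.sum_nonneg fun i _ =>
    mul_nonneg (inv_nonneg.2 (deg_pos G i).le) (sq_nonneg _)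
  have hgap := sum_norm_sq_mix_le hρ hy
  refine ⟨hgap.trans (mul_le_of_le_one_left hE hρ1.le), ?_⟩
  have h1 : ∀ a b : Params ι d, ‖a + b‖ ^ 2 ≤ (1 + s) * ‖a‖ ^ 2 + (1 + s⁻¹) * ‖b‖ ^ 2 := by
    intro a b
    have h2 : ‖a + b‖ ^ 2 ≤ (‖a‖ + ‖b‖) ^ 2 := by gcongr; exact norm_add_le a b
    have h3 : 2 * ‖a‖ * ‖b‖ ≤ s * ‖a‖ ^ 2 + s⁻¹ * ‖b‖ ^ 2 := by
      have h4 : s * ‖a‖ ^ 2 + s⁻¹ * ‖b‖ ^ 2 - 2 * ‖a‖ * ‖b‖ = s⁻¹ * (s * ‖a‖ - ‖b‖) ^ 2 := by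
        field_simp; ring
      have h5 : 0 ≤ s⁻¹ * (s * ‖a‖ - ‖b‖) ^ 2 := by positivity
      linarith
    nlinarith
  calc _ ≤ ∑ i, ((1 + s) * ((deg G i)⁻¹ * ‖mix G y i‖ ^ 2) + (1 + s⁻¹) * ‖e i‖ ^ 2) := by
        refine Finset.sum_le_sum fun i _ => ?_
        have hd : (deg G i)⁻¹ ≤ 1 := inv_le_one_of_one_le₀ (one_le_deg G i)
        have hd0 : 0 ≤ (deg G i)⁻¹ := inv_nonneg.2 (deg_pos G i).le
        have h2 := mul_le_mul_of_nonneg_left (h1 (mix G y i) (e i)) hd0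
        have h3 : (deg G i)⁻¹ * ((1 + s⁻¹) * ‖e i‖ ^ 2) ≤ (1 + s⁻¹) * ‖e i‖ ^ 2 :=
          mul_le_of_le_one_left (by positivity) hd
        linarith
    _ = (1 + s) * ∑ i, (deg G i)⁻¹ * ‖mix G y i‖ ^ 2 + (1 + s⁻¹) * ∑ i, ‖e i‖ ^ 2 := by
        rw [Finset.sum_add_distrib, Finset.mul_sum, Finset.mul_sum]
    _ ≤ (1 + s) * (ρ * ∑ i, (deg G i)⁻¹ * ‖y i‖ ^ 2) + (1 + s⁻¹) * ∑ i, ‖e i‖ ^ 2 := by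
        gcongr
    _ ≤ _ := by
        have : (1 + s) * ρ ≤ (1 + ρ) / 2 := by rw [hs]; nlinarith
        have := mul_le_mul_of_nonneg_right this hE
        linarith

variable (G)

theorem pushSum_succ (k : ℕ) (i : ι) : pushSum G (k + 1) i = mix G (pushSum G k) i := rfl

/-- The push-sum weights stay above a multiple of the stationary weights. -/
theorem deg_div_le_pushSum (k : ℕ) (i : ι) : deg G i / Fintype.card ι ≤ pushSum G k i := by
  induction k generalizing i with
  | zero =>
    have : 0 < (Fintype.card ι : ℝ) := (deg_pos G i).trans_le (deg_le G i)
    rw [div_le_iff₀ this]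
    simpa [pushSum] using deg_le G i
  | succ k ih =>
    rw [pushSum_succ, mix_eq]
    calc deg G i / Fintype.card ι = ∑ l ∈ nbhd G 1 i, (1 / Fintype.card ι : ℝ) := by
          rw [Finset.sum_const, nsmul_eq_mul, deg]; ring
      _ ≤ _ := Finset.sum_le_sum fun l _ => by
          have h := mul_le_mul_of_nonneg_left (ih l) (inv_nonneg.2 (deg_pos G l).le)
          have hd := (deg_pos G l).ne'
          rw [smul_eq_mul]
          refine le_trans (le_of_eq ?_) h
          field_simp

theorem pushSum_pos (k : ℕ) (i : ι) : 0 < pushSum G k i := by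
  have h : 0 < (Fintype.card ι : ℝ) := (deg_pos G i).trans_le (deg_le G i)
  exact (div_pos (deg_pos G i) h).trans_le (deg_div_le_pushSum G k i)

theorem one_div_pushSum_le (k : ℕ) (i : ι) : 1 / pushSum G k i ≤ Fintype.card ι := by
  have h : 0 < (Fintype.card ι : ℝ) := (deg_pos G i).trans_le (deg_le G i)
  have h1 : 1 / (Fintype.card ι : ℝ) ≤ pushSum G k i :=
    (div_le_div_of_nonneg_right (one_le_deg G i) h.le).trans (deg_div_le_pushSum G k i)
  rw [div_le_iff₀ (pushSum_pos G k i)]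
  rwa [div_le_iff₀' h] at h1

theorem sum_pushSum (k : ℕ) : ∑ i, pushSum G k i = Fintype.card ι := by
  induction k with
  | zero => simp [pushSum]
  | succ k ih => simp only [pushSum_succ]; rw [sum_mix, ih]

theorem pushSum_le (k : ℕ) (i : ι) : pushSum G k i ≤ Fintype.card ι := by
  rw [← sum_pushSum G k]
  exact Finset.single_le_sum (fun j _ => (pushSum_pos G k j).le) (Finset.mem_univ i)

end Consensus

namespace Model

variable {ι : Type*} [Fintype ι] [DecidableEq ι] {G : SimpleGraph ι} {κ d : ℕ}
  {S A : ι → Type*} [∀ i, MeasurableSpace (S i)] [∀ i, MeasurableSpace (A i)]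

/-! ### Consensus along the algorithm -/

/-- The deviation of the intermediate variables of agent `i` from their push-sum target. -/
def deviation (G : SimpleGraph ι) (k : ℕ) (x : AlgState ι d) (i : ι) : Params ι d :=
  x.2 i - pushSum G k i • x.1

/-- The weighted energy of the deviations. -/
def consensusError (G : SimpleGraph ι) (k : ℕ) (x : AlgState ι d) : ℝ :=
  ∑ i, (deg G i)⁻¹ * ‖deviation G k x i‖ ^ 2

/-- States at time `k` whose intermediate variables carry the right total mass and are close to
consensus. -/
def NearConsensus (G : SimpleGraph ι) (k : ℕ) (ε : ℝ) (x : AlgState ι d) : Prop :=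
  ∑ i, x.2 i = (Fintype.card ι : ℝ) • x.1 ∧ consensusError G k x ≤ ε

theorem sum_deviation {k : ℕ} {ε : ℝ} {x : AlgState ι d} (h : NearConsensus G k ε x) :
    ∑ i, deviation G k x i = 0 := by
  simp only [deviation]
  rw [Finset.sum_sub_distrib, ← Finset.sum_smul, sum_pushSum, h.1, sub_self]

/-- The stochastic gradients of all agents: the parameter increment of one iteration per unit of
learning rate. -/
def gradVec (M : Model G κ d S A) (ψ : ι → Params ι d) (z : Sample S A) : Params ι d :=
  WithLp.toLp 2 fun i => M.estGrad i ψ z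

theorem nextParams_eq (M : Model G κ d S A) (k : ℕ) (η : ℝ) (x : AlgState ι d) (z : Sample S A) :
    M.nextParams k η x z = x.1 + η • M.gradVec (estimate G k x) z := rfl

theorem norm_gradVec_le {M : Model G κ d S A} {B R : ℝ} (hB : 0 ≤ B) (hR₀ : 0 ≤ R)
    (hMB : M.LogGradBound B) (hR : M.RewardBound R) (ψ : ι → Params ι d) (z : Sample S A) :
    ‖M.gradVec ψ z‖ ≤ Fintype.card ι * gradBound (Fintype.card ι) M.discount R B := by
  rcases isEmpty_or_nonempty ι with h | ⟨⟨i⟩⟩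
  · have : M.gradVec ψ z = 0 := by ext i; exact h.elim i
    simp [this]
  · exact norm_le_card_mul_of_forall ((norm_nonneg _).trans (norm_estGrad_le hB hR₀ hMB hR i ψ z))
      fun i => norm_estGrad_le hB hR₀ hMB hR i ψ z

/-- The input of agent `i` in one iteration: the own and neighbouring increments, weighted. -/
def input (G : SimpleGraph ι) (i : ι) (Δ : Params ι d) : Params ι d :=
  WithLp.toLp 2 fun j => (weight G i j * (Fintype.card ι : ℝ)) • Δ j

theorem nextAux_eq (M : Model G κ d S A) (k : ℕ) (η : ℝ) (x : AlgState ι d) (z : Sample S A)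
    (i : ι) : M.nextAux k η x z i =
      mix G x.2 i + input G i (M.nextParams k η x z - x.1) := by
  ext j c
  have h1 : (if j ∈ nbhd G 1 i then
      (weight G i j * (Fintype.card ι : ℝ)) • (M.nextParams k η x z j - x.1 j) else 0) =
      (weight G i j * (Fintype.card ι : ℝ)) • (M.nextParams k η x z j - x.1 j) := by
    split_ifs with h
    · rfl
    · rw [weight_of_notMem G h, zero_mul, zero_smul]
  simp only [nextAux, h1, mix, input]
  simp

theorem sum_input (Δ : Params ι d) : ∑ i, input G i Δ = (Fintype.card ι : ℝ) • Δ := by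
  ext j c
  have h1 : (∑ i, input G i Δ) j c = ∑ i, weight G i j * (Fintype.card ι * Δ j c) := by
    simp [input, mul_assoc]
  rw [h1, ← Finset.sum_mul, sum_weight, one_mul]
  rfl

theorem mix_deviation (k : ℕ) (x : AlgState ι d) (i : ι) :
    mix G (deviation G k x) i = mix G x.2 i - pushSum G (k + 1) i • x.1 := by
  rw [pushSum_succ, mix, mix, mix, Finset.sum_smul, ← Finset.sum_sub_distrib]
  refine Finset.sum_congr rfl fun l _ => ?_
  rw [deviation, smul_sub, smul_eq_mul, mul_smul]

/-- The target `pushSum • θ` follows the same averaging as the intermediate variables, so the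
deviations obey a perturbed averaging recursion. -/
theorem deviation_update (M : Model G κ d S A) (k : ℕ) (η : ℝ) (x : AlgState ι d)
    (z : Sample S A) (i : ι) : deviation G (k + 1) (M.update k η x z) i =
      mix G (deviation G k x) i + (input G i (M.nextParams k η x z - x.1) -
        pushSum G (k + 1) i • (M.nextParams k η x z - x.1)) := by
  rw [mix_deviation, deviation]
  change M.nextAux k η x z i - pushSum G (k + 1) i • M.nextParams k η x z = _
  rw [nextAux_eq, smul_sub]
  abel

theorem norm_input_sub_le (k : ℕ) (i : ι) (Δ : Params ι d) :
    ‖input G i Δ - pushSum G k i • Δ‖ ≤ Fintype.card ι * ‖Δ‖ := by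
  have hN : (0 : ℝ) ≤ Fintype.card ι := Nat.cast_nonneg _
  have h1 : ‖input G i Δ - pushSum G k i • Δ‖ ^ 2 ≤ (Fintype.card ι * ‖Δ‖) ^ 2 := by
    rw [mul_pow, PiLp.norm_sq_eq_of_L2, PiLp.norm_sq_eq_of_L2, Finset.mul_sum]
    refine Finset.sum_le_sum fun j _ => ?_
    have h2 : (input G i Δ - pushSum G k i • Δ) j =
        (weight G i j * (Fintype.card ι : ℝ) - pushSum G k i) • Δ j := by
      rw [sub_smul]; rfl
    rw [h2, norm_smul, mul_pow]
    gcongr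
    rw [Real.norm_eq_abs, abs_le]
    have h3 := pushSum_le G k i
    have h4 := (pushSum_pos G k i).le
    have h5 := mul_nonneg (weight_nonneg G i j) hN
    have h6 := mul_le_of_le_one_left hN (weight_le_one G i j)
    constructor <;> linarith
  exact le_of_sq_le_sq h1 (by positivity)

theorem estimate_sub_eq (k : ℕ) (x : AlgState ι d) (i : ι) :
    estimate G k x i - x.1 = (1 / pushSum G (k + 1) i) • mix G (deviation G k x) i := by
  have hp := (pushSum_pos G (k + 1) i).ne'
  rw [mix_deviation, smul_sub, smul_smul, one_div_mul_cancel hp, one_smul]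
  rfl

/-- The estimates of the agents are close to the true parameters when the deviations are small. -/
theorem norm_estimate_sub_sq_le {k : ℕ} {x : AlgState ι d}
    (h : ∑ i, (deg G i)⁻¹ * ‖mix G (deviation G k x) i‖ ^ 2 ≤ consensusError G k x) :
    ‖estimate G k x - fun _ => x.1‖ ^ 2 ≤ (Fintype.card ι : ℝ) ^ 3 * consensusError G k x := by
  have hnn : ∀ i, 0 ≤ (deg G i)⁻¹ * ‖mix G (deviation G k x) i‖ ^ 2 := fun i =>
    mul_nonneg (inv_nonneg.2 (deg_pos G i).le) (sq_nonneg _)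
  have hE : 0 ≤ consensusError G k x := (Finset.sum_nonneg fun i _ => hnn i).trans h
  have h1 : ∀ i, ‖estimate G k x i - x.1‖ ^ 2 ≤
      (Fintype.card ι : ℝ) ^ 3 * consensusError G k x := fun i => by
    have h2 := (Finset.single_le_sum (fun i _ => hnn i) (Finset.mem_univ i)).trans h
    rw [inv_mul_le_iff₀ (deg_pos G i)] at h2
    have hp := pushSum_pos G (k + 1) i
    rw [estimate_sub_eq, norm_smul, mul_pow, Real.norm_of_nonneg (by positivity)]
    calc _ ≤ (Fintype.card ι : ℝ) ^ 2 * (Fintype.card ι * consensusError G k x) := by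
          gcongr
          · exact one_div_pushSum_le G (k + 1) i
          · exact h2.trans (by gcongr; exact deg_le G i)
      _ = _ := by ring
  have h3 : ‖estimate G k x - fun _ => x.1‖ ≤
      √((Fintype.card ι : ℝ) ^ 3 * consensusError G k x) :=
    (pi_norm_le_iff_of_nonneg (Real.sqrt_nonneg _)).2 fun i => Real.le_sqrt_of_sq_le (h1 i)
  calc _ ≤ √((Fintype.card ι : ℝ) ^ 3 * consensusError G k x) ^ 2 := by gcongr
    _ = _ := Real.sq_sqrt (by positivity)

theorem NearConsensus.update {M : Model G κ d S A} {B R q c : ℝ} (hB : 0 ≤ B) (hR₀ : 0 ≤ R)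
    (hMB : M.LogGradBound B) (hR : M.RewardBound R) (hq : 0 ≤ q) (hc : 0 ≤ c)
    (hG : ConsensusRate G q c) {k : ℕ} {ε η : ℝ} {x : AlgState ι d} (h : NearConsensus G k ε x)
    (z : Sample S A) :
    NearConsensus G (k + 1) (q * ε + c * ((Fintype.card ι : ℝ) ^ 3 *
      (Fintype.card ι * gradBound (Fintype.card ι) M.discount R B) ^ 2) * η ^ 2)
      (M.update k η x z) := by
  have hΔ : M.nextParams k η x z - x.1 = η • M.gradVec (estimate G k x) z := by
    rw [nextParams_eq]; abel
  refine ⟨?_, ?_⟩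
  · change ∑ i, M.nextAux k η x z i = (Fintype.card ι : ℝ) • M.nextParams k η x z
    simp only [nextAux_eq]
    rw [Finset.sum_add_distrib, sum_mix, sum_input, h.1, ← smul_add, add_sub_cancel]
  · have h1 := (hG d (deviation G k x) (fun i => input G i (M.nextParams k η x z - x.1) -
        pushSum G (k + 1) i • (M.nextParams k η x z - x.1)) (sum_deviation h)).2
    simp only [consensusError, deviation_update]
    refine h1.trans ?_
    have h2 : ∑ i, ‖input G i (M.nextParams k η x z - x.1) -
        pushSum G (k + 1) i • (M.nextParams k η x z - x.1)‖ ^ 2 ≤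
        (Fintype.card ι : ℝ) ^ 3 *
          (Fintype.card ι * gradBound (Fintype.card ι) M.discount R B) ^ 2 * η ^ 2 := by
      calc _ ≤ ∑ _i : ι, (Fintype.card ι * (|η| *
            (Fintype.card ι * gradBound (Fintype.card ι) M.discount R B))) ^ 2 := by
            refine Finset.sum_le_sum fun i _ => ?_
            gcongr
            refine (norm_input_sub_le (k + 1) i _).trans ?_
            rw [hΔ, norm_smul, Real.norm_eq_abs]
            gcongr
            exact norm_gradVec_le hB hR₀ hMB hR _ z
        _ = _ := by
            rw [Finset.sum_const, Finset.card_univ, nsmul_eq_mul, mul_pow, mul_pow, sq_abs]; ring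
    calc _ ≤ q * ε + c * ((Fintype.card ι : ℝ) ^ 3 *
          (Fintype.card ι * gradBound (Fintype.card ι) M.discount R B) ^ 2 * η ^ 2) := by
          gcongr
          exact h.2
      _ = _ := by ring

theorem nearConsensus_zero : NearConsensus G 0 0 (0 : AlgState ι d) := by
  constructor
  · simp
  · simp [consensusError, deviation]

theorem measurableSet_nearConsensus (k : ℕ) (ε : ℝ) :
    MeasurableSet {x : AlgState ι d | NearConsensus G k ε x} := by
  have h : Measurable fun x : AlgState ι d => consensusError G k x := by
    unfold consensusError deviation
    fun_prop
  exact (measurableSet_eq_fun (by fun_prop) (by fun_prop)).inter (h measurableSet_Iic)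

/-! ### Descent along the algorithm -/

theorem dscp_eq_chain (M : Model G κ d S A) (η : ℕ → ℝ) :
    M.dscp η = chain (Measure.dirac 0) (M.iterKernel η) := rfl

theorem integral_iterKernel (M : Model G κ d S A) (η : ℕ → ℝ) (k : ℕ) (x : AlgState ι d)
    {F : AlgState ι d → ℝ} (hF : Measurable F) :
    ∫ y, F y ∂(M.iterKernel η k x) =
      ∫ z, F (M.update k (η (k + 1)) x z) ∂(M.sampleKernel (estimate G k x)) := by
  have hF' : Measurable fun y : AlgState ι d × Sample S A => F (M.update k (η (k + 1)) y.1 y.2) :=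
    hF.comp (M.measurable_update k _)
  rw [iterKernel, Kernel.map_apply _ (M.measurable_update k _),
    integral_map (M.measurable_update k _).aemeasurable hF.aestronglyMeasurable, Kernel.prod_apply,
    Kernel.id_apply, Measure.dirac_prod, integral_map (by fun_prop)
    hF'.aestronglyMeasurable]
  rfl

/-- The deterministic bound for the consensus error at time `k`. -/
def errorBound (q b : ℝ) (η : ℕ → ℝ) : ℕ → ℝ
  | 0 => 0
  | k + 1 => q * errorBound q b η k + b * η (k + 1) ^ 2

/-- The stochastic gradients are bounded, so the consensus error obeys a deterministic bound along
almost every run. -/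
theorem ae_nearConsensus {M : Model G κ d S A} {B R q c : ℝ} (hB : 0 ≤ B) (hR₀ : 0 ≤ R)
    (hMB : M.LogGradBound B) (hR : M.RewardBound R) (hq : 0 ≤ q) (hc : 0 ≤ c)
    (hG : ConsensusRate G q c) (η : ℕ → ℝ) (k : ℕ) :
    ∀ᵐ x ∂(M.dscp η), NearConsensus G k (errorBound q (c * ((Fintype.card ι : ℝ) ^ 3 *
      (Fintype.card ι * gradBound (Fintype.card ι) M.discount R B) ^ 2)) η k) (x k) := by
  set b := c * ((Fintype.card ι : ℝ) ^ 3 *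
      (Fintype.card ι * gradBound (Fintype.card ι) M.discount R B) ^ 2)
  -- The indicator of the bad set at time `k` integrates to zero.
  let bad : ℕ → AlgState ι d → ℝ := fun k =>
    {x | NearConsensus G k (errorBound q b η k) x}ᶜ.indicator 1
  have hbm : ∀ k, Measurable (bad k) := fun k =>
    measurable_one.indicator (measurableSet_nearConsensus k _).compl
  have hb0 : ∀ k x, 0 ≤ bad k x := fun k x => Set.indicator_nonneg (fun _ _ => zero_le_one) x
  have hb1 : ∀ k x, |bad k x| ≤ 1 := fun k x => by
    rw [abs_of_nonneg (hb0 k x)]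
    exact Set.indicator_le_self' (fun _ _ => zero_le_one) x
  have hbi : ∀ k, bad k = {x | NearConsensus G k (errorBound q b η k) x}ᶜ.indicator 1 :=
    fun k => rfl
  have hiff : ∀ k x, bad k x = 0 ↔ NearConsensus G k (errorBound q b η k) x := fun k x => by
    rw [hbi, Set.indicator_apply_eq_zero]
    simp
  have hmeas : ∀ k, Measurable fun x : ℕ → AlgState ι d => bad k (x k) := fun k =>
    (hbm k).comp (measurable_pi_apply k)
  have hae : ∀ k, ∫ x, bad k (x k) ∂(M.dscp η) = 0 →
      ∀ᵐ x ∂(M.dscp η), NearConsensus G k (errorBound q b η k) (x k) := fun k h => by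
    have h1 := (integral_eq_zero_iff_of_nonneg (fun x : ℕ → AlgState ι d => hb0 k (x k))
      (Integrable.of_bound (hmeas k).aestronglyMeasurable 1
        (Filter.Eventually.of_forall fun x : ℕ → AlgState ι d => hb1 k (x k)))).1 h
    filter_upwards [h1] with x hx
    exact (hiff k _).1 hx
  refine hae k ?_
  induction k with
  | zero =>
    rw [dscp_eq_chain, integral_chain_zero _ _ (hbm 0), integral_dirac]
    exact (hiff 0 0).2 nearConsensus_zero
  | succ k ih =>
    rw [dscp_eq_chain, integral_chain_next _ _ k (hbm (k + 1)) (hb1 (k + 1))]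
    refine integral_eq_zero_of_ae ?_
    have h2 := hae k ih
    rw [dscp_eq_chain] at h2
    filter_upwards [h2] with x hx
    rw [M.integral_iterKernel η k (x k) (hbm (k + 1))]
    refine integral_eq_zero_of_ae (Filter.Eventually.of_forall fun z => ?_)
    exact (hiff (k + 1) _).2 (hx.update hB hR₀ hMB hR hq hc hG z)

theorem integral_inner_gradVec {M : Model G κ d S A} {B R : ℝ} (hB : 0 ≤ B) (hR₀ : 0 ≤ R)
    (hMB : M.LogGradBound B) (hR : M.RewardBound R) (ψ : ι → Params ι d) (v : Params ι d) :
    Integrable (fun z => inner ℝ v (M.gradVec ψ z)) (M.sampleKernel ψ) ∧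
    ∫ z, inner ℝ v (M.gradVec ψ z) ∂(M.sampleKernel ψ) = inner ℝ v (M.meanGrad ψ) := by
  have hi : ∀ i, Integrable (fun z => inner ℝ (v i) (M.estGrad i ψ z)) (M.sampleKernel ψ) :=
    fun i => (integrable_estGrad hB hR₀ hMB hR i ψ).const_inner (v i)
  have h1 : ∀ z, inner ℝ v (M.gradVec ψ z) = ∑ i, inner ℝ (v i) (M.estGrad i ψ z) := fun z => by
    rw [PiLp.inner_apply]; rfl
  simp only [h1]
  refine ⟨integrable_finsetSum _ fun i _ => hi i, ?_⟩
  rw [integral_finsetSum _ fun i _ => hi i, PiLp.inner_apply]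
  exact Finset.sum_congr rfl fun i _ =>
    integral_inner (integrable_estGrad hB hR₀ hMB hR i ψ) (v i)

theorem measurable_J {M : Model G κ d S A} {B L R : ℝ} (hB : 0 ≤ B) (hL : 0 ≤ L)
    (hR₀ : 0 ≤ R) (hMB : M.LogGradBound B) (hML : M.LogGradLipschitz L) (hR : M.RewardBound R) :
    Measurable M.J :=
  (continuous_iff_continuousAt.2 fun θ =>
    (hasGradientAt_J hB hL hR₀ hMB hML hR θ).continuousAt).measurable

/-- The expected increase of the objective in one iteration. -/
theorem integral_J_update_ge {M : Model G κ d S A} {B L R : ℝ} (hB : 0 ≤ B) (hL : 0 ≤ L)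
    (hR₀ : 0 ≤ R) (hMB : M.LogGradBound B) (hML : M.LogGradLipschitz L) (hR : M.RewardBound R)
    (k : ℕ) {η : ℝ} (hη : 0 ≤ η) (x : AlgState ι d) :
    M.J x.1 + η / 2 * ‖M.meanGrad fun _ => x.1‖ ^ 2 -
      η / 2 * (Fintype.card ι * meanLip (Fintype.card ι) M.discount R B L) ^ 2 *
        ‖estimate G k x - fun _ => x.1‖ ^ 2 -
      smoothConst (Fintype.card ι) M.discount R B L *
        (Fintype.card ι * gradBound (Fintype.card ι) M.discount R B) ^ 2 * η ^ 2 ≤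
      ∫ z, M.J (M.update k η x z).1 ∂(M.sampleKernel (estimate G k x)) := by
  set ψ := estimate G k x
  set D := M.meanGrad fun _ => x.1
  set b := Fintype.card ι * gradBound (Fintype.card ι) M.discount R B
  set K := smoothConst (Fintype.card ι) M.discount R B L with hK
  have hK0 : 0 ≤ K := by
    have hg := M.one_le_horizon
    have hk : 0 ≤ lipConst (Fintype.card ι) B L := zero_le_one.trans (one_le_lipConst _ hB hL)
    rw [hK, smoothConst]; positivity
  obtain ⟨hint, hmean⟩ := integral_inner_gradVec hB hR₀ hMB hR ψ D
  have hpt : ∀ z, M.J x.1 + η * inner ℝ D (M.gradVec ψ z) - K * b ^ 2 * η ^ 2 ≤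
      M.J (M.update k η x z).1 := fun z => by
    have h1 := abs_J_expansion_le hB hL hR₀ hMB hML hR x.1 (x.1 + η • M.gradVec ψ z)
    rw [add_sub_cancel_left, inner_smul_right, norm_smul, Real.norm_of_nonneg hη] at h1
    have h2 : K * (η * ‖M.gradVec ψ z‖) ^ 2 ≤ K * b ^ 2 * η ^ 2 := by
      rw [mul_pow, mul_comm (η ^ 2), ← mul_assoc]
      gcongr
      exact norm_gradVec_le hB hR₀ hMB hR ψ z
    have h3 := (abs_le.1 h1).1
    change _ ≤ M.J (x.1 + η • M.gradVec ψ z)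
    linarith
  have hu : Measurable fun z : Sample S A => M.update k η x z :=
    (M.measurable_update k η).comp (measurable_prodMk_left (x := x))
  have hJm : Measurable fun z : Sample S A => M.J (M.update k η x z).1 :=
    (measurable_J hB hL hR₀ hMB hML hR).comp hu.fst
  have hi1 : Integrable (fun z => M.J x.1 + η * inner ℝ D (M.gradVec ψ z)) (M.sampleKernel ψ) :=
    (integrable_const _).add (hint.const_mul η)
  have hmono := integral_mono (μ := M.sampleKernel ψ) (hi1.sub (integrable_const (K * b ^ 2 * η ^ 2)))
    (Integrable.of_bound hJm.aestronglyMeasurable _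
      (Filter.Eventually.of_forall fun z => abs_J_le hR₀ hR _)) hpt
  have hval : ∫ z, M.J x.1 + η * inner ℝ D (M.gradVec ψ z) - K * b ^ 2 * η ^ 2
      ∂(M.sampleKernel ψ) = M.J x.1 + η * inner ℝ D (M.meanGrad ψ) - K * b ^ 2 * η ^ 2 := by
    rw [integral_sub hi1 (integrable_const _), integral_add (integrable_const _) (hint.const_mul η),
      integral_const_mul, hmean]
    simp
  refine le_trans ?_ (hval.symm.trans_le hmono)
  -- `2 ⟪D, D'⟫ ≥ ‖D‖² - ‖D' - D‖²` absorbs the bias of the stochastic gradient.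
  have h4 : ‖M.meanGrad ψ - D‖ ^ 2 ≤ (Fintype.card ι *
      meanLip (Fintype.card ι) M.discount R B L) ^ 2 * ‖ψ - fun _ => x.1‖ ^ 2 := by
    rw [← mul_pow, mul_assoc]
    gcongr
    exact norm_meanGrad_sub_le hB hL hR₀ hMB hML hR _ ψ
  have h5 := norm_sub_sq_real (M.meanGrad ψ) D
  rw [real_inner_comm] at h5
  have h6 : 0 ≤ ‖M.meanGrad ψ‖ ^ 2 := sq_nonneg _
  have h7 : η / 2 * (‖D‖ ^ 2 - (Fintype.card ι *
      meanLip (Fintype.card ι) M.discount R B L) ^ 2 * ‖ψ - fun _ => x.1‖ ^ 2) ≤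
      η * inner ℝ D (M.meanGrad ψ) := by
    have : η * inner ℝ D (M.meanGrad ψ) = η / 2 * (2 * inner ℝ D (M.meanGrad ψ)) := by ring
    rw [this]
    gcongr
    linarith
  linarith

/-- The consensus errors are summable as soon as the learning rates are square summable. -/
theorem sum_errorBound_le {q b : ℝ} (hq : 0 ≤ q) (hq₁ : q < 1) (hb : 0 ≤ b) (η : ℕ → ℝ) (n : ℕ) :
    (∀ k, 0 ≤ errorBound q b η k) ∧ ∑ k ∈ Finset.range n, errorBound q b η k ≤
      b / (1 - q) * ∑ k ∈ Finset.range n, η (k + 1) ^ 2 := by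
  have hnn : ∀ k, 0 ≤ errorBound q b η k := fun k => by
    induction k with
    | zero => exact le_rfl
    | succ k ih => simp only [errorBound]; positivity
  have h1q : 0 < 1 - q := by linarith
  -- Summing the recursion loses only the nonnegative last term.
  have h1 : ∀ n, ∑ k ∈ Finset.range n, errorBound q b η k + errorBound q b η n ≤
      q * ∑ k ∈ Finset.range n, errorBound q b η k + b * ∑ k ∈ Finset.range n, η (k + 1) ^ 2 := by
    intro n
    induction n with
    | zero => simp [errorBound]
    | succ n ih =>
      rw [Finset.sum_range_succ, Finset.sum_range_succ]
      simp only [errorBound]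
      linarith
  refine ⟨hnn, ?_⟩
  rw [div_mul_eq_mul_div, le_div_iff₀ h1q]
  have := h1 n
  have := hnn n
  linarith

theorem sum_sq_rate_le {C : ℝ} {η : ℕ → ℝ} (h0 : ∀ t : ℕ, 1 ≤ t → 0 < η t)
    (h : ∀ t : ℕ, 1 ≤ t → η t ≤ C / t) (n : ℕ) :
    ∑ k ∈ Finset.range n, η (k + 1) ^ 2 ≤ C ^ 2 * ∑' k : ℕ, 1 / ((k : ℝ) + 1) ^ 2 := by
  have hs : Summable fun k : ℕ => 1 / ((k : ℝ) + 1) ^ 2 := by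
    have := (summable_nat_add_iff 1).2 (Real.summable_one_div_nat_pow.2 one_lt_two)
    simpa using this
  calc _ ≤ ∑ k ∈ Finset.range n, C ^ 2 * (1 / ((k : ℝ) + 1) ^ 2) := by
        refine Finset.sum_le_sum fun k _ => ?_
        have h1 := h (k + 1) (by omega)
        have h2 := (h0 (k + 1) (by omega)).le
        push_cast at h1
        calc η (k + 1) ^ 2 ≤ (C / ((k : ℝ) + 1)) ^ 2 := by gcongr
          _ = _ := by rw [div_pow]; ring
    _ = C ^ 2 * ∑ k ∈ Finset.range n, 1 / ((k : ℝ) + 1) ^ 2 := by rw [Finset.mul_sum]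
    _ ≤ _ := by
        gcongr
        exact hs.sum_le_tsum _ fun k _ => by positivity

/-- The bound for the sum of the weighted expected squared gradients: the range of the objective,
the accumulated consensus errors, and the accumulated quadratic remainders, the latter two
proportional to the square sum of the learning rates. -/
def rateConst (N : ℕ) (γ R B L C q c : ℝ) : ℝ :=
  4 * (1 / (1 - γ) * (N * R)) +
    ((N * meanLip N γ R B L) ^ 2 * N ^ 3 * C *
      (c * (N ^ 3 * (N * gradBound N γ R B) ^ 2) / (1 - q)) +
    2 * smoothConst N γ R B L * (N * gradBound N γ R B) ^ 2) *
      (C ^ 2 * ∑' k : ℕ, 1 / ((k : ℝ) + 1) ^ 2)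

theorem gradient_J {M : Model G κ d S A} {B L R : ℝ} (hB : 0 ≤ B) (hL : 0 ≤ L)
    (hR₀ : 0 ≤ R) (hMB : M.LogGradBound B) (hML : M.LogGradLipschitz L) (hR : M.RewardBound R)
    (θ : Params ι d) : gradient M.J θ = M.meanGrad fun _ => θ :=
  (hasGradientAt_J hB hL hR₀ hMB hML hR θ).gradient

theorem integrable_norm_gradient_sq {M : Model G κ d S A} {B L R : ℝ} (hB : 0 ≤ B) (hL : 0 ≤ L)
    (hR₀ : 0 ≤ R) (hMB : M.LogGradBound B) (hML : M.LogGradLipschitz L) (hR : M.RewardBound R)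
    (η : ℕ → ℝ) (k : ℕ) :
    Integrable (fun x : ℕ → AlgState ι d => ‖gradient M.J (x k).1‖ ^ 2) (M.dscp η) := by
  have hm : Measurable fun θ => ‖gradient M.J θ‖ := by
    have : (fun θ => ‖gradient M.J θ‖) = fun θ => ‖fderiv ℝ M.J θ‖ := by
      funext θ; simp [gradient]
    rw [this]
    exact (measurable_fderiv ℝ M.J).norm
  have hm' : Measurable fun x : ℕ → AlgState ι d => ‖gradient M.J (x k).1‖ ^ 2 :=
    (hm.comp (measurable_fst.comp (measurable_pi_apply k))).pow_const 2
  refine Integrable.of_bound hm'.aestronglyMeasurable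
    ((Fintype.card ι * gradBound (Fintype.card ι) M.discount R B) ^ 2)
    (Filter.Eventually.of_forall fun x => ?_)
  rw [norm_pow, norm_norm, gradient_J hB hL hR₀ hMB hML hR]
  gcongr
  exact norm_meanGrad_le hB hR₀ hMB hR _

/-- Telescoping the expected increases of the bounded objective controls the expected squared
gradients. -/
theorem sum_integral_norm_gradient_sq_le {M : Model G κ d S A} {B L R C q c : ℝ} (hB : 0 ≤ B)
    (hL : 0 ≤ L) (hR₀ : 0 ≤ R) (hC : 0 ≤ C) (hMB : M.LogGradBound B) (hML : M.LogGradLipschitz L)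
    (hR : M.RewardBound R) (hq : 0 ≤ q) (hq₁ : q < 1) (hc : 0 ≤ c) (hG : ConsensusRate G q c)
    {η : ℕ → ℝ} (h0 : ∀ t : ℕ, 1 ≤ t → 0 < η t) (h : ∀ t : ℕ, 1 ≤ t → η t ≤ C / t) (n : ℕ) :
    ∑ k ∈ Finset.range n, η (k + 1) * ∫ x, ‖gradient M.J (x k).1‖ ^ 2 ∂(M.dscp η) ≤
      rateConst (Fintype.card ι) M.discount R B L C q c := by
  set N : ℝ := (Fintype.card ι : ℝ) with hN
  set b := N * gradBound (Fintype.card ι) M.discount R B with hb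
  set e := errorBound q (c * (N ^ 3 * b ^ 2)) η with he
  set K := smoothConst (Fintype.card ι) M.discount R B L with hK
  set ℓ := (N * meanLip (Fintype.card ι) M.discount R B L) ^ 2 with hℓ
  have hK0 : 0 ≤ K := by
    have hg := M.one_le_horizon
    have hk : 0 ≤ lipConst (Fintype.card ι) B L := zero_le_one.trans (one_le_lipConst _ hB hL)
    rw [hK, smoothConst]; positivity
  have hN0 : 0 ≤ N := Nat.cast_nonneg _
  have hℓ0 : 0 ≤ ℓ := sq_nonneg _
  have h1q : 0 < 1 - q := by linarith
  have hJm := measurable_J hB hL hR₀ hMB hML hR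
  have hJi : ∀ k, Integrable (fun x : ℕ → AlgState ι d => M.J (x k).1) (M.dscp η) := fun k =>
    Integrable.of_bound (hJm.comp (measurable_fst.comp
      (measurable_pi_apply k))).aestronglyMeasurable _
      (Filter.Eventually.of_forall fun x => abs_J_le hR₀ hR _)
  have hη0 : ∀ k, 0 ≤ η (k + 1) := fun k => (h0 (k + 1) (by omega)).le
  have hηC : ∀ k, η (k + 1) ≤ C := fun k => (h (k + 1) (by omega)).trans
    (div_le_self hC (by push_cast; linarith [(Nat.cast_nonneg k : (0 : ℝ) ≤ k)]))
  have hstep : ∀ k, ∫ x, M.J (x k).1 ∂(M.dscp η) +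
      η (k + 1) / 2 * ∫ x, ‖gradient M.J (x k).1‖ ^ 2 ∂(M.dscp η) -
      η (k + 1) / 2 * ℓ * (N ^ 3 * e k) - K * b ^ 2 * η (k + 1) ^ 2 ≤
      ∫ x, M.J (x (k + 1)).1 ∂(M.dscp η) := by
    intro k
    have hnext : ∫ x, M.J (x (k + 1)).1 ∂(M.dscp η) =
        ∫ x, ∫ y, M.J y.1 ∂(M.iterKernel η k (x k)) ∂(M.dscp η) :=
      integral_chain_next (Measure.dirac 0) (M.iterKernel η) k (F := fun y => M.J y.1)
        (hJm.comp measurable_fst) fun y => abs_J_le hR₀ hR _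
    rw [hnext]
    have hgi := integrable_norm_gradient_sq hB hL hR₀ hMB hML hR η k
    have hi1 := (hJi k).add (hgi.const_mul (η (k + 1) / 2))
    have hi2 := hi1.sub (integrable_const (η (k + 1) / 2 * ℓ * (N ^ 3 * e k)))
    have hi3 := hi2.sub (integrable_const (K * b ^ 2 * η (k + 1) ^ 2))
    have hval : ∫ x, (M.J (x k).1 + η (k + 1) / 2 * ‖gradient M.J (x k).1‖ ^ 2 -
        η (k + 1) / 2 * ℓ * (N ^ 3 * e k) - K * b ^ 2 * η (k + 1) ^ 2) ∂(M.dscp η) =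
        ∫ x, M.J (x k).1 ∂(M.dscp η) +
        η (k + 1) / 2 * ∫ x, ‖gradient M.J (x k).1‖ ^ 2 ∂(M.dscp η) -
        η (k + 1) / 2 * ℓ * (N ^ 3 * e k) - K * b ^ 2 * η (k + 1) ^ 2 := by
      rw [← integral_const_mul, ← integral_add (hJi k) (hgi.const_mul (η (k + 1) / 2))]
      refine (integral_sub hi2 (integrable_const _)).trans ?_
      congr 1
      · refine (integral_sub hi1 (integrable_const _)).trans ?_
        congr 1
        simp
      · simp
    rw [← hval]
    have hright : Integrable (fun x : ℕ → AlgState ι d =>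
        ∫ y, M.J y.1 ∂(M.iterKernel η k (x k))) (M.dscp η) := by
      refine Integrable.of_bound (C := 1 / (1 - M.discount) * (Fintype.card ι * R)) ?_
        (Filter.Eventually.of_forall fun x => ?_)
      · have hsm := (hJm.comp (measurable_fst (α := Params ι d)
          (β := ι → Params ι d))).stronglyMeasurable.integral_kernel (κ := M.iterKernel η k)
        exact (hsm.measurable.comp (measurable_pi_apply k)).aestronglyMeasurable
      · have := norm_integral_le_of_norm_le_const (μ := M.iterKernel η k (x k))
          (f := fun y => M.J y.1) (Filter.Eventually.of_forall fun y => abs_J_le hR₀ hR y.1)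
        simpa using this
    refine integral_mono_ae hi3 hright ?_
    filter_upwards [ae_nearConsensus hB hR₀ hMB hR hq hc hG η k] with x hx
    rw [M.integral_iterKernel η k (x k) (F := fun y => M.J y.1) (hJm.comp measurable_fst)]
    refine le_trans ?_ (integral_J_update_ge hB hL hR₀ hMB hML hR k (hη0 k) (x k))
    have h1 := norm_estimate_sub_sq_le ((hG d _ 0 (sum_deviation hx)).1)
    have h2 : ‖estimate G k (x k) - fun _ => (x k).1‖ ^ 2 ≤ N ^ 3 * e k :=
      h1.trans (mul_le_mul_of_nonneg_left hx.2 (by positivity))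
    have h3 := mul_le_mul_of_nonneg_left h2
      (mul_nonneg (div_nonneg (hη0 k) zero_le_two) hℓ0)
    rw [← gradient_J hB hL hR₀ hMB hML hR]
    change M.J (x k).1 + η (k + 1) / 2 * ‖gradient M.J (x k).1‖ ^ 2 -
        η (k + 1) / 2 * ℓ * (N ^ 3 * e k) - K * b ^ 2 * η (k + 1) ^ 2 ≤ _
    linarith
  have htel : ∀ n, ∑ k ∈ Finset.range n, η (k + 1) * ∫ x, ‖gradient M.J (x k).1‖ ^ 2 ∂(M.dscp η) ≤
      2 * (∫ x, M.J (x n).1 ∂(M.dscp η) - ∫ x, M.J (x 0).1 ∂(M.dscp η)) +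
      ℓ * N ^ 3 * C * ∑ k ∈ Finset.range n, e k +
      2 * K * b ^ 2 * ∑ k ∈ Finset.range n, η (k + 1) ^ 2 := by
    have hbb : 0 ≤ c * (N ^ 3 * b ^ 2) := by positivity
    intro n
    induction n with
    | zero => simp
    | succ n ih =>
      rw [Finset.sum_range_succ, Finset.sum_range_succ, Finset.sum_range_succ]
      have h1 := hstep n
      have he0 : 0 ≤ e n := (sum_errorBound_le hq hq₁ hbb η n).1 n
      have h2 : η (n + 1) * (ℓ * N ^ 3 * e n) ≤ C * (ℓ * N ^ 3 * e n) := by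
        gcongr
        exact hηC n
      linarith
  have hJb : ∀ k, |∫ x, M.J (x k).1 ∂(M.dscp η)| ≤ 1 / (1 - M.discount) * (N * R) := fun k => by
    have := norm_integral_le_of_norm_le_const (μ := M.dscp η)
      (f := fun x : ℕ → AlgState ι d => M.J (x k).1)
      (Filter.Eventually.of_forall fun x => abs_J_le hR₀ hR _)
    simpa using this
  have hsq := sum_sq_rate_le h0 h n
  have hbb : 0 ≤ c * (N ^ 3 * b ^ 2) := by positivity
  have herr := (sum_errorBound_le hq hq₁ hbb η n).2
  set Z := C ^ 2 * ∑' k : ℕ, 1 / ((k : ℝ) + 1) ^ 2 with hZ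
  have h5 : ∑ k ∈ Finset.range n, e k ≤ c * (N ^ 3 * b ^ 2) / (1 - q) * Z :=
    herr.trans (by gcongr)
  calc _ ≤ _ := htel n
    _ ≤ 4 * (1 / (1 - M.discount) * (N * R)) +
        ℓ * N ^ 3 * C * (c * (N ^ 3 * b ^ 2) / (1 - q) * Z) + 2 * K * b ^ 2 * Z := by
        have h6 := (abs_le.1 (hJb n)).2
        have h7 := (abs_le.1 (hJb 0)).1
        have h8 : 2 * (∫ x, M.J (x n).1 ∂(M.dscp η) - ∫ x, M.J (x 0).1 ∂(M.dscp η)) ≤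
            4 * (1 / (1 - M.discount) * (N * R)) := by linarith
        gcongr
    _ = _ := by rw [rateConst]; ring

end Model

end

end DSCP

theorem mainTheorem1 {ι : Type*} [Fintype ι] [DecidableEq ι] (G : SimpleGraph ι)
    (hG : G.Connected) (γ R B L C : ℝ) (hγ₀ : 0 < γ) (hγ₁ : γ < 1) (hR : 0 < R) (hB : 0 < B)
    (hL : 0 ≤ L) (hC : 0 < C) :
    ∃ Jsup : ℕ → ℕ → ℝ,
      (∀ m n, 0 < Jsup m n) ∧ (∀ n, StrictMono fun m => Jsup m n) ∧ (∀ m, StrictMono (Jsup m)) ∧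
      ∀ (κ d : ℕ), 1 ≤ κ →
      ∀ (S A : ι → Type*) [∀ i, MeasurableSpace (S i)] [∀ i, MeasurableSpace (A i)]
        (M : DSCP.Model G κ d S A),
        M.discount = γ → M.RewardBound R → M.LogGradBound B → M.LogGradLipschitz L →
      ∀ η : ℕ → ℝ, (∀ t : ℕ, 1 ≤ t → 0 < η t) → (∀ t : ℕ, 1 ≤ t → η t ≤ C / t) →
        Differentiable ℝ M.J ∧
        (∀ t : ℕ, 1 ≤ t →
          Integrable (fun x => ‖gradient M.J (DSCP.Model.param t x)‖ ^ 2) (M.dscp η)) ∧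
        (∀ T : ℕ, 2 ≤ T →
          (∫ x, ∑ t ∈ Finset.Ico 1 T, η t * ‖gradient M.J (DSCP.Model.param t x)‖ ^ 2 ∂(M.dscp η)) /
              ∑ t ∈ Finset.Ico 1 T, η t
            ≤ Jsup (DSCP.maxNbhd G κ) (DSCP.maxNbhd G (κ + 1)) / ∑ t ∈ Finset.Ico 1 T, η t) ∧
        (Filter.Tendsto (fun T : ℕ => ∑ t ∈ Finset.Ico 1 T, η t) Filter.atTop Filter.atTop →
          Filter.Tendsto (fun T : ℕ =>
            (∫ x, ∑ t ∈ Finset.Ico 1 T,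
                η t * ‖gradient M.J (DSCP.Model.param t x)‖ ^ 2 ∂(M.dscp η)) /
              ∑ t ∈ Finset.Ico 1 T, η t) Filter.atTop (nhds 0)) := by
  obtain ⟨q, c, hq, hq₁, hc, hrate⟩ := DSCP.exists_consensus_rate hG
  -- Neighbourhood sizes are at most `N`, so one constant serves them all; the summands `m` and `n`
  -- make it strictly increasing.
  set K := |DSCP.Model.rateConst (Fintype.card ι) γ R B L C q c| + 1 with hK
  have hK0 : 0 < K := by positivity
  refine ⟨fun m n => K + m + n, fun m n => by positivity, fun n m m' h => ?_,
    fun m n n' h => ?_, ?_⟩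
  · have : (m : ℝ) < m' := by exact_mod_cast h
    simp only; linarith
  · have : (n : ℝ) < n' := by exact_mod_cast h
    simp only; linarith
  intro κ d _ S A _ _ M hMγ hMR hMB hML η h0 h
  subst hMγ
  have hint : ∀ t : ℕ,
      Integrable (fun x => ‖gradient M.J (DSCP.Model.param t x)‖ ^ 2) (M.dscp η) := fun t =>
    DSCP.Model.integrable_norm_gradient_sq hB.le hL hR.le hMB hML hMR η (t - 1)
  have hval : ∀ T : ℕ,
      ∫ x, ∑ t ∈ Finset.Ico 1 T, η t * ‖gradient M.J (DSCP.Model.param t x)‖ ^ 2 ∂(M.dscp η) =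
        ∑ k ∈ Finset.range (T - 1), η (k + 1) * ∫ x, ‖gradient M.J (x k).1‖ ^ 2 ∂(M.dscp η) := by
    intro T
    rw [integral_finsetSum _ fun t _ => (hint t).const_mul (η t), Finset.sum_Ico_eq_sum_range]
    refine Finset.sum_congr rfl fun k _ => ?_
    rw [integral_const_mul, add_comm 1 k]
    rfl
  have hbound : ∀ T : ℕ,
      ∫ x, ∑ t ∈ Finset.Ico 1 T, η t * ‖gradient M.J (DSCP.Model.param t x)‖ ^ 2 ∂(M.dscp η) ≤
        K := fun T => by
    rw [hval T]
    refine (DSCP.Model.sum_integral_norm_gradient_sq_le hB.le hL hR.le hC.le hMB hML hMR hq hq₁ hc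
      hrate h0 h (T - 1)).trans ?_
    exact (le_abs_self _).trans (by rw [hK]; linarith)
  have hnn : ∀ T : ℕ, 0 ≤
      ∫ x, ∑ t ∈ Finset.Ico 1 T, η t * ‖gradient M.J (DSCP.Model.param t x)‖ ^ 2 ∂(M.dscp η) :=
    fun T => integral_nonneg fun x => Finset.sum_nonneg fun t ht =>
      mul_nonneg (h0 t (Finset.mem_Ico.1 ht).1).le (sq_nonneg _)
  have hsum : ∀ T : ℕ, 0 ≤ ∑ t ∈ Finset.Ico 1 T, η t := fun T =>
    Finset.sum_nonneg fun t ht => (h0 t (Finset.mem_Ico.1 ht).1).le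
  refine ⟨fun θ => (DSCP.Model.hasGradientAt_J hB.le hL hR.le hMB hML hMR θ).differentiableAt,
    fun t _ => hint t, fun T _ => ?_, fun hT => ?_⟩
  · refine div_le_div_of_nonneg_right ((hbound T).trans ?_) (hsum T)
    have h1 : (0 : ℝ) ≤ DSCP.maxNbhd G κ := Nat.cast_nonneg _
    have h2 : (0 : ℝ) ≤ DSCP.maxNbhd G (κ + 1) := Nat.cast_nonneg _
    linarith
  · exact squeeze_zero (fun T => div_nonneg (hnn T) (hsum T))
      (fun T => div_le_div_of_nonneg_right (hbound T) (hsum T)) (hT.const_div_atTop K)
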